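/- Let $k$ be a field and let $A=\bigoplus_{n\ge 0}A_n$ be a nonnegatively graded connected ($A_0=k\cdot 1\cong k$) associative unital $k$-algebra with $\dim_k A_n<\infty$ for all $n$. Put $A_{>0}=\bigoplus_{n\geq 1}A_n$ and fix a minimal presentation $A\cong T(V)/\langle R\rangle$. This means that $V$ is a positively graded vector space with a degree-preserving linear map $V\to A$ inducing an isomorphism $V\cong A_{>0}/(A_{>0}\cdot A_{>0})$; the induced algebra map is denoted by $\pi:T(V)\to A$, and its kernel by $I$; and $R\subseteq I$ is a subspace, graded for the grading of $T(V)$ induced by that of $V$, that maps isomorphically onto $I/(T(V)_{>0}\cdot I+I\cdot T(V)_{>0})$. For subspaces $X,Y$ of $T(V)$ let $X\otimes Y$ denote the subspace of $T(V)$ spanned by the products $xy$ with $x\in X$, $y\in Y$; let $V^{(N)}\subseteq T(V)$ and $R^{(N)}\subseteq T(V)$ be the $N$-fold products of $V$ and of $R$. Define subspaces $J_i\subseteq T(V)$ by $J_0=k$, $J_{2i+1}=(V\otimes J_{2i})\cap(J_{2i}\otimes V)$ and $$J_{2(i+1)}=\Big(\sum_{N\ge1}\ \bigcap_{\bar n,\bar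 m}V^{(m_1)}\otimes J_{2n_1}\otimes\cdots\otimes V^{(m_i)}\otimes J_{2n_i}\otimes V^{(m_{i+1})}\Big)\cap R^{(i+1)}$$ for $i\ge 0$, where $\bar n=(n_1,\dots,n_i)$ and $\bar m=(m_1,\dots,m_{i+1})$ run over all tuples of nonnegative integers with $n_1+\dots+n_i=i$ and $m_1+\dots+m_{i+1}=N$. Thus $J_1=V$ and $J_2=R$. The augmented multi-Koszul bimodule complex has the terms $K_{L-R}(A)_i=A\otimes_k J_i\otimes_k A$, the augmentation $\delta^b_0:A\otimes_k J_0\otimes_k A=A\otimes_k A\to A$ given by the multiplication, and differentials $\delta_i^b:K_{L-R}(A)_i\to K_{L-R}(A)_{i-1}$ ($i\ge1$) that are the $A$-bimodule maps determined as follows on $\omega\in J_i$ (identified with $1\otimes\omega\otimes 1$). * If $i=2j+1$, write $\omega=\sum v\,\omega'=\sum\omega''\,v'$ with $v,v'\in V$ and $\omega',\omega''\in J_{2j}$; then $\delta_i^b(\omega)=\sum\pi(v)\otimes\omega'\otimes1-\sum1\otimes\omega''\otimes\pi(v')$. * If $i=2j$, write $\omega=\sum_{N\geq 0}\omega^N$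 with $\omega^N\in\bigcap_{l=0}^N V^{(l)}\otimes J_{2j-1}\otimes V^{(N-l)}$, and, for each $0\le l\le N$, write $\omega^N=\sum\omega^{N,l}_{1}\,\omega^{N,l}_{2}\,\omega^{N,l}_{3}$ with $\omega^{N,l}_1\in V^{(l)}$, $\omega^{N,l}_2\in J_{2j-1}$, $\omega^{N,l}_3\in V^{(N-l)}$; then $\delta_i^b(\omega)=\sum_N\sum_{l=0}^N\sum\pi(\omega^{N,l}_1)\otimes\omega^{N,l}_2\otimes\pi(\omega^{N,l}_3)$. (These expressions exist and the right-hand sides do not depend on choices.) The augmented left, respectively right, multi-Koszul complex is obtained from the augmented bimodule complex by applying $(-)\otimes_A k$, respectively $k\otimes_A(-)$, where $k=A/A_{>0}$. The algebra $A$ is called left (respectively right) multi-Koszul if the augmented left (respectively right) multi-Koszul complex is exact, that is, if it provides a resolution of the trivial left (respectively right) $A$-module $k$. Then the following statements are equivalent: 1. $A$ is left multi-Koszul. 2. The augmented multi-Koszul bimodule complex $\delta_0^b:K_{L-R}(A)_\bullet\to A$ is exact. 3. $A$ is right multi-Koszul. -/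

import Mathlib

open scoped TensorProduct

namespace MultiKoszul

noncomputable section

variable {k : Type*} [Field k]

open Classical in
/-- A linear left inverse of an injective linear map `f` (zero if `f` is not injective). On the
range of `f` it is the inverse of `f`. -/
def linearInverse {M N : Type*} [AddCommMonoid M] [Module k M] [AddCommMonoid N] [Module k N]
    (f : M →ₗ[k] N) : N →ₗ[k] M :=
  if h : ∃ g : N →ₗ[k] M, g ∘ₗ f = LinearMap.id then h.choose else 0

lemma linearInverse_apply {M N : Type*} [AddCommMonoid M] [Module k M] [AddCommMonoid N]
    [Module k N] (f : M →ₗ[k] N) (hf : Function.Injective f) (x : M) :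
    linearInverse f (f x) = x := by
  have h : ∃ g : N →ₗ[k] M, g ∘ₗ f = LinearMap.id := by
    let _ : AddCommGroup M := Module.addCommMonoidToAddCommGroup k
    let _ : AddCommGroup N := Module.addCommMonoidToAddCommGroup k
    exact f.exists_leftInverse_of_injective (LinearMap.ker_eq_bot.2 hf)
  rw [linearInverse, dif_pos h]
  exact LinearMap.congr_fun h.choose_spec x

section TensorAlgebraSubspaces

variable {V : Type*} [AddCommGroup V] [Module k V]

variable (k V) in
/-- The copy of `V` inside the tensor algebra `T(V)`. Its powers, for the product of subspaces
of `T(V)`, are the components `V^(N)` of the tensor grading. -/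
def gens : Submodule k (TensorAlgebra k V) :=
  LinearMap.range (TensorAlgebra.ι k)

variable (k V) in
/-- The ideal `T(V)_{>0}`, the sum of all `V^(N)` with `N ≥ 1`. -/
def tensorPos : Submodule k (TensorAlgebra k V) :=
  ⨆ N : ℕ, ⨆ _ : 1 ≤ N, gens k V ^ N

/-- The usual grading of `T(V)`, induced by a grading `𝒱` of `V`: the component of degree `n` is
spanned by the words `v₁ ⋯ v_r` with `v_j` homogeneous of degree `d_j` and `∑ d_j = n`. -/
def usualDegree (𝒱 : ℕ → Submodule k V) (n : ℕ) : Submodule k (TensorAlgebra k V) :=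
  ⨆ r : ℕ, ⨆ d : Fin r → ℕ, ⨆ _ : ∑ j, d j = n,
    (List.ofFn fun j => (𝒱 (d j)).map (TensorAlgebra.ι k)).prod

/-- The spaces `J_{2i}`. Here `n` runs over the `i`-tuples and `m` over the `(i+1)`-tuples of
nonnegative integers with sum `i` and `N`, respectively; the condition `n j ≤ i`, automatic from
the sum, is built into the type of `n`. -/
def evenJ (R : Submodule k (TensorAlgebra k V)) : ℕ → Submodule k (TensorAlgebra k V)
  | 0 => 1
  | i + 1 =>
    (⨆ N : ℕ, ⨆ _ : 1 ≤ N,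
      ⨅ n : Fin i → Fin (i + 1), ⨅ _ : ∑ j, (n j : ℕ) = i,
      ⨅ m : Fin (i + 1) → ℕ, ⨅ _ : ∑ j, m j = N,
        (List.ofFn fun j : Fin i => gens k V ^ m j.castSucc * evenJ R (n j)).prod *
          gens k V ^ m (Fin.last i)) ⊓
    R ^ (i + 1)
termination_by i => i
decreasing_by exact (n j).isLt

/-- The spaces `J_{2i+1} = (V ⊗ J_{2i}) ∩ (J_{2i} ⊗ V)`. -/
def oddJ (R : Submodule k (TensorAlgebra k V)) (i : ℕ) : Submodule k (TensorAlgebra k V) :=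
  (gens k V * evenJ R i) ⊓ (evenJ R i * gens k V)

/-- The spaces `J_i`, for all `i`. -/
def spaceJ (R : Submodule k (TensorAlgebra k V)) (i : ℕ) : Submodule k (TensorAlgebra k V) :=
  if Even i then evenJ R (i / 2) else oddJ R (i / 2)

/-- The component of special degree `N`: the intersection of `V^(l) ⊗ W ⊗ V^(N-l)` over
`0 ≤ l ≤ N`. It is used for `W = J_{2j+1}`. -/
def specialPart (W : Submodule k (TensorAlgebra k V)) (N : ℕ) :
    Submodule k (TensorAlgebra k V) :=
  ⨅ l : ℕ, ⨅ _ : l ≤ N, gens k V ^ l * W * gens k V ^ (N - l)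

/-- The multiplication map `X ⊗ Y → T(V)`, for subspaces `X`, `Y` of `T(V)`. -/
def mulTwo (X Y : Submodule k (TensorAlgebra k V)) : X ⊗[k] Y →ₗ[k] TensorAlgebra k V :=
  LinearMap.mul' k (TensorAlgebra k V) ∘ₗ TensorProduct.map X.subtype Y.subtype

/-- The multiplication map `X ⊗ Y ⊗ Z → T(V)`, for subspaces `X`, `Y`, `Z` of `T(V)`. -/
def mulThree (X Y Z : Submodule k (TensorAlgebra k V)) :
    X ⊗[k] (Y ⊗[k] Z) →ₗ[k] TensorAlgebra k V :=
  LinearMap.mul' k (TensorAlgebra k V) ∘ₗ TensorProduct.map X.subtype (mulTwo Y Z)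

end TensorAlgebraSubspaces

section Bimodules

variable {A W W' : Type*} [Ring A] [Algebra k A]
  [AddCommGroup W] [Module k W] [AddCommGroup W'] [Module k W']

variable (k A W) in
/-- The `A`-bimodule `A ⊗ W ⊗ A`. -/
abbrev FreeBimod : Type _ := A ⊗[k] (W ⊗[k] A)

variable (k A W) in
/-- The left action on `A ⊗ W ⊗ A`: `a · (a' ⊗ w ⊗ b) = a a' ⊗ w ⊗ b`. -/
def leftAct : A →ₗ[k] Module.End k (FreeBimod k A W) :=
  LinearMap.rTensorHom (W ⊗[k] A) ∘ₗ LinearMap.mul k A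

variable (k A W) in
/-- The right action on `A ⊗ W ⊗ A`: `(a ⊗ w ⊗ b') · b = a ⊗ w ⊗ b' b`. -/
def rightAct : A →ₗ[k] Module.End k (FreeBimod k A W) :=
  LinearMap.lTensorHom A ∘ₗ LinearMap.lTensorHom W ∘ₗ (LinearMap.mul k A).flip

@[simp] lemma leftAct_tmul (a a' b : A) (w : W) :
    leftAct k A W a (a' ⊗ₜ (w ⊗ₜ b)) = (a * a') ⊗ₜ (w ⊗ₜ b) := rfl

@[simp] lemma rightAct_tmul (a b b' : A) (w : W) :
    rightAct k A W b (a ⊗ₜ (w ⊗ₜ b')) = a ⊗ₜ (w ⊗ₜ (b' * b)) := rfl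

/-- The extension of a linear map `f : W → A ⊗ W' ⊗ A` to a map of bimodules
`A ⊗ W ⊗ A → A ⊗ W' ⊗ A`, `a ⊗ w ⊗ b ↦ a · f w · b`. -/
def extend (f : W →ₗ[k] FreeBimod k A W') : FreeBimod k A W →ₗ[k] FreeBimod k A W' :=
  TensorProduct.lift
    (LinearMap.lcomp k (FreeBimod k A W')
      (TensorProduct.lift ((rightAct k A W').flip ∘ₗ f)) ∘ₗ leftAct k A W')

@[simp] lemma extend_tmul (f : W →ₗ[k] FreeBimod k A W') (a b : A) (w : W) :
    extend f (a ⊗ₜ (w ⊗ₜ b)) = leftAct k A W' a (rightAct k A W' b (f w)) := rfl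

lemma leftAct_mul (a a' : A) (x : FreeBimod k A W) :
    leftAct k A W (a * a') x = leftAct k A W a (leftAct k A W a' x) := by
  have h : leftAct k A W (a * a') = leftAct k A W a ∘ₗ leftAct k A W a' := by
    ext b w c
    simp [mul_assoc]
  rw [h]
  rfl

lemma rightAct_mul (b b' : A) (x : FreeBimod k A W) :
    rightAct k A W (b * b') x = rightAct k A W b' (rightAct k A W b x) := by
  have h : rightAct k A W (b * b') = rightAct k A W b' ∘ₗ rightAct k A W b := by
    ext a w c
    simp [mul_assoc]
  rw [h]
  rfl

lemma leftAct_rightAct (a b : A) (x : FreeBimod k A W) :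
    leftAct k A W a (rightAct k A W b x) = rightAct k A W b (leftAct k A W a x) := by
  have h : leftAct k A W a ∘ₗ rightAct k A W b = rightAct k A W b ∘ₗ leftAct k A W a := by
    ext a' w c
    simp
  exact LinearMap.congr_fun h x

lemma extend_leftAct (f : W →ₗ[k] FreeBimod k A W') (a : A) (x : FreeBimod k A W) :
    extend f (leftAct k A W a x) = leftAct k A W' a (extend f x) := by
  have h : extend f ∘ₗ leftAct k A W a = leftAct k A W' a ∘ₗ extend f := by
    ext a' w c
    simp [leftAct_mul]
  exact LinearMap.congr_fun h x

lemma extend_rightAct (f : W →ₗ[k] FreeBimod k A W') (b : A) (x : FreeBimod k A W) :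
    extend f (rightAct k A W b x) = rightAct k A W' b (extend f x) := by
  have h : extend f ∘ₗ rightAct k A W b = rightAct k A W' b ∘ₗ extend f := by
    ext a' w c
    simp [rightAct_mul, leftAct_rightAct]
  exact LinearMap.congr_fun h x

end Bimodules

variable {A : Type*} [Ring A] [Algebra k A]

/-- The irrelevant ideal `A_{>0}` of a graded algebra. -/
def irrelevant (𝒜 : ℕ → Submodule k A) : Submodule k A :=
  ⨆ n : ℕ, ⨆ _ : 1 ≤ n, 𝒜 n

section Augmentation

variable (𝒜 : ℕ → Submodule k A) [GradedAlgebra 𝒜]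

/-- The augmentation `A → k`: the projection onto `A_0`, followed by the inverse of the
isomorphism `k → A_0` when `A` is connected. -/
def augmentation : A →ₗ[k] k :=
  linearInverse (Algebra.linearMap k A) ∘ₗ GradedAlgebra.proj 𝒜 0

lemma proj_zero_eq_zero {a : A} (ha : a ∈ irrelevant 𝒜) : GradedAlgebra.proj 𝒜 0 a = 0 := by
  have h : irrelevant 𝒜 ≤ LinearMap.ker (GradedAlgebra.proj 𝒜 0) := by
    refine iSup_le fun n => iSup_le fun hn a ha => ?_
    rw [LinearMap.mem_ker, GradedAlgebra.proj_apply,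
      DirectSum.decompose_of_mem_ne 𝒜 ha (by omega)]
  exact h ha

lemma augmentation_mul_right (x : A) {a : A} (ha : a ∈ irrelevant 𝒜) :
    augmentation 𝒜 (x * a) = 0 := by
  have h : GradedRing.projZeroRingHom 𝒜 a = 0 := proj_zero_eq_zero 𝒜 ha
  have h' : GradedAlgebra.proj 𝒜 0 (x * a) = 0 :=
    ((GradedRing.projZeroRingHom 𝒜).map_mul x a).trans (by rw [h, mul_zero])
  rw [augmentation, LinearMap.comp_apply, h', map_zero]

lemma augmentation_mul_left (x : A) {a : A} (ha : a ∈ irrelevant 𝒜) :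
    augmentation 𝒜 (a * x) = 0 := by
  have h : GradedRing.projZeroRingHom 𝒜 a = 0 := proj_zero_eq_zero 𝒜 ha
  have h' : GradedAlgebra.proj 𝒜 0 (a * x) = 0 :=
    ((GradedRing.projZeroRingHom 𝒜).map_mul a x).trans (by rw [h, zero_mul])
  rw [augmentation, LinearMap.comp_apply, h', map_zero]

end Augmentation

/-- A minimal presentation `A = T(V)/⟨R⟩` of a graded algebra: a positively graded space `V` with
a homogeneous map `gen : V → A` that induces an isomorphism `V ≃ A_{>0}/(A_{>0} · A_{>0})`, and a
space of relations `R`, that is, a graded subspace of the kernel `I` of the induced algebra map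
`π : T(V) → A` that projects isomorphically onto `I/(T(V)_{>0} · I + I · T(V)_{>0})`. -/
structure MinimalPresentation (𝒜 : ℕ → Submodule k A)
    (V : Type*) [AddCommGroup V] [Module k V] where
  grading : ℕ → Submodule k V
  grading_isInternal : DirectSum.IsInternal grading
  grading_zero : grading 0 = ⊥
  gen : V →ₗ[k] A
  gen_mem : ∀ n, ∀ v ∈ grading n, gen v ∈ 𝒜 n
  gen_injective : Function.Injective gen
  gen_disjoint : Disjoint (LinearMap.range gen) (irrelevant 𝒜 * irrelevant 𝒜)
  gen_sup : LinearMap.range gen ⊔ irrelevant 𝒜 * irrelevant 𝒜 = irrelevant 𝒜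
  rel : Submodule k (TensorAlgebra k V)
  rel_graded : rel = ⨆ n : ℕ, rel ⊓ usualDegree grading n
  rel_disjoint : Disjoint rel
    (tensorPos k V * LinearMap.ker (TensorAlgebra.lift k gen).toLinearMap ⊔
      LinearMap.ker (TensorAlgebra.lift k gen).toLinearMap * tensorPos k V)
  rel_sup : rel ⊔
    (tensorPos k V * LinearMap.ker (TensorAlgebra.lift k gen).toLinearMap ⊔
      LinearMap.ker (TensorAlgebra.lift k gen).toLinearMap * tensorPos k V) =
    LinearMap.ker (TensorAlgebra.lift k gen).toLinearMap

namespace MinimalPresentation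

variable {𝒜 : ℕ → Submodule k A} {V : Type*} [AddCommGroup V] [Module k V]
  (P : MinimalPresentation 𝒜 V)

/-- The projection `π : T(V) → A`. -/
def π : TensorAlgebra k V →ₐ[k] A := TensorAlgebra.lift k P.gen

/-- The space `J_i` attached to the presentation. -/
def J (i : ℕ) : Submodule k (TensorAlgebra k V) := spaceJ P.rel i

/-- The bimodule `A ⊗ J_i ⊗ A`. -/
abbrev K (i : ℕ) : Type _ := FreeBimod k A (P.J i)

/-- On an element `ω = ∑ v ω' = ∑ ω'' v'` of `(V ⊗ U) ∩ (U ⊗ V)` this is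
`∑ π(v) | ω' | 1 - ∑ 1 | ω'' | π(v')`. The multiplication maps `V ⊗ U → T(V)` and
`U ⊗ V → T(V)` are injective (for any `U`), and `linearInverse` inverts them. -/
def oddMap (U : Submodule k (TensorAlgebra k V)) :
    TensorAlgebra k V →ₗ[k] FreeBimod k A U :=
  TensorProduct.map (P.π.toLinearMap ∘ₗ (gens k V).subtype)
      ((TensorProduct.mk k U A).flip 1) ∘ₗ linearInverse (mulTwo (gens k V) U) -
    TensorProduct.mk k A (U ⊗[k] A) 1 ∘ₗ
      TensorProduct.map LinearMap.id (P.π.toLinearMap ∘ₗ (gens k V).subtype) ∘ₗ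
        linearInverse (mulTwo U (gens k V))

/-- On an element `ω = ∑ ω₁ ω₂ ω₃` of `V^(l) ⊗ W ⊗ V^(m)` this is `∑ π(ω₁) | ω₂ | π(ω₃)`. The
multiplication map `V^(l) ⊗ W ⊗ V^(m) → T(V)` is injective for `W = J_i`, since
`J_i ∩ J_i · T(V)_{>0} = 0`, and `linearInverse` inverts it. -/
def cut (W : Submodule k (TensorAlgebra k V)) (l m : ℕ) :
    TensorAlgebra k V →ₗ[k] FreeBimod k A W :=
  TensorProduct.map (P.π.toLinearMap ∘ₗ (gens k V ^ l).subtype)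
      (TensorProduct.map LinearMap.id (P.π.toLinearMap ∘ₗ (gens k V ^ m).subtype)) ∘ₗ
    linearInverse (mulThree (gens k V ^ l) W (gens k V ^ m))

/-- On an element `ω = ∑_N ω^N` with `ω^N` in `⋂_{l ≤ N} V^(l) ⊗ W ⊗ V^(N-l)` this is the sum over
`N` and `0 ≤ l ≤ N` of the elements `π(ω₁) | ω₂ | π(ω₃)` obtained by writing `ω^N` in
`V^(l) ⊗ W ⊗ V^(N-l)`. For `W = J_i` the spaces `⋂_{l ≤ N} V^(l) ⊗ W ⊗ V^(N-l)` are independent, so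
that the map from their direct sum to `T(V)` is injective, and `linearInverse` inverts
it. -/
def evenMap (W : Submodule k (TensorAlgebra k V)) :
    TensorAlgebra k V →ₗ[k] FreeBimod k A W :=
  DirectSum.toModule k ℕ (FreeBimod k A W)
      (fun N => (∑ l ∈ Finset.range (N + 1), P.cut W l (N - l)) ∘ₗ (specialPart W N).subtype) ∘ₗ
    linearInverse (DirectSum.coeLinearMap (specialPart W))

/-- The restriction of the differential to `J_{i+1}`. -/
def dJ (i : ℕ) : P.J (i + 1) →ₗ[k] P.K i :=
  (if Even i then P.oddMap (P.J i) else P.evenMap (P.J i)) ∘ₗ (P.J (i + 1)).subtype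

/-- The differential `δ^b_{i+1} : A ⊗ J_{i+1} ⊗ A → A ⊗ J_i ⊗ A` of the multi-Koszul bimodule
complex. -/
def d (i : ℕ) : P.K (i + 1) →ₗ[k] P.K i := extend (P.dJ i)

/-- The map `δ^b_0 : A ⊗ J_0 ⊗ A = A ⊗ A → A` given by the multiplication. -/
def d₀ : P.K 0 →ₗ[k] A :=
  LinearMap.mul' k A ∘ₗ TensorProduct.map LinearMap.id
    (LinearMap.mul' k A ∘ₗ
      TensorProduct.map (P.π.toLinearMap ∘ₗ (P.J 0).subtype) LinearMap.id)

lemma d₀_rightAct (a : A) (x : P.K 0) : P.d₀ (rightAct k A _ a x) = P.d₀ x * a := by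
  have h : P.d₀ ∘ₗ rightAct k A _ a = LinearMap.mulRight k a ∘ₗ P.d₀ := by
    ext a' w c
    simp [d₀, mul_assoc]
  exact LinearMap.congr_fun h x

lemma d₀_leftAct (a : A) (x : P.K 0) : P.d₀ (leftAct k A _ a x) = a * P.d₀ x := by
  have h : P.d₀ ∘ₗ leftAct k A _ a = LinearMap.mulLeft k a ∘ₗ P.d₀ := by
    ext a' w c
    simp [d₀, mul_assoc]
  exact LinearMap.congr_fun h x

/-- The augmented multi-Koszul bimodule complex `A ⊗ J_• ⊗ A → A` is exact. -/
def BimoduleComplexExact : Prop :=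
  Function.Surjective P.d₀ ∧ Function.Exact (P.d 0) P.d₀ ∧
    ∀ i, Function.Exact (P.d (i + 1)) (P.d i)

/-- The subspace `(A ⊗ J_i ⊗ A) · A_{>0}`. -/
def rightIrr (i : ℕ) : Submodule k (P.K i) :=
  Submodule.span k {y | ∃ a ∈ irrelevant 𝒜, ∃ x, y = rightAct k A (P.J i) a x}

/-- The subspace `A_{>0} · (A ⊗ J_i ⊗ A)`. -/
def leftIrr (i : ℕ) : Submodule k (P.K i) :=
  Submodule.span k {y | ∃ a ∈ irrelevant 𝒜, ∃ x, y = leftAct k A (P.J i) a x}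

/-- The term `(A ⊗ J_i ⊗ A) ⊗_A k` of the left multi-Koszul complex; `M ⊗_A k` is the quotient
`M / (M · A_{>0})`, because `k = A / A_{>0}`. -/
abbrev KLeft (i : ℕ) : Type _ := P.K i ⧸ P.rightIrr i

/-- The term `k ⊗_A (A ⊗ J_i ⊗ A)` of the right multi-Koszul complex. -/
abbrev KRight (i : ℕ) : Type _ := P.K i ⧸ P.leftIrr i

lemma d_rightAct (i : ℕ) (a : A) (x : P.K (i + 1)) :
    P.d i (rightAct k A (P.J (i + 1)) a x) = rightAct k A (P.J i) a (P.d i x) :=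
  extend_rightAct (P.dJ i) a x

lemma d_leftAct (i : ℕ) (a : A) (x : P.K (i + 1)) :
    P.d i (leftAct k A (P.J (i + 1)) a x) = leftAct k A (P.J i) a (P.d i x) :=
  extend_leftAct (P.dJ i) a x

lemma rightIrr_le (i : ℕ) : P.rightIrr (i + 1) ≤ (P.rightIrr i).comap (P.d i) := by
  refine Submodule.span_le.2 ?_
  rintro y ⟨a, ha, x, hy⟩
  rw [SetLike.mem_coe, Submodule.mem_comap, hy, P.d_rightAct]
  exact Submodule.subset_span ⟨a, ha, P.d i x, rfl⟩

lemma leftIrr_le (i : ℕ) : P.leftIrr (i + 1) ≤ (P.leftIrr i).comap (P.d i) := by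
  refine Submodule.span_le.2 ?_
  rintro y ⟨a, ha, x, hy⟩
  rw [SetLike.mem_coe, Submodule.mem_comap, hy, P.d_leftAct]
  exact Submodule.subset_span ⟨a, ha, P.d i x, rfl⟩

/-- The differential of the left multi-Koszul complex. -/
def dLeft (i : ℕ) : P.KLeft (i + 1) →ₗ[k] P.KLeft i :=
  (P.rightIrr (i + 1)).mapQ (P.rightIrr i) (P.d i) (P.rightIrr_le i)

/-- The differential of the right multi-Koszul complex. -/
def dRight (i : ℕ) : P.KRight (i + 1) →ₗ[k] P.KRight i :=
  (P.leftIrr (i + 1)).mapQ (P.leftIrr i) (P.d i) (P.leftIrr_le i)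

variable [GradedAlgebra 𝒜]

lemma rightIrr_zero_le : P.rightIrr 0 ≤ LinearMap.ker (augmentation 𝒜 ∘ₗ P.d₀) := by
  refine Submodule.span_le.2 ?_
  rintro _ ⟨a, ha, x, rfl⟩
  simp [d₀_rightAct, augmentation_mul_right 𝒜 _ ha]

lemma leftIrr_zero_le : P.leftIrr 0 ≤ LinearMap.ker (augmentation 𝒜 ∘ₗ P.d₀) := by
  refine Submodule.span_le.2 ?_
  rintro _ ⟨a, ha, x, rfl⟩
  simp [d₀_leftAct, augmentation_mul_left 𝒜 _ ha]

/-- The augmentation `(A ⊗ J_0 ⊗ A) ⊗_A k → A ⊗_A k = k` of the left multi-Koszul complex. -/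
def dLeft₀ : P.KLeft 0 →ₗ[k] k :=
  (P.rightIrr 0).liftQ (augmentation 𝒜 ∘ₗ P.d₀) P.rightIrr_zero_le

/-- The augmentation `k ⊗_A (A ⊗ J_0 ⊗ A) → k ⊗_A A = k` of the right multi-Koszul complex. -/
def dRight₀ : P.KRight 0 →ₗ[k] k :=
  (P.leftIrr 0).liftQ (augmentation 𝒜 ∘ₗ P.d₀) P.leftIrr_zero_le

/-- `A` is left multi-Koszul: the left multi-Koszul complex is a resolution of `k`. -/
def IsLeftMultiKoszul : Prop :=
  Function.Surjective P.dLeft₀ ∧ Function.Exact (P.dLeft 0) P.dLeft₀ ∧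
    ∀ i, Function.Exact (P.dLeft (i + 1)) (P.dLeft i)

/-- `A` is right multi-Koszul: the right multi-Koszul complex is a resolution of `k`. -/
def IsRightMultiKoszul : Prop :=
  Function.Surjective P.dRight₀ ∧ Function.Exact (P.dRight 0) P.dRight₀ ∧
    ∀ i, Function.Exact (P.dRight (i + 1)) (P.dRight i)

end MinimalPresentation

end

end MultiKoszul

/-! Forgetting one of its two actions, each `A ⊗ J_i ⊗ A` is a free one-sided `A`-module, and so is
`A` itself. Dividing out the action of `A_{>0}` on the side that is kept gives the left or the right
multi-Koszul complex. The theorem is therefore a comparison, made once for each side, between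
exactness of an augmented complex of free modules and exactness of its reduction modulo `A_{>0}`.
The comparison is `reducedExact_iff`. It is stated for a multiplication `ν` on `A`, to be read as
the product of `A` or as the opposite product, so that one proof serves both sides.

Exact implies reduced exact: an exact complex of free modules that ends in the free module `A`
splits. Inductively, `HasRetraction.succ` constructs an equivariant retraction onto the kernel of
every differential, and `exists_sub_mem_of_retraction` uses these retractions to correct a cycle
modulo `A_{>0}` to an honest cycle.

Reduced exact implies exact: this is a graded Nakayama argument. If a cycle is a boundary up to
`A_{≥m} · K`, its error is expanded in a basis of `A_m`. By freeness the coefficients are cycles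
modulo `A_{>0}`, hence boundaries modulo `A_{>0}`, and the error moves into `A_{≥m+1} · K`
(`exists_sub_mem_actGE`). The differentials preserve the total degree, and `A_{≥n+1} · K` has no
component in degree `n`, so each homogeneous component of the cycle is a boundary
(`mem_range_of_eq_zero`).

Two inputs are specific to the spaces `J_i`: the differential squares to zero, and it is
homogeneous. Both need the decompositions that define the differential to be unique. Uniqueness
comes from freeness of the one-sided ideals of `T(V)` generated by `V` and by `R`; for `R` this is
minimality of the relations (`rightFree_of_disjoint`). Although `R` need not be homogeneous for word
length, the coefficients over a free generating space can be sorted by length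
(`RightFree.eq_of_sum_eq`). With `cut l m` denoting the map `ω₁ ω₂ ω₃ ↦ π(ω₁) | ω₂ | π(ω₃)` on
`V^(l) ⊗ W ⊗ V^(m)`, the square of the differential telescopes to two extreme cuts. These vanish
because replacing one factor `R` by the larger `I = ker π` exhibits their coefficients as elements
of `I` (`lamLeft_eq_zero`, `lamRight_eq_zero`). -/

open scoped TensorProduct

namespace MultiKoszul

noncomputable section

variable {k : Type*} [Field k]

/-! ### Free one-sided ideals of the tensor algebra and their coordinates -/

section FreeSubspaces

variable {V : Type*} [AddCommGroup V] [Module k V]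

/-- The multiplication map `X ⊗ T(V) → T(V)`. -/
def mulTop (X : Submodule k (TensorAlgebra k V)) :
    X ⊗[k] TensorAlgebra k V →ₗ[k] TensorAlgebra k V :=
  LinearMap.mul' k (TensorAlgebra k V) ∘ₗ TensorProduct.map X.subtype LinearMap.id

/-- The multiplication map `T(V) ⊗ X → T(V)`. -/
def topMul (X : Submodule k (TensorAlgebra k V)) :
    TensorAlgebra k V ⊗[k] X →ₗ[k] TensorAlgebra k V :=
  LinearMap.mul' k (TensorAlgebra k V) ∘ₗ TensorProduct.map LinearMap.id X.subtype

@[simp] lemma mulTop_tmul (X : Submodule k (TensorAlgebra k V)) (x : X) (t : TensorAlgebra k V) :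
    mulTop X (x ⊗ₜ t) = x * t := rfl

@[simp] lemma topMul_tmul (X : Submodule k (TensorAlgebra k V)) (x : X) (t : TensorAlgebra k V) :
    topMul X (t ⊗ₜ x) = t * x := rfl

@[simp] lemma mulTwo_tmul (X Y : Submodule k (TensorAlgebra k V)) (x : X) (y : Y) :
    mulTwo X Y (x ⊗ₜ y) = x * y := rfl

@[simp] lemma mulThree_tmul (X Y Z : Submodule k (TensorAlgebra k V)) (x : X) (y : Y) (z : Z) :
    mulThree X Y Z (x ⊗ₜ (y ⊗ₜ z)) = x * (y * z) := rfl

/-- The right ideal generated by `X` is free over any basis of `X`. -/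
def RightFree (X : Submodule k (TensorAlgebra k V)) : Prop := Function.Injective (mulTop X)

/-- The left ideal generated by `X` is free over any basis of `X`. -/
def LeftFree (X : Submodule k (TensorAlgebra k V)) : Prop := Function.Injective (topMul X)

variable {X Y Z : Submodule k (TensorAlgebra k V)}

lemma range_mulTwo (X Y : Submodule k (TensorAlgebra k V)) :
    LinearMap.range (mulTwo X Y) = X * Y := by
  apply le_antisymm
  · rintro _ ⟨z, rfl⟩
    induction z with
    | zero => simp
    | tmul x y => exact Submodule.mul_mem_mul x.2 y.2
    | add a b ha hb => rw [map_add]; exact add_mem ha hb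
  · exact Submodule.mul_le.2 fun x hx y hy => ⟨⟨x, hx⟩ ⊗ₜ ⟨y, hy⟩, rfl⟩

lemma exists_mulTwo {x : TensorAlgebra k V} (hx : x ∈ X * Y) : ∃ z, mulTwo X Y z = x := by
  rwa [← range_mulTwo] at hx

/-- Over a field `X ⊗ Y` embeds in `X ⊗ T(V)`, so freeness on one side suffices and `Y` is
arbitrary. -/
lemma RightFree.mulTwo_injective (h : RightFree X) (Y : Submodule k (TensorAlgebra k V)) :
    Function.Injective (mulTwo X Y) := by
  have e : mulTwo X Y = mulTop X ∘ₗ Y.subtype.lTensor X := by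
    ext x y; rfl
  rw [e, LinearMap.coe_comp]
  exact Function.Injective.comp h
    (Module.Flat.lTensor_preserves_injective_linearMap _ Y.injective_subtype)

lemma LeftFree.mulTwo_injective (h : LeftFree Y) (X : Submodule k (TensorAlgebra k V)) :
    Function.Injective (mulTwo X Y) := by
  have e : mulTwo X Y = topMul Y ∘ₗ X.subtype.rTensor Y := by
    ext x y; rfl
  rw [e, LinearMap.coe_comp]
  exact Function.Injective.comp h
    (Module.Flat.rTensor_preserves_injective_linearMap _ X.injective_subtype)

/-- Only the outer factors have to be free. With powers of `V` outside, three-fold decompositions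
are unique for every middle space. -/
lemma RightFree.mulThree_injective (h : RightFree X) (h' : LeftFree Z)
    (Y : Submodule k (TensorAlgebra k V)) : Function.Injective (mulThree X Y Z) := by
  have e : mulThree X Y Z = mulTop X ∘ₗ (mulTwo Y Z).lTensor X := by
    ext x y z; rfl
  rw [e, LinearMap.coe_comp]
  exact Function.Injective.comp h
    (Module.Flat.lTensor_preserves_injective_linearMap _ (h'.mulTwo_injective Y))

lemma RightFree.mono (h : RightFree Y) (hXY : X ≤ Y) : RightFree X := by
  have e : mulTop X = mulTop Y ∘ₗ (Submodule.inclusion hXY).rTensor _ := by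
    ext x t; rfl
  rw [RightFree, e, LinearMap.coe_comp]
  exact Function.Injective.comp h
    (Module.Flat.rTensor_preserves_injective_linearMap _ (Submodule.inclusion_injective hXY))

lemma LeftFree.mono (h : LeftFree Y) (hXY : X ≤ Y) : LeftFree X := by
  have e : topMul X = topMul Y ∘ₗ (Submodule.inclusion hXY).lTensor _ := by
    ext x t; rfl
  rw [LeftFree, e, LinearMap.coe_comp]
  exact Function.Injective.comp h
    (Module.Flat.lTensor_preserves_injective_linearMap _ (Submodule.inclusion_injective hXY))

lemma rightFree_one : RightFree (1 : Submodule k (TensorAlgebra k V)) := by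
  refine Function.LeftInverse.injective
    (g := TensorProduct.mk k (1 : Submodule k (TensorAlgebra k V)) _
      ⟨1, Submodule.one_le.1 le_rfl⟩) fun z => ?_
  induction z with
  | zero => simp
  | add a b ha hb => rw [map_add, map_add, ha, hb]
  | tmul x t =>
    obtain ⟨x, hx⟩ := x
    obtain ⟨c, rfl⟩ := Submodule.mem_one.1 hx
    have : (⟨algebraMap k _ c, hx⟩ : (1 : Submodule k (TensorAlgebra k V))) =
        c • ⟨1, Submodule.one_le.1 le_rfl⟩ := by
      ext; simp [Algebra.algebraMap_eq_smul_one]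
    rw [this, TensorProduct.smul_tmul, mulTop_tmul, one_mul]
    rfl

lemma leftFree_one : LeftFree (1 : Submodule k (TensorAlgebra k V)) := by
  refine Function.LeftInverse.injective
    (g := (TensorProduct.mk k _ (1 : Submodule k (TensorAlgebra k V))).flip
      ⟨1, Submodule.one_le.1 le_rfl⟩) fun z => ?_
  induction z with
  | zero => simp
  | add a b ha hb => rw [map_add, map_add, ha, hb]
  | tmul t x =>
    obtain ⟨x, hx⟩ := x
    obtain ⟨c, rfl⟩ := Submodule.mem_one.1 hx
    have : (⟨algebraMap k _ c, hx⟩ : (1 : Submodule k (TensorAlgebra k V))) =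
        c • ⟨1, Submodule.one_le.1 le_rfl⟩ := by
      ext; simp [Algebra.algebraMap_eq_smul_one]
    rw [this, ← TensorProduct.smul_tmul, topMul_tmul, mul_one]
    rfl

/-- The multiplication map `X ⊗ Y → XY`. -/
def mulOnto (X Y : Submodule k (TensorAlgebra k V)) : X ⊗[k] Y →ₗ[k] (X * Y : Submodule k _) :=
  (mulTwo X Y).codRestrict _ fun z => range_mulTwo X Y ▸ LinearMap.mem_range_self _ z

lemma mulOnto_surjective (X Y : Submodule k (TensorAlgebra k V)) :
    Function.Surjective (mulOnto X Y) := by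
  rintro ⟨x, hx⟩
  obtain ⟨z, rfl⟩ := exists_mulTwo hx
  exact ⟨z, rfl⟩

/-- The map `X ⊗ Y ⊗ T(V) → X ⊗ T(V) → T(V)` is a composite of injections, and it factors through
`XY ⊗ T(V)` by way of a surjection. A kernel element is lifted along this surjection and tested
upstairs. -/
lemma RightFree.mul (hX : RightFree X) (hY : RightFree Y) : RightFree (X * Y) := by
  refine (injective_iff_map_eq_zero _).2 fun z hz => ?_
  obtain ⟨z, rfl⟩ := LinearMap.rTensor_surjective (TensorAlgebra k V) (mulOnto_surjective X Y) z
  have e : mulTop (X * Y) ∘ₗ (mulOnto X Y).rTensor _ =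
      mulTop X ∘ₗ (mulTop Y).lTensor X ∘ₗ (TensorProduct.assoc k X Y _).toLinearMap := by
    ext x y t
    simp [mulOnto, mul_assoc]
  have h := LinearMap.congr_fun e z
  rw [LinearMap.comp_apply, hz] at h
  have h2 := (injective_iff_map_eq_zero _).1
    (Module.Flat.lTensor_preserves_injective_linearMap (M := X) _ hY) _
    ((injective_iff_map_eq_zero _).1 hX _ h.symm)
  rw [(LinearEquiv.map_eq_zero_iff _).1 h2, map_zero]

lemma LeftFree.mul (hX : LeftFree X) (hY : LeftFree Y) : LeftFree (X * Y) := by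
  refine (injective_iff_map_eq_zero _).2 fun z hz => ?_
  obtain ⟨z, rfl⟩ := LinearMap.lTensor_surjective (TensorAlgebra k V) (mulOnto_surjective X Y) z
  have e : topMul (X * Y) ∘ₗ (mulOnto X Y).lTensor _ =
      topMul Y ∘ₗ (topMul X).rTensor Y ∘ₗ (TensorProduct.assoc k _ X Y).symm.toLinearMap := by
    ext t x y
    simp [mulOnto, mul_assoc]
  have h := LinearMap.congr_fun e z
  rw [LinearMap.comp_apply, hz] at h
  have h2 := (injective_iff_map_eq_zero _).1
    (Module.Flat.rTensor_preserves_injective_linearMap (M := Y) _ hX) _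
    ((injective_iff_map_eq_zero _).1 hY _ h.symm)
  rw [(LinearEquiv.map_eq_zero_iff _).1 h2, map_zero]

lemma RightFree.pow (hX : RightFree X) (n : ℕ) : RightFree (X ^ n) := by
  induction n with
  | zero => simpa using rightFree_one
  | succ n ih => rw [pow_succ]; exact ih.mul hX

lemma LeftFree.pow (hX : LeftFree X) (n : ℕ) : LeftFree (X ^ n) := by
  induction n with
  | zero => simpa using leftFree_one
  | succ n ih => rw [pow_succ]; exact ih.mul hX

variable (k V) in
/-- An auxiliary action of `V` on `T(V) × (V ⊗ T(V))`. -/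
def leftOp : V →ₗ[k] Module.End k (TensorAlgebra k V × (V ⊗[k] TensorAlgebra k V)) :=
  LinearMap.mk₂ k (fun v p => (TensorAlgebra.ι k v * p.1, v ⊗ₜ p.1))
    (fun v v' p => by simp [add_mul, TensorProduct.add_tmul])
    (fun c v p => by simp [TensorProduct.smul_tmul'])
    (fun v p p' => by simp [mul_add, TensorProduct.tmul_add])
    (fun c v p => by simp)

variable (k V) in
/-- An auxiliary action of `V` on `T(V) × (T(V) ⊗ V)`. -/
def rightOp : V →ₗ[k] Module.End k (TensorAlgebra k V × (TensorAlgebra k V ⊗[k] V)) :=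
  LinearMap.mk₂ k (fun v p => (p.1 * TensorAlgebra.ι k v, p.1 ⊗ₜ v))
    (fun v v' p => by simp [mul_add, TensorProduct.tmul_add])
    (fun c v p => by simp)
    (fun v p p' => by simp [add_mul, TensorProduct.add_tmul])
    (fun c v p => by simp [TensorProduct.smul_tmul'])

variable (k V) in
/-- The map `T(V) → V ⊗ T(V)` with `1 ↦ 0` and `v t ↦ v ⊗ t`. -/
def leftSplit : TensorAlgebra k V →ₗ[k] V ⊗[k] TensorAlgebra k V :=
  LinearMap.snd k _ _ ∘ₗ LinearMap.applyₗ (R := k) (1, 0) ∘ₗ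
    (TensorAlgebra.lift k (leftOp k V)).toLinearMap

variable (k V) in
/-- The map `T(V) → T(V) ⊗ V` with `1 ↦ 0` and `t v ↦ t ⊗ v`. -/
def rightSplit : TensorAlgebra k V →ₗ[k] TensorAlgebra k V ⊗[k] V :=
  LinearMap.snd k _ _ ∘ₗ LinearMap.applyₗ (R := k) (1, 0) ∘ₗ
    (MulOpposite.opLinearEquiv k).symm.toLinearMap ∘ₗ
    (TensorAlgebra.lift k ((MulOpposite.opLinearEquiv k).toLinearMap ∘ₗ rightOp k V)).toLinearMap

@[simp] lemma leftOp_apply (v : V) (p : TensorAlgebra k V × (V ⊗[k] TensorAlgebra k V)) :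
    leftOp k V v p = (TensorAlgebra.ι k v * p.1, v ⊗ₜ p.1) := rfl

@[simp] lemma rightOp_apply (v : V) (p : TensorAlgebra k V × (TensorAlgebra k V ⊗[k] V)) :
    rightOp k V v p = (p.1 * TensorAlgebra.ι k v, p.1 ⊗ₜ v) := rfl

/-- The first coordinate is plain left multiplication, so starting from `(1, 0)` it records the word
built so far. The second coordinate then keeps the splitting of that word into its first letter and
the rest. -/
lemma lift_leftOp_fst (x : TensorAlgebra k V) (p) :
    (TensorAlgebra.lift k (leftOp k V) x p).1 = x * p.1 := by
  induction x using TensorAlgebra.induction generalizing p with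
  | algebraMap r => simp [Algebra.algebraMap_eq_smul_one]
  | ι v => simp
  | mul a b ha hb => simp [ha, hb, mul_assoc]
  | add a b ha hb => simp [ha, hb, add_mul]

/-- Right multiplications compose in reverse order, whence the opposite of the endomorphism algebra.
-/
lemma lift_rightOp_fst (x : TensorAlgebra k V) (p) :
    ((TensorAlgebra.lift k ((MulOpposite.opLinearEquiv k).toLinearMap ∘ₗ rightOp k V) x).unop
      p).1 = p.1 * x := by
  induction x using TensorAlgebra.induction generalizing p with
  | algebraMap r => simp [Algebra.algebraMap_eq_smul_one]
  | ι v => simp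
  | mul a b ha hb => simp [ha, hb, mul_assoc]
  | add a b ha hb => simp [ha, hb, mul_add]

@[simp] lemma leftSplit_ι_mul (v : V) (t : TensorAlgebra k V) :
    leftSplit k V (TensorAlgebra.ι k v * t) = v ⊗ₜ t := by
  simp [leftSplit, lift_leftOp_fst]

@[simp] lemma rightSplit_mul_ι (v : V) (t : TensorAlgebra k V) :
    rightSplit k V (t * TensorAlgebra.ι k v) = t ⊗ₜ v := by
  simp [rightSplit, lift_rightOp_fst]

@[simp] lemma leftSplit_algebraMap (c : k) : leftSplit k V (algebraMap k _ c) = 0 := by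
  simp [leftSplit, Algebra.algebraMap_eq_smul_one]

@[simp] lemma rightSplit_algebraMap (c : k) : rightSplit k V (algebraMap k _ c) = 0 := by
  simp [rightSplit, Algebra.algebraMap_eq_smul_one]

variable (k V) in
/-- The map `V → T(V)` with values in its range. -/
def toGens : V →ₗ[k] gens k V := (TensorAlgebra.ι k).rangeRestrict

lemma toGens_surjective : Function.Surjective (toGens k V) :=
  LinearMap.surjective_rangeRestrict _

@[simp] lemma coe_toGens (v : V) : (toGens k V v : TensorAlgebra k V) = TensorAlgebra.ι k v := rfl

/-- Splitting off the first letter is a left inverse of the multiplication `V ⊗ T(V) → T(V)`. -/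
lemma rightFree_gens : RightFree (gens k V) := by
  refine (injective_iff_map_eq_zero _).2 fun z hz => ?_
  obtain ⟨z, rfl⟩ := LinearMap.rTensor_surjective _ toGens_surjective z
  have e : leftSplit k V ∘ₗ mulTop (gens k V) ∘ₗ (toGens k V).rTensor _ = LinearMap.id :=
    TensorProduct.ext' fun v t => by simp
  have h := LinearMap.congr_fun e z
  rw [LinearMap.comp_apply, LinearMap.comp_apply, hz, map_zero] at h
  rw [← LinearMap.id_apply (R := k) z, ← h, map_zero]

lemma leftFree_gens : LeftFree (gens k V) := by
  refine (injective_iff_map_eq_zero _).2 fun z hz => ?_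
  obtain ⟨z, rfl⟩ := LinearMap.lTensor_surjective _ toGens_surjective z
  have e : rightSplit k V ∘ₗ topMul (gens k V) ∘ₗ (toGens k V).lTensor _ = LinearMap.id :=
    TensorProduct.ext' fun v t => by simp
  have h := LinearMap.congr_fun e z
  rw [LinearMap.comp_apply, LinearMap.comp_apply, hz, map_zero] at h
  rw [← LinearMap.id_apply (R := k) z, ← h, map_zero]

/-- Coordinates on the free right ideal generated by `X`. -/
lemma RightFree.exists_coords (h : RightFree X) :
    ∃ c : Module.Free.ChooseBasisIndex k X → TensorAlgebra k V →ₗ[k] TensorAlgebra k V,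
      ∀ Y : Submodule k (TensorAlgebra k V), ∀ z ∈ X * ⊤, z ∈ X * Y ↔ ∀ i, c i z ∈ Y := by
  classical
  let b := Module.Free.chooseBasis k X
  let e := TensorProduct.equivFinsuppOfBasisLeft (N := TensorAlgebra k V) b
  let c i := Finsupp.lapply i ∘ₗ e.toLinearMap ∘ₗ linearInverse (mulTop X)
  have hc : ∀ i w, c i (mulTop X w) = e w i := fun i w => by
    simp only [c, LinearMap.comp_apply, linearInverse_apply _ h]
    rfl
  refine ⟨c, fun Y z hz => ?_⟩
  have hz' : ∃ w, mulTop X w = z := by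
    obtain ⟨w, hw⟩ := exists_mulTwo hz
    exact ⟨TensorProduct.map LinearMap.id (Submodule.subtype ⊤) w, by
      rw [← hw, mulTop, mulTwo, LinearMap.comp_apply, LinearMap.comp_apply,
        ← LinearMap.comp_apply (TensorProduct.map _ _), ← TensorProduct.map_comp]
      rfl⟩
  constructor
  · intro hzY i
    obtain ⟨w, rfl⟩ := exists_mulTwo hzY
    clear hz hz' hzY
    induction w with
    | zero => simp
    | add a b ha hb => rw [map_add, map_add]; exact add_mem ha hb
    | tmul x y =>
      have := hc i (x ⊗ₜ (y : TensorAlgebra k V))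
      rw [mulTop_tmul] at this
      rw [mulTwo_tmul, this, TensorProduct.equivFinsuppOfBasisLeft_apply_tmul,
        Finsupp.mapRange_apply]
      exact Y.smul_mem _ y.2
  · intro hY
    obtain ⟨w, rfl⟩ := hz'
    have hw : w = (e w).sum fun i n => b i ⊗ₜ[k] n := by
      rw [← TensorProduct.equivFinsuppOfBasisLeft_symm_apply]
      exact (e.symm_apply_apply w).symm
    rw [hw, Finsupp.sum, map_sum]
    exact sum_mem fun i _ => Submodule.mul_mem_mul (b i).2 (hc i w ▸ hY i)

/-- Coordinates on the free left ideal generated by `X`. -/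
lemma LeftFree.exists_coords (h : LeftFree X) :
    ∃ c : Module.Free.ChooseBasisIndex k X → TensorAlgebra k V →ₗ[k] TensorAlgebra k V,
      ∀ Y : Submodule k (TensorAlgebra k V), ∀ z ∈ ⊤ * X, z ∈ Y * X ↔ ∀ i, c i z ∈ Y := by
  classical
  let b := Module.Free.chooseBasis k X
  let e := TensorProduct.equivFinsuppOfBasisRight (M := TensorAlgebra k V) b
  let c i := Finsupp.lapply i ∘ₗ e.toLinearMap ∘ₗ linearInverse (topMul X)
  have hc : ∀ i w, c i (topMul X w) = e w i := fun i w => by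
    simp only [c, LinearMap.comp_apply, linearInverse_apply _ h]
    rfl
  refine ⟨c, fun Y z hz => ?_⟩
  have hz' : ∃ w, topMul X w = z := by
    obtain ⟨w, hw⟩ := exists_mulTwo hz
    exact ⟨TensorProduct.map (Submodule.subtype ⊤) LinearMap.id w, by
      rw [← hw, topMul, mulTwo, LinearMap.comp_apply, LinearMap.comp_apply,
        ← LinearMap.comp_apply (TensorProduct.map _ _), ← TensorProduct.map_comp]
      rfl⟩
  constructor
  · intro hzY i
    obtain ⟨w, rfl⟩ := exists_mulTwo hzY
    clear hz hz' hzY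
    induction w with
    | zero => simp
    | add a b ha hb => rw [map_add, map_add]; exact add_mem ha hb
    | tmul y x =>
      have := hc i ((y : TensorAlgebra k V) ⊗ₜ x)
      rw [topMul_tmul] at this
      rw [mulTwo_tmul, this, TensorProduct.equivFinsuppOfBasisRight_apply_tmul,
        Finsupp.mapRange_apply]
      exact Y.smul_mem _ y.2
  · intro hY
    obtain ⟨w, rfl⟩ := hz'
    have hw : w = (e w).sum fun i n => n ⊗ₜ[k] b i := by
      rw [← TensorProduct.equivFinsuppOfBasisRight_symm_apply]
      exact (e.symm_apply_apply w).symm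
    rw [hw, Finsupp.sum, map_sum]
    exact sum_mem fun i _ => Submodule.mul_mem_mul (hc i w ▸ hY i) (b i).2

lemma mul_le_mul_top (X Y : Submodule k (TensorAlgebra k V)) : X * Y ≤ X * ⊤ :=
  mul_le_mul' le_rfl le_top

lemma mul_le_top_mul (X Y : Submodule k (TensorAlgebra k V)) : Y * X ≤ ⊤ * X :=
  mul_le_mul' le_top le_rfl

/-- Membership in `X · Y` is the coordinatewise condition that all coefficients lie in `Y`, and such
conditions intersect. -/
lemma RightFree.mul_inf (h : RightFree X) (Y Z : Submodule k (TensorAlgebra k V)) :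
    X * Y ⊓ X * Z ≤ X * (Y ⊓ Z) := by
  obtain ⟨c, hc⟩ := h.exists_coords
  rintro z ⟨hY, hZ⟩
  have hz := mul_le_mul_top X Y hY
  rw [hc _ z hz]
  exact fun i => ⟨(hc _ z hz).1 hY i, (hc _ z hz).1 hZ i⟩

lemma LeftFree.inf_mul (h : LeftFree X) (Y Z : Submodule k (TensorAlgebra k V)) :
    Y * X ⊓ Z * X ≤ (Y ⊓ Z) * X := by
  obtain ⟨c, hc⟩ := h.exists_coords
  rintro z ⟨hY, hZ⟩
  have hz := mul_le_top_mul X Y hY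
  rw [hc _ z hz]
  exact fun i => ⟨(hc _ z hz).1 hY i, (hc _ z hz).1 hZ i⟩

instance gradedAlgebraGens : GradedAlgebra (gens k V ^ ·) := TensorAlgebra.gradedAlgebra

/-- The families of elements of `X · V^(n)`, `n ≥ 0`, are independent. -/
lemma RightFree.eq_of_sum_eq (h : RightFree X) (f g : ℕ →₀ TensorAlgebra k V)
    (hf : ∀ n, f n ∈ X * gens k V ^ n) (hg : ∀ n, g n ∈ X * gens k V ^ n)
    (hfg : f.sum (fun _ x => x) = g.sum fun _ x => x) : f = g := by
  classical
  obtain ⟨c, hc⟩ := h.exists_coords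
  ext n
  have hn : ∀ n, f n - g n ∈ X * gens k V ^ n := fun n => sub_mem (hf n) (hg n)
  have h0 : (f - g).sum (fun _ x => x) = 0 := by
    rw [Finsupp.sum_sub_index (fun _ _ _ => rfl), hfg, sub_self]
  rw [← sub_eq_zero]
  suffices f n - g n ∈ X * (⊥ : Submodule k (TensorAlgebra k V)) by simpa using this
  rw [hc _ _ (mul_le_mul_top _ _ (hn n))]
  intro i
  have hs : ∑ m ∈ (f - g).support, c i ((f - g) m) = 0 := by
    rw [← map_sum]
    exact (congrArg (c i) h0).trans (map_zero _)
  -- `X` may mix word lengths, but the coordinates of an element of `X · V^(m)` all have length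
  -- exactly `m`. The length grading is therefore applied to the coordinates and not to the
  -- elements.
  have hm : ∀ m, c i ((f - g) m) ∈ gens k V ^ m :=
    fun m => (hc _ _ (mul_le_mul_top _ _ (hn m))).1 (hn m) i
  have hd := congrArg (GradedAlgebra.proj (gens k V ^ ·) n) hs
  rw [map_sum, map_zero] at hd
  have hp : ∀ m, GradedAlgebra.proj (gens k V ^ ·) n (c i ((f - g) m)) =
      if m = n then c i ((f - g) m) else 0 := by
    intro m
    rw [GradedAlgebra.proj_apply]
    split_ifs with hmn
    · subst hmn; exact DirectSum.decompose_of_mem_same _ (hm m)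
    · exact DirectSum.decompose_of_mem_ne _ (hm m) hmn
  simp only [hp, Finset.sum_ite_eq'] at hd
  rw [Submodule.mem_bot, ← Finsupp.sub_apply]
  split_ifs at hd with hns
  · exact hd
  · rw [Finsupp.notMem_support_iff.1 hns, map_zero]

end FreeSubspaces

/-! ### Minimal generating spaces generate free one-sided ideals -/

section RelationSpaces

variable {V : Type*} [AddCommGroup V] [Module k V] {X : Submodule k (TensorAlgebra k V)}

lemma iSup_gens_pow : ⨆ n : ℕ, gens k V ^ n = ⊤ :=
  (DirectSum.Decomposition.isInternal (gens k V ^ ·)).submodule_iSup_eq_top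

lemma top_mul_gens_le : (⊤ : Submodule k (TensorAlgebra k V)) * gens k V ≤ tensorPos k V := by
  rw [← iSup_gens_pow, Submodule.iSup_mul]
  exact iSup_le fun n => (pow_succ (gens k V) n).ge.trans
    (le_iSup₂_of_le (n + 1) (Nat.le_add_left 1 n) le_rfl)

lemma gens_mul_top_le : gens k V * (⊤ : Submodule k (TensorAlgebra k V)) ≤ tensorPos k V := by
  rw [← iSup_gens_pow, Submodule.mul_iSup]
  exact iSup_le fun n => (pow_succ' (gens k V) n).ge.trans
    (le_iSup₂_of_le (n + 1) (Nat.le_add_left 1 n) le_rfl)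

/-- The splitting `t = c + ∑ v t'`. -/
lemma exists_eq_algebraMap_add_leftSplit (t : TensorAlgebra k V) :
    ∃ c : k, t = algebraMap k _ c +
      LinearMap.mul' k _ ((TensorAlgebra.ι k).rTensor _ (leftSplit k V t)) := by
  have ht : t ∈ ⨆ n : ℕ, gens k V ^ n := iSup_gens_pow (k := k) (V := V) ▸ Submodule.mem_top
  induction ht using Submodule.iSup_induction' with
  | zero => exact ⟨0, by simp⟩
  | add x y _ _ hx hy =>
    obtain ⟨a, ha⟩ := hx
    obtain ⟨b, hb⟩ := hy
    refine ⟨a + b, ?_⟩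
    simp only [map_add]
    nth_rewrite 1 [ha, hb]
    abel
  | mem n x hx =>
    cases n with
    | zero =>
      rw [pow_zero] at hx
      obtain ⟨c, rfl⟩ := Submodule.mem_one.1 hx
      exact ⟨c, by simp⟩
    | succ n =>
      refine ⟨0, ?_⟩
      rw [pow_succ'] at hx
      refine Submodule.mul_induction_on hx ?_ fun x y hx hy => ?_
      · rintro _ ⟨v, rfl⟩ y -
        simp
      · simp only [map_add]
        nth_rewrite 1 [hx, hy]
        simp

/-- The splitting `t = c + ∑ t' v`. -/
lemma exists_eq_algebraMap_add_rightSplit (t : TensorAlgebra k V) :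
    ∃ c : k, t = algebraMap k _ c +
      LinearMap.mul' k _ ((TensorAlgebra.ι k).lTensor _ (rightSplit k V t)) := by
  have ht : t ∈ ⨆ n : ℕ, gens k V ^ n := iSup_gens_pow (k := k) (V := V) ▸ Submodule.mem_top
  induction ht using Submodule.iSup_induction' with
  | zero => exact ⟨0, by simp⟩
  | add x y _ _ hx hy =>
    obtain ⟨a, ha⟩ := hx
    obtain ⟨b, hb⟩ := hy
    refine ⟨a + b, ?_⟩
    simp only [map_add]
    nth_rewrite 1 [ha, hb]
    abel
  | mem n x hx =>
    cases n with
    | zero =>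
      rw [pow_zero] at hx
      obtain ⟨c, rfl⟩ := Submodule.mem_one.1 hx
      exact ⟨c, by simp⟩
    | succ n =>
      refine ⟨0, ?_⟩
      rw [pow_succ] at hx
      refine Submodule.mul_induction_on hx ?_ fun x y hx hy => ?_
      · rintro y - _ ⟨v, rfl⟩
        simp
      · simp only [map_add]
        nth_rewrite 1 [hx, hy]
        simp

/-- The derivation-like map `v t ↦ φ(v) t`. -/
def leftContract (φ : V →ₗ[k] k) : TensorAlgebra k V →ₗ[k] TensorAlgebra k V :=
  (TensorProduct.lid k _).toLinearMap ∘ₗ φ.rTensor _ ∘ₗ leftSplit k V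

/-- The derivation-like map `t v ↦ φ(v) t`. -/
def rightContract (φ : V →ₗ[k] k) : TensorAlgebra k V →ₗ[k] TensorAlgebra k V :=
  (TensorProduct.rid k _).toLinearMap ∘ₗ φ.lTensor _ ∘ₗ rightSplit k V

/-- The coordinate functionals of a basis of `V` already separate the elements of `V ⊗ T(V)`. -/
lemma leftSplit_eq_zero {t : TensorAlgebra k V} (h : ∀ φ, leftContract φ t = 0) :
    leftSplit k V t = 0 := by
  classical
  let b := Module.Free.chooseBasis k V
  let e := TensorProduct.equivFinsuppOfBasisLeft (N := TensorAlgebra k V) b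
  rw [← e.map_eq_zero_iff]
  ext i
  rw [Finsupp.zero_apply, ← h (b.coord i)]
  have : Finsupp.lapply (R := k) i ∘ₗ e.toLinearMap =
      (TensorProduct.lid k _).toLinearMap ∘ₗ (b.coord i).rTensor _ :=
    TensorProduct.ext' fun v t => by simp [e]
  exact LinearMap.congr_fun this _

lemma rightSplit_eq_zero {t : TensorAlgebra k V} (h : ∀ φ, rightContract φ t = 0) :
    rightSplit k V t = 0 := by
  classical
  let b := Module.Free.chooseBasis k V
  let e := TensorProduct.equivFinsuppOfBasisRight (M := TensorAlgebra k V) b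
  rw [← e.map_eq_zero_iff]
  ext i
  rw [Finsupp.zero_apply, ← h (b.coord i)]
  have : Finsupp.lapply (R := k) i ∘ₗ e.toLinearMap =
      (TensorProduct.rid k _).toLinearMap ∘ₗ (b.coord i).lTensor _ :=
    TensorProduct.ext' fun v t => by simp [e]
  exact LinearMap.congr_fun this _

lemma leftContract_ι_mul (φ : V →ₗ[k] k) (v : V) (t : TensorAlgebra k V) :
    leftContract φ (TensorAlgebra.ι k v * t) = φ v • t := by
  simp [leftContract]

lemma rightContract_mul_ι (φ : V →ₗ[k] k) (v : V) (t : TensorAlgebra k V) :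
    rightContract φ (t * TensorAlgebra.ι k v) = φ v • t := by
  simp [rightContract]

variable (k V) in
/-- The elements of `T(V)` of length `< n`. -/
def leftLength : ℕ → Submodule k (TensorAlgebra k V)
  | 0 => ⊥
  | n + 1 => ⨅ φ : V →ₗ[k] k, (leftLength n).comap (leftContract φ)

variable (k V) in
/-- The elements of `T(V)` of length `< n`. -/
def rightLength : ℕ → Submodule k (TensorAlgebra k V)
  | 0 => ⊥
  | n + 1 => ⨅ φ : V →ₗ[k] k, (rightLength n).comap (rightContract φ)

lemma leftLength_mono : Monotone (leftLength k V) := by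
  refine monotone_nat_of_le_succ fun n => ?_
  induction n with
  | zero => exact bot_le
  | succ n ih => exact iInf_mono fun φ => Submodule.comap_mono ih

lemma rightLength_mono : Monotone (rightLength k V) := by
  refine monotone_nat_of_le_succ fun n => ?_
  induction n with
  | zero => exact bot_le
  | succ n ih => exact iInf_mono fun φ => Submodule.comap_mono ih

lemma gens_pow_le_leftLength (n : ℕ) : gens k V ^ n ≤ leftLength k V (n + 1) := by
  induction n with
  | zero =>
    rw [pow_zero]
    rintro _ hx
    obtain ⟨c, rfl⟩ := Submodule.mem_one.1 hx
    simp [leftLength, leftContract]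
  | succ n ih =>
    rw [pow_succ']
    refine Submodule.mul_le.2 ?_
    rintro _ ⟨v, rfl⟩ t ht
    refine (Submodule.mem_iInf _).2 fun φ => ?_
    rw [Submodule.mem_comap, leftContract_ι_mul]
    exact Submodule.smul_mem _ _ (ih ht)

lemma gens_pow_le_rightLength (n : ℕ) : gens k V ^ n ≤ rightLength k V (n + 1) := by
  induction n with
  | zero =>
    rw [pow_zero]
    rintro _ hx
    obtain ⟨c, rfl⟩ := Submodule.mem_one.1 hx
    simp [rightLength, rightContract]
  | succ n ih =>
    rw [pow_succ]
    refine Submodule.mul_le.2 ?_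
    rintro t ht _ ⟨v, rfl⟩
    refine (Submodule.mem_iInf _).2 fun φ => ?_
    rw [Submodule.mem_comap, rightContract_mul_ι]
    exact Submodule.smul_mem _ _ (ih ht)

lemma exists_mem_leftLength (t : TensorAlgebra k V) : ∃ n, t ∈ leftLength k V n := by
  have ht : t ∈ ⨆ n, leftLength k V n :=
    (iSup_gens_pow (k := k) (V := V) ▸ iSup_le fun n => (gens_pow_le_leftLength n).trans
      (le_iSup (leftLength k V) (n + 1)) : (⊤ : Submodule k (TensorAlgebra k V)) ≤ _)
      Submodule.mem_top
  exact (Submodule.mem_iSup_of_directed _ leftLength_mono.directed_le).1 ht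

lemma exists_mem_rightLength (t : TensorAlgebra k V) : ∃ n, t ∈ rightLength k V n := by
  have ht : t ∈ ⨆ n, rightLength k V n :=
    (iSup_gens_pow (k := k) (V := V) ▸ iSup_le fun n => (gens_pow_le_rightLength n).trans
      (le_iSup (rightLength k V) (n + 1)) : (⊤ : Submodule k (TensorAlgebra k V)) ≤ _)
      Submodule.mem_top
  exact (Submodule.mem_iSup_of_directed _ rightLength_mono.directed_le).1 ht

/-- The right factor is the part of `t` without constant term. Its last letter belongs to `t`, so
removing it does not affect `x`. -/
lemma rightContract_mul_mul'_rightSplit (φ : V →ₗ[k] k) (x t : TensorAlgebra k V) :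
    rightContract φ (x * LinearMap.mul' k _ ((TensorAlgebra.ι k).lTensor _ (rightSplit k V t))) =
      x * rightContract φ t := by
  rw [rightContract, LinearMap.comp_apply, LinearMap.comp_apply, LinearMap.comp_apply,
    LinearMap.comp_apply]
  generalize rightSplit k V t = z
  induction z with
  | zero => simp
  | add a b ha hb => simp only [map_add, mul_add] at *; rw [ha, hb]
  | tmul t v => simp [← mul_assoc]

lemma leftContract_mul'_leftSplit_mul (φ : V →ₗ[k] k) (x t : TensorAlgebra k V) :
    leftContract φ (LinearMap.mul' k _ ((TensorAlgebra.ι k).rTensor _ (leftSplit k V t)) * x) =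
      leftContract φ t * x := by
  rw [leftContract, LinearMap.comp_apply, LinearMap.comp_apply, LinearMap.comp_apply,
    LinearMap.comp_apply]
  generalize leftSplit k V t = z
  induction z with
  | zero => simp
  | add a b ha hb => simp only [map_add, add_mul] at *; rw [ha, hb]
  | tmul v t => simp [mul_assoc]

lemma mul'_lTensor_mem (z : TensorAlgebra k V ⊗[k] V) :
    LinearMap.mul' k _ ((TensorAlgebra.ι k).lTensor _ z) ∈ tensorPos k V := by
  refine top_mul_gens_le ?_
  induction z with
  | zero => simp
  | add a b ha hb => rw [map_add, map_add]; exact add_mem ha hb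
  | tmul t v => exact Submodule.mul_mem_mul Submodule.mem_top ⟨v, rfl⟩

lemma mul'_rTensor_mem (z : V ⊗[k] TensorAlgebra k V) :
    LinearMap.mul' k _ ((TensorAlgebra.ι k).rTensor _ z) ∈ tensorPos k V := by
  refine gens_mul_top_le ?_
  induction z with
  | zero => simp
  | add a b ha hb => rw [map_add, map_add]; exact add_mem ha hb
  | tmul v t => exact Submodule.mul_mem_mul ⟨v, rfl⟩ Submodule.mem_top

/-- A space of right generators that are minimal generates a free right ideal. -/
lemma rightFree_of_disjoint (h : Disjoint X (X * tensorPos k V)) : RightFree X := by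
  classical
  let b := Module.Free.chooseBasis k X
  let e := TensorProduct.equivFinsuppOfBasisLeft (N := TensorAlgebra k V) b
  -- Induction on a common length bound for the coefficients of a relation. The constant terms
  -- vanish by minimality, and removing the last letter by a functional yields shorter relations.
  have key : ∀ n (f : Module.Free.ChooseBasisIndex k X →₀ TensorAlgebra k V),
      (∀ i, f i ∈ rightLength k V n) → f.sum (fun i t => (b i : TensorAlgebra k V) * t) = 0 →
        f = 0 := by
    intro n
    induction n with
    | zero => exact fun f hf _ => Finsupp.ext fun i => hf i
    | succ n ih =>
      intro f hf hs
      choose c hc using exists_eq_algebraMap_add_rightSplit (k := k) (V := V)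
      set D : TensorAlgebra k V → TensorAlgebra k V := fun t =>
        LinearMap.mul' k _ ((TensorAlgebra.ι k).lTensor _ (rightSplit k V t))
      have hs' : (∑ i ∈ f.support, c (f i) • (b i : TensorAlgebra k V)) +
          ∑ i ∈ f.support, (b i : TensorAlgebra k V) * D (f i) = 0 := by
        rw [← Finset.sum_add_distrib, ← hs, Finsupp.sum]
        refine Finset.sum_congr rfl fun i _ => ?_
        conv_rhs => rw [hc (f i), mul_add, Algebra.algebraMap_eq_smul_one, mul_smul_comm, mul_one]
      -- The constant terms contribute an element of `X`; by the relation it is minus an element of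
      -- `X · T(V)_{>0}`.
      have h1 : ∑ i ∈ f.support, c (f i) • (b i : TensorAlgebra k V) = 0 := by
        refine Submodule.disjoint_def.1 h _ (sum_mem fun i _ => X.smul_mem _ (b i).2) ?_
        rw [eq_neg_of_add_eq_zero_left hs']
        exact neg_mem (sum_mem fun i _ => Submodule.mul_mem_mul (b i).2 (mul'_lTensor_mem _))
      have h1' : ∀ i ∈ f.support, c (f i) = 0 := by
        refine fun i hi => linearIndependent_iff'.1 b.linearIndependent f.support
          (fun i => c (f i)) ?_ i hi
        ext
        simpa using h1
      rw [h1, zero_add] at hs'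
      have h2 : ∀ φ, (f.mapRange (rightContract φ) (map_zero _)) = 0 := by
        intro φ
        refine ih _ (fun i => ?_) ?_
        · rw [Finsupp.mapRange_apply]
          exact (Submodule.mem_iInf _).1 (hf i) φ
        · rw [Finsupp.sum_mapRange_index (by simp), Finsupp.sum]
          have := congrArg (rightContract φ) hs'
          rw [map_sum, map_zero] at this
          rw [← this]
          exact Finset.sum_congr rfl fun i _ => (rightContract_mul_mul'_rightSplit φ _ _).symm
      ext i
      by_contra hi
      refine hi ?_
      rw [hc (f i), h1' i (Finsupp.mem_support_iff.2 hi), rightSplit_eq_zero fun φ => ?_]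
      · simp
      · simpa using DFunLike.congr_fun (h2 φ) i
  refine (injective_iff_map_eq_zero _).2 fun z hz => ?_
  have hz' : z = (e z).sum fun i n => b i ⊗ₜ[k] n := by
    rw [← TensorProduct.equivFinsuppOfBasisLeft_symm_apply]
    exact (e.symm_apply_apply z).symm
  rw [← e.map_eq_zero_iff]
  choose n hn using exists_mem_rightLength (k := k) (V := V)
  refine key ((e z).support.sup fun i => n (e z i)) _ (fun i => ?_) ?_
  · by_cases hi : i ∈ (e z).support
    · exact rightLength_mono (Finset.le_sup (f := fun i => n (e z i)) hi) (hn _)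
    · rw [Finsupp.notMem_support_iff.1 hi]; exact zero_mem _
  · rw [← hz]
    conv_rhs => rw [hz', Finsupp.sum, map_sum]
    rfl

/-- A space of left generators that are minimal generates a free left ideal. -/
lemma leftFree_of_disjoint (h : Disjoint X (tensorPos k V * X)) : LeftFree X := by
  classical
  let b := Module.Free.chooseBasis k X
  let e := TensorProduct.equivFinsuppOfBasisRight (M := TensorAlgebra k V) b
  have key : ∀ n (f : Module.Free.ChooseBasisIndex k X →₀ TensorAlgebra k V),
      (∀ i, f i ∈ leftLength k V n) → f.sum (fun i t => t * (b i : TensorAlgebra k V)) = 0 →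
        f = 0 := by
    intro n
    induction n with
    -- Mirror image of the argument for right ideals, with first letters in place of last letters.
    | zero => exact fun f hf _ => Finsupp.ext fun i => hf i
    | succ n ih =>
      intro f hf hs
      choose c hc using exists_eq_algebraMap_add_leftSplit (k := k) (V := V)
      set D : TensorAlgebra k V → TensorAlgebra k V := fun t =>
        LinearMap.mul' k _ ((TensorAlgebra.ι k).rTensor _ (leftSplit k V t))
      have hs' : (∑ i ∈ f.support, c (f i) • (b i : TensorAlgebra k V)) +
          ∑ i ∈ f.support, D (f i) * (b i : TensorAlgebra k V) = 0 := by
        rw [← Finset.sum_add_distrib, ← hs, Finsupp.sum]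
        refine Finset.sum_congr rfl fun i _ => ?_
        conv_rhs => rw [hc (f i), add_mul, Algebra.algebraMap_eq_smul_one, smul_mul_assoc, one_mul]
      have h1 : ∑ i ∈ f.support, c (f i) • (b i : TensorAlgebra k V) = 0 := by
        refine Submodule.disjoint_def.1 h _ (sum_mem fun i _ => X.smul_mem _ (b i).2) ?_
        rw [eq_neg_of_add_eq_zero_left hs']
        exact neg_mem (sum_mem fun i _ => Submodule.mul_mem_mul (mul'_rTensor_mem _) (b i).2)
      have h1' : ∀ i ∈ f.support, c (f i) = 0 := by
        refine fun i hi => linearIndependent_iff'.1 b.linearIndependent f.support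
          (fun i => c (f i)) ?_ i hi
        ext
        simpa using h1
      rw [h1, zero_add] at hs'
      have h2 : ∀ φ, (f.mapRange (leftContract φ) (map_zero _)) = 0 := by
        intro φ
        refine ih _ (fun i => ?_) ?_
        · rw [Finsupp.mapRange_apply]
          exact (Submodule.mem_iInf _).1 (hf i) φ
        · rw [Finsupp.sum_mapRange_index (by simp), Finsupp.sum]
          have := congrArg (leftContract φ) hs'
          rw [map_sum, map_zero] at this
          rw [← this]
          exact Finset.sum_congr rfl fun i _ => (leftContract_mul'_leftSplit_mul φ _ _).symm
      ext i
      by_contra hi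
      refine hi ?_
      rw [hc (f i), h1' i (Finsupp.mem_support_iff.2 hi), leftSplit_eq_zero fun φ => ?_]
      · simp
      · simpa using DFunLike.congr_fun (h2 φ) i
  refine (injective_iff_map_eq_zero _).2 fun z hz => ?_
  have hz' : z = (e z).sum fun i n => n ⊗ₜ[k] b i := by
    rw [← TensorProduct.equivFinsuppOfBasisRight_symm_apply]
    exact (e.symm_apply_apply z).symm
  rw [← e.map_eq_zero_iff]
  choose n hn using exists_mem_leftLength (k := k) (V := V)
  refine key ((e z).support.sup fun i => n (e z i)) _ (fun i => ?_) ?_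
  · by_cases hi : i ∈ (e z).support
    · exact leftLength_mono (Finset.le_sup (f := fun i => n (e z i)) hi) (hn _)
    · rw [Finsupp.notMem_support_iff.1 hi]; exact zero_mem _
  · rw [← hz]
    conv_rhs => rw [hz', Finsupp.sum, map_sum]
    rfl

end RelationSpaces

/-! ### Decomposition of the even spaces by special degree -/

section SpacesJ

variable {V : Type*} [AddCommGroup V] [Module k V] {R : Submodule k (TensorAlgebra k V)}

lemma exists_finsupp_of_mem_iSup {M : Type*} [AddCommGroup M] [Module k M] {p : ℕ → Prop}
    {X : ℕ → Submodule k M} {x : M} (hx : x ∈ ⨆ n, ⨆ _ : p n, X n) :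
    ∃ f : ℕ →₀ M, (∀ n, f n ∈ X n) ∧ (∀ n, ¬ p n → f n = 0) ∧ f.sum (fun _ y => y) = x := by
  obtain ⟨f, hf, hs⟩ := (Submodule.mem_iSup_iff_exists_finsupp _ _).1 hx
  refine ⟨f, fun n => ?_, fun n hn => ?_, hs⟩
  · have h : (⨆ _ : p n, X n) ≤ X n := iSup_le fun _ => le_rfl
    exact h (hf n)
  · simpa [hn] using hf n

lemma evenJ_zero : evenJ R 0 = 1 := by rw [evenJ]

lemma evenJ_le_pow (i : ℕ) : evenJ R i ≤ R ^ i := by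
  cases i with
  | zero => rw [evenJ, pow_zero]
  | succ i => rw [evenJ]; exact inf_le_right

lemma oddJ_le_left (i : ℕ) : oddJ R i ≤ gens k V * R ^ i :=
  inf_le_left.trans (mul_le_mul' le_rfl (evenJ_le_pow i))

lemma oddJ_le_right (i : ℕ) : oddJ R i ≤ R ^ i * gens k V :=
  inf_le_right.trans (mul_le_mul' (evenJ_le_pow i) le_rfl)

/-- Among the terms of the intersection is the one with a single block `J_{2i}`, all other blocks
being `J_0 = k`. -/
lemma iInf_evenJ_le (i N l : ℕ) (hl : l ≤ N) :
    (⨅ n : Fin i → Fin (i + 1), ⨅ _ : ∑ j, (n j : ℕ) = i,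
      ⨅ m : Fin (i + 1) → ℕ, ⨅ _ : ∑ j, m j = N,
        (List.ofFn fun j : Fin i => gens k V ^ m j.castSucc * evenJ R (n j)).prod *
          gens k V ^ m (Fin.last i)) ≤ gens k V ^ l * evenJ R i * gens k V ^ (N - l) := by
  cases i with
  | zero =>
    refine iInf₂_le_of_le (fun j => 0) (by simp) (iInf₂_le_of_le (fun _ => N) (by simp) ?_)
    rw [evenJ_zero, mul_one, ← pow_add, Nat.add_sub_cancel' hl]
    simp
  | succ i =>
    refine iInf₂_le_of_le (Fin.cons (Fin.last _) fun _ => 0) ?_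
      -- All weight of `n` sits in the first slot. The `N` letters are split into `l` before the
      -- first block and `N - l` after the last one, with none in between.
      (iInf₂_le_of_le (Fin.cons l (Fin.snoc (fun _ => 0) (N - l))) ?_ ?_)
    · rw [Fin.sum_univ_succ]
      simp
    · rw [Fin.sum_univ_succ, Fin.sum_univ_castSucc]
      simp [Nat.add_sub_cancel' hl]
    · rw [List.ofFn_succ, List.prod_cons]
      have h1 : (List.ofFn fun j : Fin i =>
          gens k V ^ (Fin.cons l (Fin.snoc (fun _ => 0) (N - l) : Fin (i + 1) → ℕ) :
            Fin (i + 2) → ℕ) j.succ.castSucc *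
          evenJ R ((Fin.cons (Fin.last (i + 1)) (fun _ => 0) : Fin (i + 1) → Fin (i + 2))
            j.succ : Fin (i + 2))).prod = 1 := by
        apply List.prod_eq_one
        intro x hx
        obtain ⟨j, rfl⟩ := List.mem_ofFn.1 hx
        rw [Fin.castSucc_succ]
        simp [evenJ_zero]
      rw [h1, mul_one, ← Fin.succ_last]
      simp

/-- For a total of `N + 1` letters, the conditions at `l + 1` and at `l` share the outer factors
`V^(l)` and `V^(N-l)`. Freeness of these factors moves the intersection inside, where it becomes `(V
⊗ J_{2i}) ∩ (J_{2i} ⊗ V) = J_{2i+1}`. One letter is absorbed, so `N + 1` turns into special degree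
`N`. -/
lemma iInf_evenJ_le_specialPart (i N : ℕ) :
    (⨅ n : Fin i → Fin (i + 1), ⨅ _ : ∑ j, (n j : ℕ) = i,
      ⨅ m : Fin (i + 1) → ℕ, ⨅ _ : ∑ j, m j = N + 1,
        (List.ofFn fun j : Fin i => gens k V ^ m j.castSucc * evenJ R (n j)).prod *
          gens k V ^ m (Fin.last i)) ≤ specialPart (oddJ R i) N := by
  refine le_iInf₂ fun l hl => ?_
  have h1 := iInf_evenJ_le (R := R) i (N + 1) (l + 1) (by omega)
  have h2 := iInf_evenJ_le (R := R) i (N + 1) l (by omega)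
  have e1 : N + 1 - (l + 1) = N - l := by omega
  have e2 : N + 1 - l = 1 + (N - l) := by omega
  rw [e1, pow_succ, mul_assoc (gens k V ^ l)] at h1
  rw [e2, pow_add, pow_one, ← mul_assoc, mul_assoc (gens k V ^ l)] at h2
  refine (le_inf h1 h2).trans (((leftFree_gens.pow _).inf_mul _ _).trans ?_)
  exact mul_le_mul' ((rightFree_gens.pow _).mul_inf _ _) le_rfl

lemma specialPart_le (W : Submodule k (TensorAlgebra k V)) {l m N : ℕ} (h : l + m = N) :
    specialPart W N ≤ gens k V ^ l * W * gens k V ^ m := by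
  obtain rfl : m = N - l := by omega
  exact iInf₂_le l (by omega)

/-- The condition at `l = 0` places the special part of degree `N` in `X · V^(N)`, and over a free
`X` these spaces are independent. -/
lemma RightFree.specialPart_injective {X W : Submodule k (TensorAlgebra k V)} (h : RightFree X)
    (hW : W ≤ X) : Function.Injective (DirectSum.coeLinearMap (specialPart W)) := by
  classical
  refine (injective_iff_map_eq_zero _).2 fun x hx => ?_
  have hf := h.eq_of_sum_eq
    (Finsupp.onFinset (DFinsupp.support x) (fun n => (x n : TensorAlgebra k V)) (fun n hn => by
      rw [DFinsupp.mem_support_iff]; rintro h0; exact hn (by rw [h0]; rfl))) 0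
    (fun n => (specialPart_le W (zero_add n)).trans
      (by rw [pow_zero, one_mul]; exact mul_le_mul' hW le_rfl) (x n).2)
    (fun n => zero_mem _) ?_
  · ext n
    exact DFunLike.congr_fun hf n
  · rw [Finsupp.onFinset_sum _ (fun _ => rfl), Finsupp.sum_zero_index, ← hx,
      DirectSum.coeLinearMap_eq_dfinsuppSum]
    rfl

/-- The vanishing of the part of special degree `0` reflects that relations involve only words of
length at least `2`. It is needed when decompositions of elements of `V · J` and `J · V` are
compared. -/
lemma exists_special_decomposition (hR : RightFree R)
    (hR2 : R ≤ ⨆ n : ℕ, ⨆ _ : 2 ≤ n, gens k V ^ n) {i : ℕ} {x : TensorAlgebra k V}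
    (hx : x ∈ evenJ R (i + 1)) :
    ∃ f : ℕ →₀ TensorAlgebra k V, (∀ N, f N ∈ specialPart (oddJ R i) N) ∧ f 0 = 0 ∧
      f.sum (fun _ y => y) = x := by
  have hx1 : x ∈ ⨆ N : ℕ, specialPart (oddJ R i) N := by
    rw [evenJ] at hx
    refine (iSup₂_le fun N hN => ?_ : _ ≤ ⨆ N : ℕ, specialPart (oddJ R i) N) hx.1
    obtain ⟨N, rfl⟩ : ∃ M, N = M + 1 := ⟨N - 1, by omega⟩
    exact (iInf_evenJ_le_specialPart i N).trans (le_iSup (specialPart (oddJ R i)) N)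
  obtain ⟨f, hf, hs⟩ := (Submodule.mem_iSup_iff_exists_finsupp _ _).1 hx1
  have hx2 : x ∈ ⨆ n : ℕ, ⨆ _ : 2 ≤ n, R ^ i * gens k V ^ n := by
    have := (evenJ_le_pow _).trans ((pow_succ R i).le.trans (mul_le_mul' le_rfl hR2)) hx
    simpa only [Submodule.mul_iSup] using this
  obtain ⟨g, hg, hg0, hgs⟩ := exists_finsupp_of_mem_iSup hx2
  refine ⟨f, hf, ?_, hs⟩
  -- A part of special degree `N` lies in `J_{2i+1} V^(N) ⊆ R^(i) V^(N+1)`. Hence `f`, shifted by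
  -- one, must agree with the expansion `g` over `R^(i)`, in which length `1` does not occur.
  have hfg := (hR.pow i).eq_of_sum_eq (f.embDomain ⟨Nat.succ, Nat.succ_injective⟩) g ?_ hg ?_
  · have h1 := DFunLike.congr_fun hfg 1
    rw [hg0 1 (by omega)] at h1
    rw [← h1]
    exact (Finsupp.embDomain_apply_self ⟨Nat.succ, Nat.succ_injective⟩ f 0).symm
  · intro n
    cases n with
    | zero =>
      rw [Finsupp.embDomain_of_notMem_range]
      · exact zero_mem _
      · rintro ⟨m, hm⟩; exact Nat.succ_ne_zero m hm
    | succ n =>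
      have e : (f.embDomain ⟨Nat.succ, Nat.succ_injective⟩) (n + 1) = f n :=
        Finsupp.embDomain_apply_self ⟨Nat.succ, Nat.succ_injective⟩ f n
      rw [e, pow_succ', ← mul_assoc]
      refine ((specialPart_le _ (zero_add n)).trans ?_) (hf n)
      rw [pow_zero, one_mul]
      exact mul_le_mul' (oddJ_le_right i) le_rfl
  · rw [Finsupp.sum_embDomain, hs, hgs]

end SpacesJ

namespace MinimalPresentation

variable {A : Type*} [Ring A] [Algebra k A] {𝒜 : ℕ → Submodule k A}
  {V : Type*} [AddCommGroup V] [Module k V] (P : MinimalPresentation 𝒜 V)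

/-! ### The differentials written as sums of cuts -/

section Cuts

variable {U W Y : Submodule k (TensorAlgebra k V)}

/-- The powers of `V` on both sides are free, so the inverse in the definition of `cut` is a true
inverse for every middle space `W`. -/
lemma cut_mul {l m : ℕ} {x w y : TensorAlgebra k V} (hx : x ∈ gens k V ^ l) (hw : w ∈ W)
    (hy : y ∈ gens k V ^ m) :
    P.cut W l m (x * w * y) = P.π x ⊗ₜ ((⟨w, hw⟩ : W) ⊗ₜ P.π y) := by
  have e : x * w * y = mulThree (gens k V ^ l) W (gens k V ^ m)
      (⟨x, hx⟩ ⊗ₜ (⟨w, hw⟩ ⊗ₜ ⟨y, hy⟩)) := by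
    simp [mul_assoc]
  rw [cut, LinearMap.comp_apply, e, linearInverse_apply _
    ((rightFree_gens.pow l).mulThree_injective (leftFree_gens.pow m) W)]
  rfl

@[elab_as_elim]
lemma mul_mul_induction {X Y Z : Submodule k (TensorAlgebra k V)}
    {C : TensorAlgebra k V → Prop} {z : TensorAlgebra k V} (hz : z ∈ X * Y * Z)
    (hC : ∀ x ∈ X, ∀ y ∈ Y, ∀ z ∈ Z, C (x * y * z)) (hadd : ∀ x y, C x → C y → C (x + y)) :
    C z := by
  refine Submodule.mul_induction_on hz (fun x hx z hz => ?_) hadd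
  refine Submodule.mul_induction_on hx (fun x hx y hy => hC x hx y hy z hz) fun x y hx hy => ?_
  rw [add_mul]
  exact hadd _ _ hx hy

lemma cut_mul_mul {a b l m : ℕ} {x z y : TensorAlgebra k V} (hx : x ∈ gens k V ^ a)
    (hz : z ∈ gens k V ^ l * U * gens k V ^ m) (hy : y ∈ gens k V ^ b) :
    P.cut U (a + l) (m + b) (x * z * y) =
      leftAct k A U (P.π x) (rightAct k A U (P.π y) (P.cut U l m z)) := by
  refine mul_mul_induction hz (fun x' hx' u hu y' hy' => ?_) fun z z' hz hz' => ?_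
  · have e : x * (x' * u * y') * y = x * x' * u * (y' * y) := by simp only [mul_assoc]
    rw [e, P.cut_mul (by rw [pow_add]; exact Submodule.mul_mem_mul hx hx') hu
      (by rw [pow_add]; exact Submodule.mul_mem_mul hy' hy), P.cut_mul hx' hu hy']
    simp
  · simp only [mul_add, add_mul, map_add, hz, hz']

lemma oddMap_fst {z : TensorAlgebra k V} (hz : z ∈ gens k V * U) :
    TensorProduct.map (P.π.toLinearMap ∘ₗ (gens k V).subtype)
      ((TensorProduct.mk k U A).flip 1) (linearInverse (mulTwo (gens k V) U) z) =
        P.cut U 1 0 z := by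
  obtain ⟨ξ, rfl⟩ := exists_mulTwo hz
  rw [linearInverse_apply _ (rightFree_gens.mulTwo_injective U)]
  clear hz
  induction ξ with
  | zero => simp
  | add a b ha hb => simp only [map_add, ha, hb]
  | tmul v u =>
    have := P.cut_mul (W := U) (l := 1) (m := 0) (x := v) (w := u) (y := 1)
      (by simp) u.2 (by rw [pow_zero]; exact Submodule.one_le.1 le_rfl)
    rw [mulTwo_tmul, ← mul_one ((v : TensorAlgebra k V) * u), this, map_one P.π]
    rfl

lemma oddMap_snd {z : TensorAlgebra k V} (hz : z ∈ U * gens k V) :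
    TensorProduct.mk k A (U ⊗[k] A) 1 (TensorProduct.map LinearMap.id
      (P.π.toLinearMap ∘ₗ (gens k V).subtype) (linearInverse (mulTwo U (gens k V)) z)) =
        P.cut U 0 1 z := by
  obtain ⟨ξ, rfl⟩ := exists_mulTwo hz
  rw [linearInverse_apply _ (leftFree_gens.mulTwo_injective U)]
  clear hz
  induction ξ with
  | zero => simp
  | add a b ha hb => simp only [map_add, ha, hb]
  | tmul u v =>
    have := P.cut_mul (W := U) (l := 0) (m := 1) (x := 1) (w := u) (y := v)
      (by rw [pow_zero]; exact Submodule.one_le.1 le_rfl) u.2 (by simp)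
    rw [mulTwo_tmul, ← one_mul ((u : TensorAlgebra k V) * v), ← mul_assoc, this, map_one P.π]
    rfl

lemma oddMap_eq_cut {z : TensorAlgebra k V} (hz : z ∈ gens k V * U ⊓ U * gens k V) :
    P.oddMap U z = P.cut U 1 0 z - P.cut U 0 1 z := by
  rw [← P.oddMap_fst hz.1, ← P.oddMap_snd hz.2]
  rfl

/-- An odd differential moves one letter out of the middle factor, to the left in the first term and
to the right in the second. The result is a difference of neighbouring cuts, the source of the
telescoping in the square of the differential. -/
lemma extend_oddMap_cut (hW : W ≤ gens k V * U ⊓ U * gens k V) {l m : ℕ}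
    {z : TensorAlgebra k V} (hz : z ∈ gens k V ^ l * W * gens k V ^ m) :
    extend (P.oddMap U ∘ₗ W.subtype) (P.cut W l m z) =
      P.cut U (l + 1) m z - P.cut U l (m + 1) z := by
  refine mul_mul_induction hz (fun x hx w hw y hy => ?_) fun z z' hz hz' => ?_
  · have h1 := P.cut_mul_mul (U := U) (l := 1) (m := 0) hx
      (by simpa using (hW hw).1) hy
    have h2 := P.cut_mul_mul (U := U) (l := 0) (m := 1) hx
      (by simpa using (hW hw).2) hy
    rw [zero_add] at h1
    rw [add_zero, add_comm 1 m] at h2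
    rw [h1, h2, P.cut_mul hx hw hy, extend_tmul, LinearMap.comp_apply, Submodule.subtype_apply,
      P.oddMap_eq_cut (hW hw), map_sub, map_sub]
  · simp only [map_add, hz, hz']
    abel

lemma sum_cut_sub_cut (N : ℕ) (z : TensorAlgebra k V) :
    ∑ l ∈ Finset.range (N + 1), (P.cut U (l + 1) (N - l) z - P.cut U l (N - l + 1) z) =
      P.cut U (N + 1) 0 z - P.cut U 0 (N + 1) z := by
  have h := Finset.sum_range_sub (fun l => P.cut U l (N + 1 - l) z) (N + 1)
  rw [Nat.sub_self, Nat.sub_zero] at h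
  rw [← h]
  refine Finset.sum_congr rfl fun l hl => ?_
  have hl' := Finset.mem_range.1 hl
  rw [show N + 1 - (l + 1) = N - l by omega, show N + 1 - l = N - l + 1 by omega]

/-- By independence of the special parts, any finitely supported decomposition may be used to
compute the even differential. -/
lemma evenMap_sum (hi : Function.Injective (DirectSum.coeLinearMap (specialPart W)))
    (f : ℕ →₀ TensorAlgebra k V) (hf : ∀ N, f N ∈ specialPart W N) :
    P.evenMap W (f.sum fun _ y => y) =
      f.sum fun N y => ∑ l ∈ Finset.range (N + 1), P.cut W l (N - l) y := by
  have e : (f.sum fun _ y => y) = DirectSum.coeLinearMap (specialPart W)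
      (∑ N ∈ f.support, DirectSum.lof k ℕ (fun N => specialPart W N) N ⟨f N, hf N⟩) := by
    rw [map_sum]
    exact Finset.sum_congr rfl fun N _ => by rw [DirectSum.coeLinearMap_lof]
  rw [evenMap, LinearMap.comp_apply, e, linearInverse_apply _ hi, map_sum]
  refine Finset.sum_congr rfl fun N _ => ?_
  rw [DirectSum.toModule_lof, LinearMap.comp_apply, LinearMap.sum_apply]
  rfl

/-- The map `t w ↦ π(t) | w | 1` on `T(V) · W`. -/
def lamLeft (W : Submodule k (TensorAlgebra k V)) : TensorAlgebra k V →ₗ[k] FreeBimod k A W :=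
  TensorProduct.map P.π.toLinearMap ((TensorProduct.mk k W A).flip 1) ∘ₗ linearInverse (topMul W)

/-- The map `w t ↦ 1 | w | π(t)` on `W · T(V)`. -/
def lamRight (W : Submodule k (TensorAlgebra k V)) : TensorAlgebra k V →ₗ[k] FreeBimod k A W :=
  TensorProduct.mk k A (W ⊗[k] A) 1 ∘ₗ TensorProduct.map LinearMap.id P.π.toLinearMap ∘ₗ
    linearInverse (mulTop W)

/-- The extreme cuts for different lengths are restrictions of one linear map on `T(V) · W`. The
pieces of different special degree can thus be summed before vanishing is tested; it holds for the
total but not for each piece separately. -/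
lemma lamLeft_eq_cut (hW : LeftFree W) {l : ℕ} {z : TensorAlgebra k V}
    (hz : z ∈ gens k V ^ l * W) : P.lamLeft W z = P.cut W l 0 z := by
  refine Submodule.mul_induction_on hz (fun x hx w hw => ?_) fun z z' hz hz' => ?_
  · have := P.cut_mul hx hw (m := 0) (y := 1)
      (by rw [pow_zero]; exact Submodule.one_le.1 le_rfl)
    rw [mul_one, map_one] at this
    have e : x * w = topMul W (x ⊗ₜ ⟨w, hw⟩) := rfl
    rw [this, lamLeft, LinearMap.comp_apply, e, linearInverse_apply _ hW]
    rfl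
  · rw [map_add, map_add, hz, hz']

lemma lamRight_eq_cut (hW : RightFree W) {m : ℕ} {z : TensorAlgebra k V}
    (hz : z ∈ W * gens k V ^ m) : P.lamRight W z = P.cut W 0 m z := by
  refine Submodule.mul_induction_on hz (fun w hw y hy => ?_) fun z z' hz hz' => ?_
  · have := P.cut_mul (l := 0) (x := 1)
      (by rw [pow_zero]; exact Submodule.one_le.1 le_rfl) hw hy
    rw [one_mul, map_one] at this
    have e : w * y = mulTop W (⟨w, hw⟩ ⊗ₜ y) := rfl
    rw [this, lamRight, LinearMap.comp_apply, LinearMap.comp_apply, e, linearInverse_apply _ hW]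
    rfl
  · rw [map_add, map_add, hz, hz']

/-- The expansions of `z` over `W` and over `Y` agree in `T(V) ⊗ Y` by freeness of `Y`, so `π` kills
the coefficients of the former in `A ⊗ Y`. Since `A ⊗ W → A ⊗ Y` is injective, it kills them already
in `A ⊗ W`. The larger space `Y` matters: membership in `ker π · R^(j)` is what the relations
provide, not membership in `ker π · J_{2j}`. -/
lemma lamLeft_eq_zero (hY : LeftFree Y) (hWY : W ≤ Y) {z : TensorAlgebra k V}
    (hz : z ∈ ⊤ * W) (hz' : z ∈ LinearMap.ker P.π.toLinearMap * Y) : P.lamLeft W z = 0 := by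
  obtain ⟨ζ, rfl⟩ : ∃ ζ, topMul W ζ = z := by
    obtain ⟨w, hw⟩ := exists_mulTwo hz
    exact ⟨(Submodule.subtype ⊤).rTensor W w, by
      rw [← hw, topMul, mulTwo, LinearMap.comp_apply, LinearMap.comp_apply, LinearMap.rTensor,
        ← LinearMap.comp_apply (TensorProduct.map _ _), ← TensorProduct.map_comp]
      rfl⟩
  obtain ⟨ξ, hξ⟩ := exists_mulTwo hz'
  have h1 : (Submodule.inclusion hWY).lTensor _ ζ =
      (LinearMap.ker P.π.toLinearMap).subtype.rTensor Y ξ := by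
    refine hY ?_
    have e1 : topMul Y ∘ₗ (Submodule.inclusion hWY).lTensor _ = topMul W := by ext; rfl
    have e2 : topMul Y ∘ₗ (LinearMap.ker P.π.toLinearMap).subtype.rTensor Y = mulTwo _ Y := by
      ext; rfl
    rw [← LinearMap.comp_apply, ← LinearMap.comp_apply, e1, e2, hξ]
  have h2 : P.π.toLinearMap.rTensor W ζ = 0 := by
    refine Module.Flat.lTensor_preserves_injective_linearMap (M := A) (Submodule.inclusion hWY)
      (Submodule.inclusion_injective hWY) ?_
    rw [map_zero, ← LinearMap.comp_apply, LinearMap.lTensor_comp_rTensor,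
      ← LinearMap.rTensor_comp_lTensor, LinearMap.comp_apply, h1, ← LinearMap.comp_apply,
      ← LinearMap.rTensor_comp]
    have : P.π.toLinearMap ∘ₗ (LinearMap.ker P.π.toLinearMap).subtype = 0 :=
      LinearMap.ext fun x => x.2
    rw [this, LinearMap.rTensor_zero, LinearMap.zero_apply]
  rw [lamLeft, LinearMap.comp_apply, linearInverse_apply _ (hY.mono hWY),
    ← LinearMap.lTensor_comp_rTensor, LinearMap.comp_apply, h2, map_zero]

lemma lamRight_eq_zero (hY : RightFree Y) (hWY : W ≤ Y) {z : TensorAlgebra k V}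
    (hz : z ∈ W * ⊤) (hz' : z ∈ Y * LinearMap.ker P.π.toLinearMap) : P.lamRight W z = 0 := by
  obtain ⟨ζ, rfl⟩ : ∃ ζ, mulTop W ζ = z := by
    obtain ⟨w, hw⟩ := exists_mulTwo hz
    exact ⟨(Submodule.subtype ⊤).lTensor W w, by
      rw [← hw, mulTop, mulTwo, LinearMap.comp_apply, LinearMap.comp_apply, LinearMap.lTensor,
        ← LinearMap.comp_apply (TensorProduct.map _ _), ← TensorProduct.map_comp]
      rfl⟩
  obtain ⟨ξ, hξ⟩ := exists_mulTwo hz'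
  have h1 : (Submodule.inclusion hWY).rTensor _ ζ =
      (LinearMap.ker P.π.toLinearMap).subtype.lTensor Y ξ := by
    refine hY ?_
    have e1 : mulTop Y ∘ₗ (Submodule.inclusion hWY).rTensor _ = mulTop W := by ext; rfl
    have e2 : mulTop Y ∘ₗ (LinearMap.ker P.π.toLinearMap).subtype.lTensor Y = mulTwo Y _ := by
      ext; rfl
    rw [← LinearMap.comp_apply, ← LinearMap.comp_apply, e1, e2, hξ]
  have h2 : P.π.toLinearMap.lTensor W ζ = 0 := by
    refine Module.Flat.rTensor_preserves_injective_linearMap (M := A) (Submodule.inclusion hWY)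
      (Submodule.inclusion_injective hWY) ?_
    rw [map_zero, ← LinearMap.comp_apply, LinearMap.rTensor_comp_lTensor,
      ← LinearMap.lTensor_comp_rTensor, LinearMap.comp_apply, h1, ← LinearMap.comp_apply,
      ← LinearMap.lTensor_comp]
    have : P.π.toLinearMap ∘ₗ (LinearMap.ker P.π.toLinearMap).subtype = 0 :=
      LinearMap.ext fun x => x.2
    rw [this, LinearMap.lTensor_zero, LinearMap.zero_apply]
  rw [lamRight, LinearMap.comp_apply, LinearMap.comp_apply,
    linearInverse_apply _ (hY.mono hWY)]
  exact (congrArg _ h2).trans (map_zero _)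

end Cuts

end MinimalPresentation

namespace MinimalPresentation

variable {A : Type*} [Ring A] [Algebra k A] {𝒜 : ℕ → Submodule k A}
  {V : Type*} [AddCommGroup V] [Module k V] (P : MinimalPresentation 𝒜 V)

/-! ### Consequences of minimality of the presentation -/

section Relations

lemma rel_le_ker : P.rel ≤ LinearMap.ker P.π.toLinearMap :=
  le_sup_left.trans P.rel_sup.le

lemma rightFree_rel : RightFree P.rel :=
  rightFree_of_disjoint (P.rel_disjoint.mono_right
    ((mul_le_mul' P.rel_le_ker le_rfl).trans le_sup_right))

lemma leftFree_rel : LeftFree P.rel :=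
  leftFree_of_disjoint (P.rel_disjoint.mono_right
    ((mul_le_mul' le_rfl P.rel_le_ker).trans le_sup_left))

@[simp] lemma π_ι (v : V) : P.π (TensorAlgebra.ι k v) = P.gen v :=
  TensorAlgebra.lift_ι_apply P.gen v

lemma gen_mem_irrelevant (v : V) : P.gen v ∈ irrelevant 𝒜 := by
  rw [← P.gen_sup]
  exact Submodule.mem_sup_left ⟨v, rfl⟩

lemma π_mem_irrelevant_mul {n : ℕ} (hn : 2 ≤ n) {x : TensorAlgebra k V}
    (hx : x ∈ gens k V ^ n) : P.π x ∈ irrelevant 𝒜 * irrelevant 𝒜 := by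
  have h1 : (gens k V).map P.π.toLinearMap ≤ irrelevant 𝒜 := by
    rintro _ ⟨_, ⟨v, rfl⟩, rfl⟩
    rw [AlgHom.toLinearMap_apply, P.π_ι]
    exact P.gen_mem_irrelevant v
  have h2 : irrelevant 𝒜 * irrelevant 𝒜 ≤ irrelevant 𝒜 := le_sup_right.trans P.gen_sup.le
  have h3 : ∀ m, irrelevant 𝒜 ^ (m + 2) ≤ irrelevant 𝒜 * irrelevant 𝒜 := by
    intro m
    induction m with
    | zero => rw [pow_two]
    | succ m ih => rw [pow_succ]; exact mul_le_mul' (ih.trans h2) le_rfl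
  obtain ⟨m, rfl⟩ : ∃ m, n = m + 2 := ⟨n - 2, by omega⟩
  refine h3 m (pow_le_pow_left' h1 (m + 2) ?_)
  rw [← Submodule.map_pow]
  exact ⟨x, hx, rfl⟩

/-- The constant term is detected by the component of degree `0`. The linear term then maps into
`A_{>0} · A_{>0}`, which meets the image of `V` trivially, and `V` injects into `A`. -/
lemma ker_le_longWords [GradedAlgebra 𝒜] [Nontrivial A] :
    LinearMap.ker P.π.toLinearMap ≤ ⨆ n : ℕ, ⨆ _ : 2 ≤ n, gens k V ^ n := by
  intro x hx
  have hx1 : x ∈ ⨆ n : ℕ, gens k V ^ n := iSup_gens_pow (k := k) (V := V) ▸ Submodule.mem_top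
  have hle : ⨆ n : ℕ, gens k V ^ n ≤ (1 ⊔ gens k V) ⊔ ⨆ n : ℕ, ⨆ _ : 2 ≤ n, gens k V ^ n := by
    refine iSup_le fun n => ?_
    match n with
    | 0 => rw [pow_zero]; exact le_sup_left.trans le_sup_left
    | 1 => rw [pow_one]; exact le_sup_right.trans le_sup_left
    | n + 2 => exact le_sup_of_le_right (le_iSup₂_of_le (n + 2) (by omega) le_rfl)
  obtain ⟨y, hy, z, hz, rfl⟩ := Submodule.mem_sup.1 (hle hx1)
  obtain ⟨c, hc, v, hv, rfl⟩ := Submodule.mem_sup.1 hy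
  obtain ⟨c, rfl⟩ := Submodule.mem_one.1 hc
  obtain ⟨v, rfl⟩ := hv
  have hπz : P.π z ∈ irrelevant 𝒜 * irrelevant 𝒜 := by
    have : (⨆ n : ℕ, ⨆ _ : 2 ≤ n, gens k V ^ n) ≤
        (irrelevant 𝒜 * irrelevant 𝒜).comap P.π.toLinearMap :=
      iSup₂_le fun n hn x hx => P.π_mem_irrelevant_mul hn hx
    exact this hz
  have hirr : P.gen v + P.π z ∈ irrelevant 𝒜 :=
    add_mem (P.gen_mem_irrelevant v) ((le_sup_right.trans P.gen_sup.le) hπz)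
  have h0 : algebraMap k A c + (P.gen v + P.π z) = 0 := by
    have : P.π (algebraMap k _ c + TensorAlgebra.ι k v + z) = 0 := hx
    rw [← this, map_add, map_add, AlgHom.commutes, P.π_ι, add_assoc]
  have hc0 : algebraMap k A c = 0 := by
    have h := congrArg (GradedAlgebra.proj 𝒜 0) h0
    rw [map_add, proj_zero_eq_zero 𝒜 hirr, add_zero, map_zero, GradedAlgebra.proj_apply,
      DirectSum.decompose_of_mem_same 𝒜 (SetLike.algebraMap_mem_graded 𝒜 c)] at h
    exact h
  have hc' : c = 0 := (map_eq_zero _).1 hc0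
  rw [hc0, zero_add] at h0
  have hv0 : P.gen v = 0 := Submodule.disjoint_def.1 P.gen_disjoint _ ⟨v, rfl⟩
    (by rw [eq_neg_of_add_eq_zero_left h0]; exact neg_mem hπz)
  have hv' : v = 0 := P.gen_injective (hv0.trans (map_zero _).symm)
  rw [hc', hv', map_zero, map_zero, add_zero, zero_add]
  exact hz

end Relations

/-! ### The differential squares to zero -/

section DifferentialSquare

variable {U W : Submodule k (TensorAlgebra k V)}

lemma rel_pow_succ_le_ker_mul (j : ℕ) :
    P.rel ^ (j + 1) ≤ LinearMap.ker P.π.toLinearMap * P.rel ^ j := by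
  rw [pow_succ']
  exact mul_le_mul' P.rel_le_ker le_rfl

lemma rel_pow_succ_le_mul_ker (j : ℕ) :
    P.rel ^ (j + 1) ≤ P.rel ^ j * LinearMap.ker P.π.toLinearMap := by
  rw [pow_succ]
  exact mul_le_mul' le_rfl P.rel_le_ker

lemma sum_cut_left_eq_lamLeft (hW : LeftFree W) (f : ℕ →₀ TensorAlgebra k V)
    (hf : ∀ N, f N ∈ gens k V ^ (N + 1) * W) :
    (f.sum fun N y => P.cut W (N + 1) 0 y) = P.lamLeft W (f.sum fun _ y => y) := by
  rw [Finsupp.sum, Finsupp.sum, map_sum]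
  exact Finset.sum_congr rfl fun N _ => (P.lamLeft_eq_cut hW (hf N)).symm

lemma sum_cut_right_eq_lamRight (hW : RightFree W) (f : ℕ →₀ TensorAlgebra k V)
    (hf : ∀ N, f N ∈ W * gens k V ^ (N + 1)) :
    (f.sum fun N y => P.cut W 0 (N + 1) y) = P.lamRight W (f.sum fun _ y => y) := by
  rw [Finsupp.sum, Finsupp.sum, map_sum]
  exact Finset.sum_congr rfl fun N _ => (P.lamRight_eq_cut hW (hf N)).symm

lemma finsuppSum_mem {X : Submodule k (TensorAlgebra k V)} (f : ℕ →₀ TensorAlgebra k V)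
    (hf : ∀ N, f N ∈ X) : (f.sum fun _ y => y) ∈ X :=
  sum_mem fun N _ => hf N

lemma specialPart_oddJ_injective (j : ℕ) :
    Function.Injective (DirectSum.coeLinearMap (specialPart (oddJ P.rel j))) :=
  ((P.rightFree_rel.pow j).mul rightFree_gens).specialPart_injective (oddJ_le_right j)

lemma specialPart_le_left (N : ℕ) : specialPart W N ≤ gens k V ^ N * W := by
  simpa using specialPart_le W (add_zero N)

lemma specialPart_le_right (N : ℕ) : specialPart W N ≤ W * gens k V ^ N := by
  simpa using specialPart_le W (zero_add N)

lemma gens_mul_oddJ_le (j N : ℕ) : gens k V ^ N * oddJ P.rel j ≤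
    gens k V ^ (N + 1) * evenJ P.rel j := by
  rw [pow_succ, mul_assoc]
  exact mul_le_mul' le_rfl inf_le_left

lemma oddJ_mul_gens_le (j N : ℕ) : oddJ P.rel j * gens k V ^ N ≤
    evenJ P.rel j * gens k V ^ (N + 1) := by
  rw [pow_succ', ← mul_assoc]
  exact mul_le_mul' inf_le_right le_rfl

/-- The composite of the differentials `J_{2j+2} → A ⊗ J_{2j+1} ⊗ A → A ⊗ J_{2j} ⊗ A` is zero. -/
lemma extend_oddMap_evenMap [GradedAlgebra 𝒜] [Nontrivial A] (j : ℕ) {ω : TensorAlgebra k V}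
    (hω : ω ∈ evenJ P.rel (j + 1)) :
    extend (P.oddMap (evenJ P.rel j) ∘ₗ (oddJ P.rel j).subtype)
      (P.evenMap (oddJ P.rel j) ω) = 0 := by
  obtain ⟨f, hf, -, rfl⟩ := exists_special_decomposition P.rightFree_rel
    (P.rel_le_ker.trans P.ker_le_longWords) hω
  have hR := evenJ_le_pow _ hω
  have hl : ∀ N, f N ∈ gens k V ^ (N + 1) * evenJ P.rel j := fun N =>
    P.gens_mul_oddJ_le j N (specialPart_le_left N (hf N))
  have hr : ∀ N, f N ∈ evenJ P.rel j * gens k V ^ (N + 1) := fun N =>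
    P.oddJ_mul_gens_le j N (specialPart_le_right N (hf N))
  rw [P.evenMap_sum (P.specialPart_oddJ_injective j) f hf, Finsupp.sum, map_sum]
  have e : ∀ N, extend (P.oddMap (evenJ P.rel j) ∘ₗ (oddJ P.rel j).subtype)
      (∑ l ∈ Finset.range (N + 1), P.cut (oddJ P.rel j) l (N - l) (f N)) =
      P.cut (evenJ P.rel j) (N + 1) 0 (f N) - P.cut (evenJ P.rel j) 0 (N + 1) (f N) := by
    intro N
    rw [← P.sum_cut_sub_cut, map_sum]
    refine Finset.sum_congr rfl fun l hl => P.extend_oddMap_cut le_rfl ?_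
    exact specialPart_le _ (by have := Finset.mem_range.1 hl; omega) (hf N)
  simp only [e]
  rw [Finset.sum_sub_distrib]
  have h1 := P.sum_cut_left_eq_lamLeft
    ((P.leftFree_rel.pow j).mono (evenJ_le_pow j)) f hl
  have h2 := P.sum_cut_right_eq_lamRight
    ((P.rightFree_rel.pow j).mono (evenJ_le_pow j)) f hr
  -- After telescoping only the two extreme cuts of `ω` remain. Both vanish since `ω` lies in
  -- `R^(j+1)`, which is contained in `I R^(j)` and in `R^(j) I`.
  rw [P.lamLeft_eq_zero (P.leftFree_rel.pow j) (evenJ_le_pow j)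
    (finsuppSum_mem f fun N => mul_le_top_mul _ _ (hl N))
    (P.rel_pow_succ_le_ker_mul j hR)] at h1
  rw [P.lamRight_eq_zero (P.rightFree_rel.pow j) (evenJ_le_pow j)
    (finsuppSum_mem f fun N => mul_le_mul_top _ _ (hr N))
    (P.rel_pow_succ_le_mul_ker j hR)] at h2
  exact (congrArg₂ (· - ·) h1 h2).trans (sub_zero 0)

lemma leftAct_one {W : Type*} [AddCommGroup W] [Module k W] (x : FreeBimod k A W) :
    leftAct k A W 1 x = x := by
  have : leftAct k A W 1 = LinearMap.id := by ext; simp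
  rw [this, LinearMap.id_apply]

lemma rightAct_one {W : Type*} [AddCommGroup W] [Module k W] (x : FreeBimod k A W) :
    rightAct k A W 1 x = x := by
  have : rightAct k A W 1 = LinearMap.id := by ext; simp
  rw [this, LinearMap.id_apply]

/-- An element of `V · J_{2j+2}` is only a sum of products `v u`, so the decomposition is carried
along with the formula for the differential and added up. The extra letter on the left turns the
exponent `l` into `l + 1`. -/
lemma exists_left_decomposition [GradedAlgebra 𝒜] [Nontrivial A] (j : ℕ) {ω : TensorAlgebra k V}
    (hω : ω ∈ gens k V * evenJ P.rel (j + 1)) :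
    ∃ f : ℕ →₀ TensorAlgebra k V, (∀ N, f N ∈ gens k V * specialPart (oddJ P.rel j) N) ∧
      f 0 = 0 ∧ f.sum (fun _ y => y) = ω ∧
      extend (P.evenMap (oddJ P.rel j) ∘ₗ (evenJ P.rel (j + 1)).subtype)
        (P.cut (evenJ P.rel (j + 1)) 1 0 ω) =
        f.sum fun N y => ∑ l ∈ Finset.range (N + 1), P.cut (oddJ P.rel j) (l + 1) (N - l) y := by
  refine Submodule.mul_induction_on hω (fun v hv u hu => ?_) ?_
  · obtain ⟨f, hf, hf0, rfl⟩ := exists_special_decomposition P.rightFree_rel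
      (P.rel_le_ker.trans P.ker_le_longWords) hu
    refine ⟨f.mapRange (v * ·) (mul_zero v), fun N => ?_, ?_, ?_, ?_⟩
    · rw [Finsupp.mapRange_apply]; exact Submodule.mul_mem_mul hv (hf N)
    · rw [Finsupp.mapRange_apply, hf0, mul_zero]
    · rw [Finsupp.sum_mapRange_index (fun _ => rfl), Finsupp.mul_sum]
    · have h := P.cut_mul (l := 1) (m := 0) (by simpa using hv) hu (y := 1)
        (by rw [pow_zero]; exact Submodule.one_le.1 le_rfl)
      rw [mul_one, map_one P.π] at h
      rw [h, extend_tmul, rightAct_one, LinearMap.comp_apply, Submodule.subtype_apply,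
        P.evenMap_sum (P.specialPart_oddJ_injective j) f hf,
        Finsupp.sum_mapRange_index (fun _ => by simp), Finsupp.sum, Finsupp.sum, map_sum]
      refine Finset.sum_congr rfl fun N _ => ?_
      rw [map_sum]
      refine Finset.sum_congr rfl fun l hl => ?_
      have := P.cut_mul_mul (a := 1) (b := 0) (x := v) (y := 1) (by simpa using hv)
        (specialPart_le _ (by have := Finset.mem_range.1 hl; omega) (hf N) :
          f N ∈ gens k V ^ l * _ * gens k V ^ (N - l))
        (by rw [pow_zero]; exact Submodule.one_le.1 le_rfl)
      rw [map_one P.π, rightAct_one, mul_one, add_comm 1 l, add_zero] at this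
      exact this.symm
  · rintro x y ⟨f, hf, hf0, rfl, hfe⟩ ⟨g, hg, hg0, rfl, hge⟩
    refine ⟨f + g, fun N => add_mem (hf N) (hg N), by simp [hf0, hg0], ?_, ?_⟩
    · exact Finsupp.sum_add_index' (fun _ => rfl) fun _ _ _ => rfl
    · rw [map_add, map_add, hfe, hge]
      refine (Finsupp.sum_add_index' (fun _ => by simp) fun _ _ _ => ?_).symm
      simp [Finset.sum_add_distrib]

/-- Mirror image of `exists_left_decomposition`. The clause on `f 0` makes the comparison of the two
decompositions possible. -/
lemma exists_right_decomposition [GradedAlgebra 𝒜] [Nontrivial A] (j : ℕ) {ω : TensorAlgebra k V}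
    (hω : ω ∈ evenJ P.rel (j + 1) * gens k V) :
    ∃ f : ℕ →₀ TensorAlgebra k V, (∀ N, f N ∈ specialPart (oddJ P.rel j) N * gens k V) ∧
      f 0 = 0 ∧ f.sum (fun _ y => y) = ω ∧
      extend (P.evenMap (oddJ P.rel j) ∘ₗ (evenJ P.rel (j + 1)).subtype)
        (P.cut (evenJ P.rel (j + 1)) 0 1 ω) =
        f.sum fun N y => ∑ l ∈ Finset.range (N + 1), P.cut (oddJ P.rel j) l (N - l + 1) y := by
  refine Submodule.mul_induction_on hω (fun u hu v hv => ?_) ?_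
  · obtain ⟨f, hf, hf0, rfl⟩ := exists_special_decomposition P.rightFree_rel
      (P.rel_le_ker.trans P.ker_le_longWords) hu
    refine ⟨f.mapRange (· * v) (zero_mul v), fun N => ?_, ?_, ?_, ?_⟩
    · rw [Finsupp.mapRange_apply]; exact Submodule.mul_mem_mul (hf N) hv
    · rw [Finsupp.mapRange_apply, hf0, zero_mul]
    · rw [Finsupp.sum_mapRange_index (fun _ => rfl), Finsupp.sum_mul]
    · have h := P.cut_mul (l := 0) (m := 1) (x := 1)
        (by rw [pow_zero]; exact Submodule.one_le.1 le_rfl) hu (by simpa using hv)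
      rw [one_mul, map_one P.π] at h
      rw [h, extend_tmul, leftAct_one, LinearMap.comp_apply, Submodule.subtype_apply,
        P.evenMap_sum (P.specialPart_oddJ_injective j) f hf,
        Finsupp.sum_mapRange_index (fun _ => by simp), Finsupp.sum, Finsupp.sum, map_sum]
      refine Finset.sum_congr rfl fun N _ => ?_
      rw [map_sum]
      refine Finset.sum_congr rfl fun l hl => ?_
      have := P.cut_mul_mul (a := 0) (b := 1) (x := 1) (y := v)
        (by rw [pow_zero]; exact Submodule.one_le.1 le_rfl)
        (specialPart_le _ (by have := Finset.mem_range.1 hl; omega) (hf N) :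
          f N ∈ gens k V ^ l * _ * gens k V ^ (N - l))
        (by simpa using hv)
      rw [map_one P.π, leftAct_one, one_mul, zero_add] at this
      exact this.symm
  · rintro x y ⟨f, hf, hf0, rfl, hfe⟩ ⟨g, hg, hg0, rfl, hge⟩
    refine ⟨f + g, fun N => add_mem (hf N) (hg N), by simp [hf0, hg0], ?_, ?_⟩
    · exact Finsupp.sum_add_index' (fun _ => rfl) fun _ _ _ => rfl
    · rw [map_add, map_add, hfe, hge]
      refine (Finsupp.sum_add_index' (fun _ => by simp) fun _ _ _ => ?_).symm
      simp [Finset.sum_add_distrib]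

/-- The composite of the differentials `J_{2j+3} → A ⊗ J_{2j+2} ⊗ A → A ⊗ J_{2j+1} ⊗ A` is
zero. -/
lemma extend_evenMap_oddMap [GradedAlgebra 𝒜] [Nontrivial A] (j : ℕ) {ω : TensorAlgebra k V}
    (hω : ω ∈ oddJ P.rel (j + 1)) :
    extend (P.evenMap (oddJ P.rel j) ∘ₗ (evenJ P.rel (j + 1)).subtype)
      (P.oddMap (evenJ P.rel (j + 1)) ω) = 0 := by
  obtain ⟨f, hf, hf0, hfs, hfe⟩ := P.exists_left_decomposition j hω.1
  obtain ⟨g, hg, hg0, hgs, hge⟩ := P.exists_right_decomposition j hω.2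
  have hY := oddJ_le_right (R := P.rel) j
  have hY' := oddJ_le_left (R := P.rel) j
  have hRL := (P.leftFree_rel.pow j).mul leftFree_gens
  have hRR := rightFree_gens.mul (P.rightFree_rel.pow j)
  have hfr : ∀ N, f N ∈ gens k V ^ (N + 1) * oddJ P.rel j := fun N => by
    rw [pow_succ', mul_assoc]
    exact mul_le_mul' le_rfl (specialPart_le_left N) (hf N)
  have hgr : ∀ N, g N ∈ oddJ P.rel j * gens k V ^ (N + 1) := fun N => by
    rw [pow_succ, ← mul_assoc]
    exact mul_le_mul' (specialPart_le_right N) le_rfl (hg N)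
  -- Both decompositions of `ω` are expansions over the free space `V R^(j) V`, with coefficients
  -- sorted by length, hence they coincide.
  have hfg : f = g := by
    refine (rightFree_gens.mul ((P.rightFree_rel.pow j).mul rightFree_gens)).eq_of_sum_eq f g
      (fun N => ?_) (fun N => ?_) (hfs.trans hgs.symm)
    · rw [mul_assoc]
      exact mul_le_mul' le_rfl ((specialPart_le_right N).trans (mul_le_mul' hY le_rfl)) (hf N)
    -- In special degree `0` the space is `J_{2j+1} · V`, with no letter on the left to split off,
    -- so the vanishing of `g 0` is needed. In higher degree one letter is taken from the left of
    -- the special part.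
    · cases N with
      | zero => rw [hg0]; exact zero_mem _
      | succ N =>
        have h := mul_le_mul' (specialPart_le _ (add_comm 1 N)) le_rfl (hg (N + 1))
        rw [pow_one, mul_assoc, ← pow_succ] at h
        exact mul_le_mul' (mul_le_mul' le_rfl hY) le_rfl h
  subst hfg
  rw [P.oddMap_eq_cut hω, map_sub, hfe, hge, ← Finsupp.sum_sub]
  have e : ∀ N y, (∑ l ∈ Finset.range (N + 1), P.cut (oddJ P.rel j) (l + 1) (N - l) y) -
      (∑ l ∈ Finset.range (N + 1), P.cut (oddJ P.rel j) l (N - l + 1) y) =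
      P.cut (oddJ P.rel j) (N + 1) 0 y - P.cut (oddJ P.rel j) 0 (N + 1) y := fun N y => by
    rw [← P.sum_cut_sub_cut, Finset.sum_sub_distrib]
  simp only [e]
  -- The two extreme cuts are expansions over `R^(j) V` and `V R^(j)`. Their vanishing uses the two
  -- memberships of `ω` crosswise: `J_{2j+2} V ⊆ I R^(j) V` for the left cut, `V J_{2j+2} ⊆ V R^(j)
  -- I` for the right cut.
  rw [Finsupp.sum_sub, P.sum_cut_left_eq_lamLeft (hRL.mono hY) f hfr,
    P.sum_cut_right_eq_lamRight (hRR.mono hY') f hgr, hfs,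
    P.lamLeft_eq_zero hRL hY (hfs ▸ finsuppSum_mem f fun N => mul_le_top_mul _ _ (hfr N)),
    P.lamRight_eq_zero hRR hY'
      (hfs ▸ finsuppSum_mem f fun N => mul_le_mul_top _ _ (hgr N)), sub_zero]
  · rw [mul_assoc]
    exact (mul_le_mul' le_rfl ((evenJ_le_pow _).trans (P.rel_pow_succ_le_mul_ker j))) hω.1
  · rw [← mul_assoc]
    exact (mul_le_mul' ((evenJ_le_pow _).trans (P.rel_pow_succ_le_ker_mul j)) le_rfl) hω.2

lemma J_even {i : ℕ} (hi : Even i) : P.J i = evenJ P.rel (i / 2) := if_pos hi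

lemma J_odd {i : ℕ} (hi : ¬ Even i) : P.J i = oddJ P.rel (i / 2) := if_neg hi

lemma dJ_even {i : ℕ} (hi : Even i) : P.dJ i = P.oddMap (P.J i) ∘ₗ (P.J (i + 1)).subtype := by
  rw [dJ, if_pos hi]

lemma dJ_odd {i : ℕ} (hi : ¬ Even i) :
    P.dJ i = P.evenMap (P.J i) ∘ₗ (P.J (i + 1)).subtype := by
  rw [dJ, if_neg hi]

lemma d_dJ [GradedAlgebra 𝒜] [Nontrivial A] (i : ℕ) (w : P.J (i + 2)) :
    P.d i (P.dJ (i + 1) w) = 0 := by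
  obtain ⟨w, hw⟩ := w
  rw [d]
  by_cases hi : Even i
  · have h1 : ¬ Even (i + 1) := by simpa [Nat.even_add_one] using hi
    have h2 : Even (i + 2) := by simpa [Nat.even_add_one] using hi
    rw [P.dJ_even hi, P.dJ_odd h1, LinearMap.comp_apply, Submodule.subtype_apply]
    have e2 : (i + 2) / 2 = i / 2 + 1 := by omega
    have e1 : (i + 1) / 2 = i / 2 := by obtain ⟨m, rfl⟩ := hi; omega
    have hw' := hw
    rw [P.J_even h2, e2] at hw'
    have key := P.extend_oddMap_evenMap (i / 2) hw'
    have hU := P.J_even hi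
    have hW := P.J_odd h1
    rw [e1] at hW
    -- The types of the maps depend on the spaces, so the identity is transported along equalities
    -- of subspaces, not rewritten inside the goal.
    rw [← hU, ← hW] at key
    exact key
  · have h1 : Even (i + 1) := by simpa [Nat.even_add_one] using hi
    have h2 : ¬ Even (i + 2) := by simpa [Nat.even_add_one] using hi
    rw [P.dJ_odd hi, P.dJ_even h1, LinearMap.comp_apply, Submodule.subtype_apply]
    have e2 : (i + 2) / 2 = i / 2 + 1 := by omega
    have e1 : (i + 1) / 2 = i / 2 + 1 := by
      have := Nat.not_even_iff.1 hi; omega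
    have hw' := hw
    rw [P.J_odd h2, e2] at hw'
    have key := P.extend_evenMap_oddMap (i / 2) hw'
    have hU := P.J_odd hi
    have hW := P.J_even h1
    rw [e1] at hW
    rw [← hU, ← hW] at key
    exact key

/-- The square of the differential is zero. -/
lemma d_d [GradedAlgebra 𝒜] [Nontrivial A] (i : ℕ) (x : P.K (i + 2)) :
    P.d i (P.d (i + 1) x) = 0 := by
  induction x using TensorProduct.induction_on with
  | zero => simp
  | add a b ha hb => rw [map_add, map_add, ha, hb, add_zero]
  | tmul a y =>
    induction y with
    | zero => simp
    | add y z hy hz => rw [TensorProduct.tmul_add, map_add, map_add, hy, hz, add_zero]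
    | tmul w b =>
      rw [d.eq_def P (i + 1), extend_tmul, P.d_leftAct, P.d_rightAct, P.d_dJ, map_zero, map_zero]

lemma d₀_cut {l m : ℕ} {z : TensorAlgebra k V}
    (hz : z ∈ gens k V ^ l * P.J 0 * gens k V ^ m) : P.d₀ (P.cut (P.J 0) l m z) = P.π z := by
  refine mul_mul_induction hz (fun x hx w hw y hy => ?_) fun z z' hz hz' => ?_
  · rw [P.cut_mul hx hw hy]
    simp [d₀, mul_assoc]
  · simp only [map_add, hz, hz']

lemma d₀_d (x : P.K 1) : P.d₀ (P.d 0 x) = 0 := by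
  induction x using TensorProduct.induction_on with
  | zero => simp
  | add a b ha hb => rw [map_add, map_add, ha, hb, add_zero]
  | tmul a y =>
    induction y with
    | zero => simp
    | add y z hy hz => rw [TensorProduct.tmul_add, map_add, map_add, hy, hz, add_zero]
    | tmul w b =>
      obtain ⟨w, hw⟩ := w
      have hw' : w ∈ gens k V * P.J 0 ⊓ P.J 0 * gens k V := hw
      rw [d, extend_tmul, P.d₀_leftAct, P.d₀_rightAct, P.dJ_even Even.zero,
        LinearMap.comp_apply, Submodule.subtype_apply, P.oddMap_eq_cut hw', map_sub,
        P.d₀_cut (by simpa using hw'.1), P.d₀_cut (by simpa using hw'.2)]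
      simp

end DifferentialSquare

end MinimalPresentation

/-! ### Free modules over a graded algebra and their filtration by degree -/

section FreeComplexes

variable {A : Type*} [Ring A] [Algebra k A] (𝒜 : ℕ → Submodule k A)

/-- The elements of degree at least `m`. -/
def degreeGE (m : ℕ) : Submodule k A := ⨆ n : ℕ, ⨆ _ : m ≤ n, 𝒜 n

lemma le_degreeGE {m n : ℕ} (h : m ≤ n) : 𝒜 n ≤ degreeGE 𝒜 m := le_iSup₂_of_le n h le_rfl

lemma degreeGE_le_sup (m : ℕ) : degreeGE 𝒜 m ≤ 𝒜 m ⊔ degreeGE 𝒜 (m + 1) := by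
  refine iSup₂_le fun n hn => ?_
  rcases hn.eq_or_lt with rfl | h
  · exact le_sup_left
  · exact le_sup_of_le_right (le_degreeGE 𝒜 h)

/-- A unital multiplication on `A` compatible with the grading; this is the multiplication of `A`
or its opposite. -/
structure IsGradedMul (ν : A →ₗ[k] A →ₗ[k] A) : Prop where
  mul_one : ∀ a, ν a 1 = a
  mem : ∀ {m n a b}, a ∈ 𝒜 m → b ∈ 𝒜 n → ν a b ∈ 𝒜 (m + n)

variable {𝒜} {ν : A →ₗ[k] A →ₗ[k] A}

lemma IsGradedMul.mem_degreeGE (h : IsGradedMul 𝒜 ν) {m n : ℕ} {a b : A}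
    (ha : a ∈ degreeGE 𝒜 m) (hb : b ∈ degreeGE 𝒜 n) : ν a b ∈ degreeGE 𝒜 (m + n) := by
  have h1 : ∀ i, m ≤ i → ∀ a ∈ 𝒜 i, degreeGE 𝒜 n ≤ (degreeGE 𝒜 (m + n)).comap (ν a) :=
    fun i hi a ha => iSup₂_le fun l hl b hb => le_degreeGE 𝒜 (by omega) (h.mem ha hb)
  have h2 : degreeGE 𝒜 m ≤ (degreeGE 𝒜 (m + n)).comap (ν.flip b) :=
    iSup₂_le fun i hi a ha => h1 i hi a ha hb
  exact h2 ha

variable {K K' K'' L L' : Type*} [AddCommGroup K] [Module k K] [AddCommGroup K'] [Module k K']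
  [AddCommGroup K''] [Module k K''] [AddCommGroup L] [Module k L]
  [AddCommGroup L'] [Module k L']
  {act : A →ₗ[k] Module.End k K} {act' : A →ₗ[k] Module.End k K'} {act'' : A →ₗ[k] Module.End k K''}
  {j : L →ₗ[k] K} {j' : L' →ₗ[k] K''}

/-- The map `l ⊗ a ↦ a · j(l)`. -/
def actMap (act : A →ₗ[k] Module.End k K) (j : L →ₗ[k] K) : L ⊗[k] A →ₗ[k] K :=
  TensorProduct.lift (act.flip ∘ₗ j)

@[simp] lemma actMap_tmul (act : A →ₗ[k] Module.End k K) (j : L →ₗ[k] K) (l : L) (a : A) :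
    actMap act j (l ⊗ₜ a) = act a (j l) := rfl

/-- `K` is free over `(A, ν)` on the subspace `j(L)`. -/
structure IsFreeAction (ν : A →ₗ[k] A →ₗ[k] A) (act : A →ₗ[k] Module.End k K)
    (j : L →ₗ[k] K) : Prop where
  bijective : Function.Bijective (actMap act j)
  act_mul : ∀ a b x, act (ν a b) x = act a (act b x)
  act_one : ∀ x, act 1 x = x

variable (𝒜) in
/-- The subspace of `K` spanned by the products `a · x` with `a` of degree at least `m`. -/
def actGE (act : A →ₗ[k] Module.End k K) (m : ℕ) : Submodule k K :=
  Submodule.span k {y | ∃ a ∈ degreeGE 𝒜 m, ∃ x, y = act a x}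

/-- Compatibility of a linear map with actions of `A`. -/
def Equivariant (act : A →ₗ[k] Module.End k K) (act' : A →ₗ[k] Module.End k K')
    (f : K →ₗ[k] K') : Prop := ∀ a x, f (act a x) = act' a (f x)

lemma act_mem_actGE {m : ℕ} {a : A} (ha : a ∈ degreeGE 𝒜 m) (x : K) : act a x ∈ actGE 𝒜 act m :=
  Submodule.subset_span ⟨a, ha, x, rfl⟩

lemma Equivariant.map_mem {f : K →ₗ[k] K'} (hf : Equivariant act act' f) {m : ℕ} {x : K}
    (hx : x ∈ actGE 𝒜 act m) : f x ∈ actGE 𝒜 act' m := by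
  have : actGE 𝒜 act m ≤ (actGE 𝒜 act' m).comap f := by
    refine Submodule.span_le.2 ?_
    rintro _ ⟨a, ha, x, rfl⟩
    rw [SetLike.mem_coe, Submodule.mem_comap, hf]
    exact act_mem_actGE ha _
  exact this hx

/-! ### Splitting an exact complex of free modules -/

section Lifting

/-- Equivariant maps from a free module lift. -/
lemma IsFreeAction.exists_lift (h : IsFreeAction ν act j)
    (hmul' : ∀ a b x, act' (ν a b) x = act' a (act' b x)) {d : K' →ₗ[k] K}
    (hd : Equivariant act' act d) {r : K →ₗ[k] K} (hr : Equivariant act act r)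
    (hrd : ∀ x, ∃ y, d y = r x) :
    ∃ t : K →ₗ[k] K', Equivariant act act' t ∧ ∀ x, d (t x) = r x := by
  -- The free generators are lifted linearly, which is possible over a field; freeness extends the
  -- lift equivariantly.
  obtain ⟨t₀, ht₀⟩ := Module.projective_lifting_property d.rangeRestrict
    ((r ∘ₗ j).codRestrict (LinearMap.range d) fun l => hrd (j l))
    (LinearMap.surjective_rangeRestrict d)
  have ht₀' : ∀ l, d (t₀ l) = r (j l) := fun l => congrArg Subtype.val (LinearMap.congr_fun ht₀ l)
  let e := LinearEquiv.ofBijective _ h.bijective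
  have ht : ∀ ξ, (actMap act' t₀ ∘ₗ e.symm.toLinearMap) (actMap act j ξ) = actMap act' t₀ ξ :=
    fun ξ => congrArg (actMap act' t₀) (e.symm_apply_apply ξ)
  refine ⟨actMap act' t₀ ∘ₗ e.symm.toLinearMap, fun a x => ?_, fun x => ?_⟩
  · obtain ⟨ξ, rfl⟩ := h.bijective.2 x
    rw [ht]
    induction ξ with
    | zero => simp
    | add x y hx hy => simp only [map_add, hx, hy]
    | tmul l b =>
      rw [actMap_tmul, actMap_tmul, ← h.act_mul, ← actMap_tmul act j, ht, actMap_tmul, hmul']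
  · obtain ⟨ξ, rfl⟩ := h.bijective.2 x
    rw [ht]
    induction ξ with
    | zero => simp
    | add x y hx hy => simp only [map_add, hx, hy]
    | tmul l b => rw [actMap_tmul, actMap_tmul, hd, hr, ht₀']

/-- An equivariant retraction onto the kernel of an equivariant map. -/
def HasRetraction (act : A →ₗ[k] Module.End k K) (d : K →ₗ[k] K') : Prop :=
  ∃ r : K →ₗ[k] K, Equivariant act act r ∧ (∀ x, d (r x) = 0) ∧ ∀ x, d x = 0 → r x = x

/-- The retraction `r` onto `ker e = im d` lifts through `d` to a map `t` with `d t = r`. Then `1 -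
t d` is a retraction onto `ker d`, because `r` fixes the values of `d`. -/
lemma HasRetraction.succ (h : IsFreeAction ν act j)
    (hmul' : ∀ a b x, act' (ν a b) x = act' a (act' b x)) {d : K' →ₗ[k] K} {e : K →ₗ[k] K''}
    (hd : Equivariant act' act d) (hde : ∀ x, e (d x) = 0) (hex : ∀ x, e x = 0 → ∃ y, d y = x)
    (hr : HasRetraction act e) : HasRetraction act' d := by
  obtain ⟨r, hr, hr0, hr1⟩ := hr
  obtain ⟨t, ht, hdt⟩ := h.exists_lift hmul' hd hr fun x => hex _ (hr0 x)
  refine ⟨LinearMap.id - t ∘ₗ d, fun a x => ?_, fun x => ?_, fun x hx => ?_⟩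
  · simp [hd a x, ht a (d x)]
  · simp [hdt, hr1 _ (hde x)]
  · simp [hx]

/-- Here `r` is an equivariant retraction onto the image of `e`. If `e x = ∑ a · y`, then `e x = r
(e x) = ∑ a · r y`, and each `r y` is some `e y'`. So `x - ∑ a · y'` is a cycle, hence a boundary.
-/
lemma exists_sub_mem_of_retraction {d : K' →ₗ[k] K} {e : K →ₗ[k] K''}
    (he : Equivariant act act'' e) (hex : ∀ x, e x = 0 → ∃ y, d y = x) {r : K'' →ₗ[k] K''}
    (hr : Equivariant act'' act'' r) (hre : ∀ y, ∃ y', e y' = r y)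
    (hr1 : ∀ x, r (e x) = e x) {m : ℕ} {x : K} (hx : e x ∈ actGE 𝒜 act'' m) :
    ∃ y, x - d y ∈ actGE 𝒜 act m := by
  have h1 : actGE 𝒜 act'' m ≤ ((actGE 𝒜 act m).map e).comap r := by
    refine Submodule.span_le.2 ?_
    rintro _ ⟨a, ha, y, rfl⟩
    obtain ⟨y', hy'⟩ := hre y
    refine ⟨act a y', act_mem_actGE ha _, ?_⟩
    rw [he, hy', hr]
  obtain ⟨u, hu, hux⟩ := h1 hx
  rw [hr1] at hux
  obtain ⟨y, hy⟩ := hex (x - u) (by rw [map_sub, hux, sub_self])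
  exact ⟨y, by rw [hy, sub_sub_cancel]; exact hu⟩

end Lifting

/-! ### Graded Nakayama argument -/

section Nakayama

lemma IsFreeAction.act_mem (hν : IsGradedMul 𝒜 ν) (h : IsFreeAction ν act j) {m n : ℕ} {a : A}
    (ha : a ∈ degreeGE 𝒜 m) {x : K} (hx : x ∈ actGE 𝒜 act n) : act a x ∈ actGE 𝒜 act (m + n) := by
  have : actGE 𝒜 act n ≤ (actGE 𝒜 act (m + n)).comap (act a) := by
    refine Submodule.span_le.2 ?_
    rintro _ ⟨b, hb, x, rfl⟩
    rw [SetLike.mem_coe, Submodule.mem_comap, ← h.act_mul]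
    exact act_mem_actGE (hν.mem_degreeGE ha hb) x
  exact this hx

/-- Together with `mem_of_sum_mem` this identifies `A_{≥m} K / A_{≥m+1} K` with `A_m ⊗ K / A_{>0} K`
for free `K`. The present half is the generation statement and needs no freeness. -/
lemma exists_basis_expansion {ι : Type*} {m : ℕ} (b : Module.Basis ι k (𝒜 m)) {x : K}
    (hx : x ∈ actGE 𝒜 act m) :
    ∃ f : ι →₀ K, x - f.sum (fun i y => act (b i) y) ∈ actGE 𝒜 act (m + 1) := by
  refine Submodule.span_induction ?_ ⟨0, by simp⟩ ?_ ?_ hx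
  · rintro _ ⟨a, ha, x, rfl⟩
    obtain ⟨a₀, ha₀, a₁, ha₁, rfl⟩ := Submodule.mem_sup.1 (degreeGE_le_sup 𝒜 m ha)
    refine ⟨(b.repr ⟨a₀, ha₀⟩).mapRange (· • x) (zero_smul _ _), ?_⟩
    have h0 : act a₀ x = ((b.repr ⟨a₀, ha₀⟩).mapRange (· • x) (zero_smul _ _)).sum
        (fun i y => act (b i) y) := by
      rw [Finsupp.sum_mapRange_index (fun _ => by simp)]
      have := congrArg Subtype.val (b.linearCombination_repr ⟨a₀, ha₀⟩)
      rw [Finsupp.linearCombination_apply, Finsupp.sum, Submodule.coe_sum] at this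
      conv_lhs => rw [← show _ = a₀ from this]
      rw [map_sum, LinearMap.sum_apply]
      exact Finset.sum_congr rfl fun i _ => by simp
    rw [map_add, LinearMap.add_apply, ← h0, add_sub_cancel_left]
    exact act_mem_actGE ha₁ x
  · rintro x y _ _ ⟨f, hf⟩ ⟨g, hg⟩
    refine ⟨f + g, ?_⟩
    rw [Finsupp.sum_add_index' (fun _ => by simp) fun _ _ _ => by simp, add_sub_add_comm]
    exact add_mem hf hg
  · rintro c x _ ⟨f, hf⟩
    refine ⟨c • f, ?_⟩
    rw [Finsupp.sum_smul_index' (fun _ => by simp)]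
    simp only [map_smul]
    rw [← Finsupp.smul_sum, ← smul_sub]
    exact Submodule.smul_mem _ _ hf

variable [GradedAlgebra 𝒜]

variable (𝒜) in
/-- The projection onto the component of degree `m`. -/
def component (m : ℕ) : A →ₗ[k] 𝒜 m :=
  DirectSum.component k ℕ (fun i => 𝒜 i) m ∘ₗ (DirectSum.decomposeLinearEquiv 𝒜).toLinearMap

lemma component_of_mem {m : ℕ} (a : 𝒜 m) : component 𝒜 m a = a := by
  refine Subtype.ext ?_
  exact DirectSum.decompose_of_mem_same 𝒜 a.2

lemma component_eq_zero {m : ℕ} {a : A} (ha : a ∈ degreeGE 𝒜 (m + 1)) : component 𝒜 m a = 0 := by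
  have : degreeGE 𝒜 (m + 1) ≤ LinearMap.ker (component 𝒜 m) :=
    iSup₂_le fun n hn a ha => Subtype.ext (DirectSum.decompose_of_mem_ne 𝒜 ha (by omega))
  exact this ha

lemma mem_degreeGE_zero (a : A) : a ∈ degreeGE 𝒜 0 := by
  have h1 : ⨆ n, 𝒜 n ≤ degreeGE 𝒜 0 := iSup_le fun n => le_degreeGE 𝒜 n.zero_le
  rw [(DirectSum.Decomposition.isInternal 𝒜).submodule_iSup_eq_top] at h1
  exact h1 Submodule.mem_top

lemma IsFreeAction.exists_sub_mem (h : IsFreeAction ν act j) (connected : 𝒜 0 = 1) (x : K) :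
    ∃ l, x - j l ∈ actGE 𝒜 act 1 := by
  obtain ⟨ξ, rfl⟩ := h.bijective.2 x
  induction ξ with
  | zero => exact ⟨0, by simp⟩
  | add x y hx hy =>
    obtain ⟨l, hl⟩ := hx
    obtain ⟨l', hl'⟩ := hy
    refine ⟨l + l', ?_⟩
    rw [map_add, map_add, add_sub_add_comm]
    exact add_mem hl hl'
  | tmul l a =>
    obtain ⟨a₀, ha₀, a₁, ha₁, rfl⟩ :=
      Submodule.mem_sup.1 (degreeGE_le_sup 𝒜 0 (mem_degreeGE_zero (𝒜 := 𝒜) a))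
    rw [connected] at ha₀
    obtain ⟨c, rfl⟩ := Submodule.mem_one.1 ha₀
    refine ⟨c • l, ?_⟩
    rw [actMap_tmul, map_add, LinearMap.add_apply, Algebra.algebraMap_eq_smul_one, map_smul,
      LinearMap.smul_apply, h.act_one, map_smul, add_sub_cancel_left]
    exact act_mem_actGE ha₁ _

/-- Modulo `A_{>0} K` each `f i` may be replaced by a free generator `j (l (f i))`, which changes
the sum only within `A_{≥m+1} K`. Reading off the coefficient of `b i` then gives `l (f i) = 0`. -/
lemma IsFreeAction.mem_of_sum_mem (hν : IsGradedMul 𝒜 ν) (h : IsFreeAction ν act j)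
    (connected : 𝒜 0 = 1) {ι : Type*} {m : ℕ} (b : Module.Basis ι k (𝒜 m)) (f : ι →₀ K)
    (hf : f.sum (fun i y => act (b i) y) ∈ actGE 𝒜 act (m + 1)) (i : ι) :
    f i ∈ actGE 𝒜 act 1 := by
  classical
  by_cases hi : i ∈ f.support
  swap
  · rw [Finsupp.notMem_support_iff.1 hi]; exact zero_mem _
  choose l hl using h.exists_sub_mem connected
  let e := LinearEquiv.ofBijective _ h.bijective
  -- In `K = L ⊗ A` this extracts the `L`-valued coefficient of the basis vector `b i` of `A_m`; it
  -- kills `A_{≥m+1} K`.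
  let κ : K →ₗ[k] L := (TensorProduct.rid k L).toLinearMap ∘ₗ
    (b.coord i ∘ₗ component 𝒜 m).lTensor L ∘ₗ e.symm.toLinearMap
  have hκ : ∀ (l : L) a, κ (act a (j l)) = b.coord i (component 𝒜 m a) • l := by
    intro l a
    have : e.symm (act a (j l)) = l ⊗ₜ a := e.symm_apply_apply (l ⊗ₜ a)
    simp [κ, this]
  have hκ0 : ∀ x ∈ actGE 𝒜 act (m + 1), κ x = 0 := by
    intro x hx
    have : actGE 𝒜 act (m + 1) ≤ LinearMap.ker κ := by
      refine Submodule.span_le.2 ?_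
      rintro _ ⟨a, ha, x, rfl⟩
      obtain ⟨ξ, rfl⟩ := h.bijective.2 x
      rw [SetLike.mem_coe, LinearMap.mem_ker]
      induction ξ with
      | zero => simp
      | add x y hx hy => rw [map_add, map_add, map_add, hx, hy, add_zero]
      | tmul l c =>
        have hc : ν a c ∈ degreeGE 𝒜 (m + 1) :=
          hν.mem_degreeGE (m := m + 1) (n := 0) ha (mem_degreeGE_zero c)
        rw [actMap_tmul, ← h.act_mul, hκ, component_eq_zero hc, map_zero, zero_smul]
    exact this hx
  have h1 : f.sum (fun i y => act (b i) (j (l y))) ∈ actGE 𝒜 act (m + 1) := by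
    have : f.sum (fun i y => act (b i) (j (l y))) =
        f.sum (fun i y => act (b i) y) - f.sum (fun i y => act (b i) (y - j (l y))) := by
      rw [← Finsupp.sum_sub]
      simp
    rw [this]
    exact sub_mem hf (sum_mem fun i _ => h.act_mem hν (le_degreeGE 𝒜 le_rfl (b i).2) (hl _))
  have h2 := hκ0 _ h1
  rw [Finsupp.sum, map_sum, Finset.sum_eq_single i] at h2
  · rw [hκ, component_of_mem, Module.Basis.coord_apply, Module.Basis.repr_self,
      Finsupp.single_eq_same, one_smul] at h2
    have := hl (f i)
    rwa [h2, map_zero, sub_zero] at this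
  · intro i' _ hi'
    rw [hκ, component_of_mem, Module.Basis.coord_apply, Module.Basis.repr_self,
      Finsupp.single_eq_of_ne hi'.symm, zero_smul]
  · exact fun h => absurd hi h

/-- Cycles are boundaries up to terms of arbitrarily high filtration. -/
lemma exists_sub_mem_actGE (hν : IsGradedMul 𝒜 ν) (connected : 𝒜 0 = 1)
    (h : IsFreeAction ν act j) (h'' : IsFreeAction ν act'' j')
    {d : K' →ₗ[k] K} {e : K →ₗ[k] K''} (hd : Equivariant act' act d)
    (he : Equivariant act act'' e) (hde : ∀ x, e (d x) = 0)
    (hbar : ∀ x, e x ∈ actGE 𝒜 act'' 1 → ∃ y, x - d y ∈ actGE 𝒜 act 1) (m : ℕ) (x : K)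
    (hx : e x = 0) : ∃ y, x - d y ∈ actGE 𝒜 act m := by
  induction m with
  | zero =>
    refine ⟨0, ?_⟩
    rw [← h.act_one (x - d 0)]
    exact act_mem_actGE (le_degreeGE 𝒜 le_rfl (SetLike.GradedOne.one_mem)) _
  | succ m ih =>
    obtain ⟨y, hy⟩ := ih
    let b := Module.Free.chooseBasis k (𝒜 m)
    obtain ⟨f, hf⟩ := exists_basis_expansion b hy
    have h1 : (f.mapRange e (map_zero e)).sum (fun i y => act'' (b i) y) ∈
        actGE 𝒜 act'' (m + 1) := by
      have := he.map_mem hf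
      rw [map_sub, map_sub, hx, hde, sub_zero, zero_sub, neg_mem_iff, Finsupp.sum, map_sum] at this
      rw [Finsupp.sum_mapRange_index (fun _ => by simp), Finsupp.sum]
      convert this using 2 with i
      rw [he]
    -- Since `x - d y` is a cycle, `∑ b i · e (f i)` has filtration at least `m + 1`. Freeness of
    -- the target gives `e (f i) ∈ A_{>0} K''`, so the hypothesis modulo `A_{>0}` applies to each `f
    -- i`.
    have h2 : ∀ i, ∃ y, f i - d y ∈ actGE 𝒜 act 1 := fun i => by
      have := h''.mem_of_sum_mem hν connected b _ h1 i
      rw [Finsupp.mapRange_apply] at this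
      exact hbar _ this
    choose z hz using h2
    refine ⟨y + ∑ i ∈ f.support, act' (b i) (z i), ?_⟩
    have h3 : ∑ i ∈ f.support, act (b i) (f i - d (z i)) ∈ actGE 𝒜 act (m + 1) :=
      sum_mem fun i _ => h.act_mem hν (le_degreeGE 𝒜 le_rfl (b i).2) (hz i)
    have h4 := add_mem hf h3
    convert h4 using 1
    rw [Finsupp.sum, map_add, map_sum]
    simp only [map_sub, Finset.sum_sub_distrib, hd _ _]
    abel

/-- The maps `q n` stand for the projections onto the components of total degree `n`. An error in
`A_{≥n+1} K` is invisible to `q n`, so no limit is needed: each component of `x` is exactly a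
boundary. -/
lemma mem_range_of_eq_zero (hν : IsGradedMul 𝒜 ν) (connected : 𝒜 0 = 1)
    (h : IsFreeAction ν act j) (h'' : IsFreeAction ν act'' j')
    {d : K' →ₗ[k] K} {e : K →ₗ[k] K''} (hd : Equivariant act' act d)
    (he : Equivariant act act'' e) (hde : ∀ x, e (d x) = 0)
    (hbar : ∀ x, e x ∈ actGE 𝒜 act'' 1 → ∃ y, x - d y ∈ actGE 𝒜 act 1)
    {q : ℕ → K →ₗ[k] K} {q' : ℕ → K' →ₗ[k] K'} (hq : ∀ n y, q n (d y) = d (q' n y))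
    (hq0 : ∀ n, ∀ x ∈ actGE 𝒜 act (n + 1), q n x = 0)
    (hqmem : ∀ (N : Submodule k K) (x : K), (∀ n, q n x ∈ N) → x ∈ N) (x : K) (hx : e x = 0) :
    ∃ y, d y = x := by
  refine hqmem (LinearMap.range d) x fun n => ?_
  obtain ⟨y, hy⟩ := exists_sub_mem_actGE hν connected h h'' hd he hde hbar (n + 1) x hx
  refine ⟨q' n y, ?_⟩
  have := hq0 n _ hy
  rwa [map_sub, hq, sub_eq_zero, eq_comm] at this

end Nakayama

end FreeComplexes

/-! ### Gradings given by projections, and their tensor products -/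

section Gradings

variable {M N M' : Type*} [AddCommGroup M] [Module k M] [AddCommGroup N] [Module k N]
  [AddCommGroup M'] [Module k M']

/-- The elements that are homogeneous of degree `n` for a family of projections. -/
def homogeneousPart (p : ℕ → M →ₗ[k] M) (n : ℕ) : Submodule k M where
  carrier := {x | ∀ m, p m x = if m = n then x else 0}
  add_mem' := fun {x y} hx hy m => by
    rw [map_add, hx, hy]
    split_ifs <;> simp
  zero_mem' := fun m => by simp
  smul_mem' := fun c x hx m => by
    rw [map_smul, hx]
    split_ifs <;> simp

variable (k M) in
/-- A grading of `M`, given by the projections onto its components. -/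
structure Grading where
  p : ℕ → M →ₗ[k] M
  iSup_homogeneousPart : ⨆ n, homogeneousPart p n = ⊤

/-- The elements of degree `n`. -/
abbrev Grading.homog (G : Grading k M) (n : ℕ) : Submodule k M := homogeneousPart G.p n

/-- Homogeneous elements span by assumption; applying `G.p n` to a decomposition of `x` returns its
`n`-th term, so the projections themselves decompose `x`. -/
lemma Grading.exists_sum (G : Grading k M) (x : M) :
    ∃ s : Finset ℕ, ∑ n ∈ s, G.p n x = x ∧ ∀ n, G.p n x ∈ G.homog n := by
  classical
  have hx : x ∈ ⨆ n, G.homog n := G.iSup_homogeneousPart ▸ Submodule.mem_top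
  obtain ⟨f, hf, hs⟩ := (Submodule.mem_iSup_iff_exists_finsupp _ _).1 hx
  have h : ∀ n, G.p n x = f n := by
    intro n
    rw [← hs, Finsupp.sum, map_sum]
    have : ∀ m, G.p n (f m) = if n = m then f m else 0 := fun m => hf m n
    simp only [this]
    rw [Finset.sum_ite_eq]
    split_ifs with h
    · rfl
    · exact (Finsupp.notMem_support_iff.1 h).symm
  refine ⟨f.support, ?_, fun n => h n ▸ hf n⟩
  simp only [h]
  exact hs

lemma Grading.mem_of_forall (G : Grading k M) (X : Submodule k M) (x : M)
    (h : ∀ n, G.p n x ∈ X) : x ∈ X := by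
  obtain ⟨s, hs, -⟩ := G.exists_sum x
  rw [← hs]
  exact sum_mem fun n _ => h n

/-- A linear map of degree zero between graded spaces. -/
def IsGradedMap (G : Grading k M) (H : Grading k N) (f : M →ₗ[k] N) : Prop :=
  ∀ n x, f (G.p n x) = H.p n (f x)

lemma IsGradedMap.mem {G : Grading k M} {H : Grading k N} {f : M →ₗ[k] N}
    (hf : IsGradedMap G H f) {n : ℕ} {x : M} (hx : x ∈ G.homog n) : f x ∈ H.homog n := by
  intro m
  rw [← hf, hx m]
  split_ifs <;> simp

lemma isGradedMap_of_iSup {G : Grading k M} {H : Grading k N} {f : M →ₗ[k] N}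
    {X : ℕ → Submodule k M} (hX : ⨆ n, X n = ⊤) (hXG : ∀ n, X n ≤ G.homog n)
    (hf : ∀ n, ∀ x ∈ X n, f x ∈ H.homog n) : IsGradedMap G H f := by
  intro n x
  have hx : x ∈ ⨆ n, X n := hX ▸ Submodule.mem_top
  induction hx using Submodule.iSup_induction' with
  | zero => simp
  | add x y _ _ hx hy => simp only [map_add, hx, hy]
  | mem m x hx =>
    rw [hXG m hx n, hf m x hx n]
    split_ifs <;> simp

/-- The grading of a tensor product. -/
def tensorP (p : ℕ → M →ₗ[k] M) (q : ℕ → N →ₗ[k] N) (n : ℕ) : M ⊗[k] N →ₗ[k] M ⊗[k] N :=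
  ∑ a ∈ Finset.HasAntidiagonal.antidiagonal n, TensorProduct.map (p a.1) (q a.2)

lemma tensorP_tmul (p : ℕ → M →ₗ[k] M) (q : ℕ → N →ₗ[k] N) (n : ℕ) (x : M) (y : N) :
    tensorP p q n (x ⊗ₜ y) = ∑ a ∈ Finset.HasAntidiagonal.antidiagonal n, p a.1 x ⊗ₜ q a.2 y := by
  simp [tensorP]

lemma tmul_mem_homogeneousPart {p : ℕ → M →ₗ[k] M} {q : ℕ → N →ₗ[k] N} {a b : ℕ} {x : M} {y : N}
    (hx : x ∈ homogeneousPart p a) (hy : y ∈ homogeneousPart q b) :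
    x ⊗ₜ y ∈ homogeneousPart (tensorP p q) (a + b) := by
  intro m
  rw [tensorP_tmul]
  have h : ∀ i : ℕ × ℕ, p i.1 x ⊗ₜ[k] q i.2 y = if i = (a, b) then x ⊗ₜ y else 0 := by
    rintro ⟨i, i'⟩
    have h1 := hx i
    have h2 := hy i'
    rw [h1, h2]
    by_cases hi : i = a <;> by_cases hi' : i' = b <;> simp [hi, hi']
  simp only [h, Finset.sum_ite_eq', Finset.HasAntidiagonal.mem_antidiagonal, eq_comm (a := m)]

/-- The pure tensors of homogeneous elements of total degree `n`. -/
def pureTensors (p : ℕ → M →ₗ[k] M) (q : ℕ → N →ₗ[k] N) (n : ℕ) : Set (M ⊗[k] N) :=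
  {z | ∃ a b, a + b = n ∧ ∃ x ∈ homogeneousPart p a, ∃ y ∈ homogeneousPart q b, z = x ⊗ₜ y}

lemma span_pureTensors_le (p : ℕ → M →ₗ[k] M) (q : ℕ → N →ₗ[k] N) (n : ℕ) :
    Submodule.span k (pureTensors p q n) ≤ homogeneousPart (tensorP p q) n := by
  refine Submodule.span_le.2 ?_
  rintro _ ⟨a, b, rfl, x, hx, y, hy, rfl⟩
  exact tmul_mem_homogeneousPart hx hy

lemma iSup_span_pureTensors (G : Grading k M) (H : Grading k N) :
    ⨆ n, Submodule.span k (pureTensors G.p H.p n) = ⊤ := by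
  rw [eq_top_iff, ← TensorProduct.span_tmul_eq_top, Submodule.span_le]
  rintro _ ⟨x, y, rfl⟩
  obtain ⟨s, hs, hs'⟩ := G.exists_sum x
  obtain ⟨t, ht, ht'⟩ := H.exists_sum y
  rw [← hs, ← ht, TensorProduct.sum_tmul]
  refine sum_mem fun i _ => ?_
  rw [TensorProduct.tmul_sum]
  refine sum_mem fun i' _ => ?_
  exact Submodule.mem_iSup_of_mem (i + i') (Submodule.subset_span
    ⟨i, i', rfl, _, hs' i, _, ht' i', rfl⟩)

/-- The grading of a tensor product. -/
def Grading.tensor (G : Grading k M) (H : Grading k N) : Grading k (M ⊗[k] N) where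
  p := tensorP G.p H.p
  iSup_homogeneousPart := top_le_iff.1 ((iSup_span_pureTensors G H).ge.trans
    (iSup_mono fun n => span_pureTensors_le G.p H.p n))

/-- The projection of degree `n` maps everything into this span and fixes the homogeneous elements
of degree `n`. -/
lemma Grading.mem_span_pureTensors {G : Grading k M} {H : Grading k N} {n : ℕ} {z : M ⊗[k] N}
    (hz : z ∈ (G.tensor H).homog n) : z ∈ Submodule.span k (pureTensors G.p H.p n) := by
  have h : ∀ z, (G.tensor H).p n z ∈ Submodule.span k (pureTensors G.p H.p n) := by
    intro z
    have hz : z ∈ ⨆ n, Submodule.span k (pureTensors G.p H.p n) :=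
      iSup_span_pureTensors G H ▸ Submodule.mem_top
    induction hz using Submodule.iSup_induction' with
    | zero => simp
    | add x y _ _ hx hy => rw [map_add]; exact add_mem hx hy
    | mem m x hx =>
      have h1 := span_pureTensors_le G.p H.p m hx n
      change tensorP G.p H.p n x ∈ _
      rw [h1]
      split_ifs with hnm
      · rwa [hnm]
      · exact zero_mem _
  have h1 := h z
  rwa [hz n, if_pos rfl] at h1

lemma isGradedMap_of_tmul {G : Grading k M} {H : Grading k N} {G' : Grading k M'}
    {f : M ⊗[k] N →ₗ[k] M'}
    (hf : ∀ a b, ∀ x ∈ G.homog a, ∀ y ∈ H.homog b, f (x ⊗ₜ y) ∈ G'.homog (a + b)) :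
    IsGradedMap (G.tensor H) G' f := by
  refine isGradedMap_of_iSup (iSup_span_pureTensors G H) (span_pureTensors_le G.p H.p) ?_
  intro n x hx
  have : Submodule.span k (pureTensors G.p H.p n) ≤ (G'.homog n).comap f := by
    refine Submodule.span_le.2 ?_
    rintro _ ⟨a, b, rfl, x, hx, y, hy, rfl⟩
    exact hf a b x hx y hy
  exact this hx

/-- Stability under the projections onto the graded components. -/
def Grading.Stable (G : Grading k M) (X : Submodule k M) : Prop := ∀ n, ∀ x ∈ X, G.p n x ∈ X

/-- The grading of a graded subspace. -/
def Grading.restrict (G : Grading k M) {X : Submodule k M} (hX : G.Stable X) : Grading k X where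
  p n := (G.p n).restrict (hX n)
  iSup_homogeneousPart := by
    rw [eq_top_iff]
    intro x _
    obtain ⟨s, hs, hs'⟩ := G.exists_sum x
    have : x = ∑ n ∈ s, (G.p n).restrict (hX n) x := by
      refine Subtype.ext ?_
      rw [Submodule.coe_sum]
      exact hs.symm
    rw [this]
    refine sum_mem fun n _ => Submodule.mem_iSup_of_mem n fun m => Subtype.ext ?_
    have := hs' n m
    split_ifs with hmn
    · rw [if_pos hmn] at this; exact this
    · rw [if_neg hmn] at this; exact this

lemma Grading.Stable.inf {G : Grading k M} {X Y : Submodule k M} (hX : G.Stable X)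
    (hY : G.Stable Y) : G.Stable (X ⊓ Y) :=
  fun n x hx => ⟨hX n x hx.1, hY n x hx.2⟩

lemma Grading.Stable.iInf {ι : Sort*} {G : Grading k M} {X : ι → Submodule k M}
    (hX : ∀ i, G.Stable (X i)) : G.Stable (⨅ i, X i) := by
  intro n x hx
  rw [Submodule.mem_iInf] at hx ⊢
  exact fun i => hX i n x (hx i)

lemma Grading.Stable.iSup {ι : Sort*} {G : Grading k M} {X : ι → Submodule k M}
    (hX : ∀ i, G.Stable (X i)) : G.Stable (⨆ i, X i) := by
  intro n x hx
  have : ⨆ i, X i ≤ (⨆ i, X i).comap (G.p n) :=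
    iSup_le fun i x hx => Submodule.mem_iSup_of_mem i (hX i n x hx)
  exact this hx

end Gradings

/-! ### The grading of the tensor algebra induced by the generators -/

section TensorAlgebraGrading

variable {V : Type*} [AddCommGroup V] [Module k V] {𝒱 : ℕ → Submodule k V}

open Polynomial in
/-- The coaction `T(V) → T(V)[X]` of a grading of `V`. -/
def coaction (h : DirectSum.IsInternal 𝒱) : TensorAlgebra k V →ₐ[k] (TensorAlgebra k V)[X] :=
  TensorAlgebra.lift k (DirectSum.toModule k ℕ _ (fun n =>
    (Polynomial.monomial n).restrictScalars k ∘ₗ TensorAlgebra.ι k ∘ₗ (𝒱 n).subtype) ∘ₗ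
      (LinearEquiv.ofBijective (DirectSum.coeLinearMap 𝒱) h).symm.toLinearMap)

lemma coaction_ι (h : DirectSum.IsInternal 𝒱) {n : ℕ} {v : V} (hv : v ∈ 𝒱 n) :
    coaction h (TensorAlgebra.ι k v) = Polynomial.monomial n (TensorAlgebra.ι k v) := by
  have e : (LinearEquiv.ofBijective (DirectSum.coeLinearMap 𝒱) h).symm v =
      DirectSum.lof k ℕ (fun i => 𝒱 i) n ⟨v, hv⟩ := by
    rw [LinearEquiv.symm_apply_eq]
    exact (DirectSum.coeLinearMap_lof 𝒱 n ⟨v, hv⟩).symm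
  rw [coaction, TensorAlgebra.lift_ι_apply, LinearMap.comp_apply, LinearEquiv.coe_coe, e,
    DirectSum.toModule_lof]
  rfl

/-- The projections of `T(V)` for the grading induced by `V`. -/
def tensorAlgebraP (h : DirectSum.IsInternal 𝒱) (n : ℕ) :
    TensorAlgebra k V →ₗ[k] TensorAlgebra k V :=
  (Polynomial.lcoeff (TensorAlgebra k V) n).restrictScalars k ∘ₗ (coaction h).toLinearMap

lemma tensorAlgebraP_apply (h : DirectSum.IsInternal 𝒱) (n : ℕ) (x : TensorAlgebra k V) :
    tensorAlgebraP h n x = (coaction h x).coeff n := rfl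

lemma tensorAlgebraP_mul (h : DirectSum.IsInternal 𝒱) (n : ℕ) (x y : TensorAlgebra k V) :
    tensorAlgebraP h n (x * y) =
      ∑ a ∈ Finset.HasAntidiagonal.antidiagonal n, tensorAlgebraP h a.1 x * tensorAlgebraP h a.2 y := by
  simp only [tensorAlgebraP_apply, map_mul, Polynomial.coeff_mul]

/-- Homogeneity becomes the identity `x ↦ x X^n` for an algebra map, so it is compatible with
products at once. -/
lemma mem_homogeneousPart_iff (h : DirectSum.IsInternal 𝒱) {n : ℕ} {x : TensorAlgebra k V} :
    x ∈ homogeneousPart (tensorAlgebraP h) n ↔ coaction h x = Polynomial.monomial n x := by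
  rw [Polynomial.ext_iff]
  refine forall_congr' fun m => ?_
  rw [Polynomial.coeff_monomial, tensorAlgebraP_apply]
  simp only [eq_comm]

lemma homogeneousPart_mul_le (h : DirectSum.IsInternal 𝒱) (a b : ℕ) :
    homogeneousPart (tensorAlgebraP h) a * homogeneousPart (tensorAlgebraP h) b ≤
      homogeneousPart (tensorAlgebraP h) (a + b) := by
  refine Submodule.mul_le.2 fun x hx y hy => ?_
  rw [mem_homogeneousPart_iff] at *
  rw [map_mul, hx, hy, Polynomial.monomial_mul_monomial]

lemma one_le_homogeneousPart (h : DirectSum.IsInternal 𝒱) :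
    1 ≤ homogeneousPart (tensorAlgebraP h) 0 := by
  rw [Submodule.one_le, mem_homogeneousPart_iff, map_one, Polynomial.monomial_zero_one]

lemma map_ι_le_homogeneousPart (h : DirectSum.IsInternal 𝒱) (n : ℕ) :
    (𝒱 n).map (TensorAlgebra.ι k) ≤ homogeneousPart (tensorAlgebraP h) n := by
  rintro _ ⟨v, hv, rfl⟩
  rw [mem_homogeneousPart_iff, coaction_ι h hv]

lemma usualDegree_le_homogeneousPart (h : DirectSum.IsInternal 𝒱) (n : ℕ) :
    usualDegree 𝒱 n ≤ homogeneousPart (tensorAlgebraP h) n := by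
  refine iSup_le fun r => iSup₂_le fun c hc => ?_
  subst hc
  induction r with
  | zero => simpa using one_le_homogeneousPart h
  | succ r ih =>
    rw [List.ofFn_succ, List.prod_cons, Fin.sum_univ_succ]
    exact (mul_le_mul' (map_ι_le_homogeneousPart h _) (ih _)).trans (homogeneousPart_mul_le h _ _)

/-- A family of subspaces of `T(V)` compatible with the multiplication that contains the
homogeneous generators spans `T(V)`. -/
lemma iSup_eq_top_of_mul_le (h : DirectSum.IsInternal 𝒱)
    {X : ℕ → Submodule k (TensorAlgebra k V)} (h1 : 1 ≤ X 0)
    (hV : ∀ n, (𝒱 n).map (TensorAlgebra.ι k) ≤ X n) (hX : ∀ a b, X a * X b ≤ X (a + b)) :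
    ⨆ n, X n = ⊤ := by
  rw [eq_top_iff]
  intro x _
  induction x using TensorAlgebra.induction with
  | algebraMap r => exact Submodule.mem_iSup_of_mem 0 (h1 (Submodule.algebraMap_mem r))
  | ι v =>
    have hv : v ∈ ⨆ n, 𝒱 n := h.submodule_iSup_eq_top ▸ Submodule.mem_top
    have : (⨆ n, 𝒱 n).map (TensorAlgebra.ι k) ≤ ⨆ n, X n := by
      rw [Submodule.map_iSup]
      exact iSup_mono hV
    exact this ⟨v, hv, rfl⟩
  | mul a b ha hb =>
    have : (⨆ n, X n) * ⨆ n, X n ≤ ⨆ n, X n := by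
      rw [Submodule.iSup_mul]
      refine iSup_le fun n => ?_
      rw [Submodule.mul_iSup]
      exact iSup_le fun m => (hX n m).trans (le_iSup X (n + m))
    exact this (Submodule.mul_mem_mul (ha trivial) (hb trivial))
  | add a b ha hb => exact add_mem (ha trivial) (hb trivial)

/-- The grading of `T(V)` induced by a grading of `V`. -/
def tensorAlgebraGrading (h : DirectSum.IsInternal 𝒱) : Grading k (TensorAlgebra k V) where
  p := tensorAlgebraP h
  iSup_homogeneousPart := iSup_eq_top_of_mul_le h (one_le_homogeneousPart h)
    (map_ι_le_homogeneousPart h) (homogeneousPart_mul_le h)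

variable {h : DirectSum.IsInternal 𝒱} {X Y : Submodule k (TensorAlgebra k V)}

lemma stable_mul (hX : (tensorAlgebraGrading h).Stable X)
    (hY : (tensorAlgebraGrading h).Stable Y) : (tensorAlgebraGrading h).Stable (X * Y) := by
  intro n z hz
  refine Submodule.mul_induction_on hz (fun x hx y hy => ?_) fun x y hx hy => ?_
  · change tensorAlgebraP h n (x * y) ∈ _
    rw [tensorAlgebraP_mul]
    exact sum_mem fun a _ => Submodule.mul_mem_mul (hX _ x hx) (hY _ y hy)
  · rw [map_add]; exact add_mem hx hy

lemma stable_of_le {n : ℕ} (hX : X ≤ (tensorAlgebraGrading h).homog n) :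
    (tensorAlgebraGrading h).Stable X := by
  intro m x hx
  rw [hX hx m]
  split_ifs
  · exact hx
  · exact zero_mem _

lemma stable_one : (tensorAlgebraGrading h).Stable 1 := stable_of_le (one_le_homogeneousPart h)

lemma stable_gens : (tensorAlgebraGrading h).Stable (gens k V) := by
  have : gens k V = ⨆ n, (𝒱 n).map (TensorAlgebra.ι k) := by
    rw [← Submodule.map_iSup, h.submodule_iSup_eq_top, Submodule.map_top]
    rfl
  rw [this]
  exact Grading.Stable.iSup fun n => stable_of_le (map_ι_le_homogeneousPart h n)

lemma stable_pow (hX : (tensorAlgebraGrading h).Stable X) (n : ℕ) :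
    (tensorAlgebraGrading h).Stable (X ^ n) := by
  induction n with
  | zero => rw [pow_zero]; exact stable_one
  | succ n ih => rw [pow_succ]; exact stable_mul ih hX

lemma stable_list_prod {l : List (Submodule k (TensorAlgebra k V))}
    (hl : ∀ X ∈ l, (tensorAlgebraGrading h).Stable X) :
    (tensorAlgebraGrading h).Stable l.prod := by
  induction l with
  | nil => exact stable_one
  | cons X l ih =>
    rw [List.prod_cons]
    exact stable_mul (hl X (by simp)) (ih fun Y hY => hl Y (by simp [hY]))

lemma stable_evenJ {R : Submodule k (TensorAlgebra k V)}
    (hR : (tensorAlgebraGrading h).Stable R) (i : ℕ) :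
    (tensorAlgebraGrading h).Stable (evenJ R i) := by
  induction i using Nat.strong_induction_on with
  | _ i ih =>
    cases i with
    | zero => rw [evenJ_zero]; exact stable_one
    | succ i =>
      rw [evenJ]
      refine Grading.Stable.inf ?_ (stable_pow hR _)
      refine Grading.Stable.iSup fun N => Grading.Stable.iSup fun _ => ?_
      refine Grading.Stable.iInf fun n => Grading.Stable.iInf fun _ => ?_
      refine Grading.Stable.iInf fun m => Grading.Stable.iInf fun _ => ?_
      refine stable_mul (stable_list_prod fun X hX => ?_) (stable_pow stable_gens _)
      obtain ⟨j, rfl⟩ := List.mem_ofFn.1 hX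
      exact stable_mul (stable_pow stable_gens _) (ih _ (n j).isLt)

lemma stable_oddJ {R : Submodule k (TensorAlgebra k V)}
    (hR : (tensorAlgebraGrading h).Stable R) (i : ℕ) :
    (tensorAlgebraGrading h).Stable (oddJ R i) :=
  (stable_mul stable_gens (stable_evenJ hR i)).inf (stable_mul (stable_evenJ hR i) stable_gens)

lemma stable_specialPart (hX : (tensorAlgebraGrading h).Stable X) (N : ℕ) :
    (tensorAlgebraGrading h).Stable (specialPart X N) :=
  Grading.Stable.iInf fun _ => Grading.Stable.iInf fun _ =>
    stable_mul (stable_mul (stable_pow stable_gens _) hX) (stable_pow stable_gens _)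

end TensorAlgebraGrading

/-! ### The total grading of free bimodules -/

section BimoduleGradings

variable {A : Type*} [Ring A] [Algebra k A] {𝒜 : ℕ → Submodule k A} [GradedAlgebra 𝒜]

variable (𝒜) in
lemma homogeneousPart_proj (n : ℕ) :
    homogeneousPart (fun n => GradedAlgebra.proj 𝒜 n) n = 𝒜 n := by
  ext x
  constructor
  · intro hx
    have := hx n
    rw [if_pos rfl, GradedAlgebra.proj_apply] at this
    rw [← this]
    exact SetLike.coe_mem _
  · intro hx m
    rw [GradedAlgebra.proj_apply]
    split_ifs with hmn
    · subst hmn; exact DirectSum.decompose_of_mem_same 𝒜 hx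
    · exact DirectSum.decompose_of_mem_ne 𝒜 hx (Ne.symm hmn)

variable (𝒜) in
/-- The grading of a graded algebra, as a family of projections. -/
def algebraGrading : Grading k A where
  p n := GradedAlgebra.proj 𝒜 n
  iSup_homogeneousPart := by
    simp only [homogeneousPart_proj]
    exact (DirectSum.Decomposition.isInternal 𝒜).submodule_iSup_eq_top

lemma mem_algebraGrading_homog {n : ℕ} {a : A} : a ∈ (algebraGrading 𝒜).homog n ↔ a ∈ 𝒜 n := by
  rw [← homogeneousPart_proj 𝒜 n]
  rfl

variable {W W' : Type*} [AddCommGroup W] [Module k W] [AddCommGroup W'] [Module k W']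

variable (𝒜) in
/-- The total grading of `A ⊗ W ⊗ A`. -/
def bimodGrading (G : Grading k W) : Grading k (FreeBimod k A W) :=
  (algebraGrading 𝒜).tensor (G.tensor (algebraGrading 𝒜))

lemma leftAct_mem_homog (G : Grading k W) {m n : ℕ} {a : A} (ha : a ∈ 𝒜 m) {x : FreeBimod k A W}
    (hx : x ∈ (bimodGrading 𝒜 G).homog n) :
    leftAct k A W a x ∈ (bimodGrading 𝒜 G).homog (m + n) := by
  have h : Submodule.span k (pureTensors (algebraGrading 𝒜).p (G.tensor (algebraGrading 𝒜)).p n) ≤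
      ((bimodGrading 𝒜 G).homog (m + n)).comap (leftAct k A W a) := by
    refine Submodule.span_le.2 ?_
    rintro _ ⟨i, j, rfl, b, hb, y, hy, rfl⟩
    rw [SetLike.mem_coe, Submodule.mem_comap, ← add_assoc]
    exact tmul_mem_homogeneousPart (mem_algebraGrading_homog.2
      (SetLike.mul_mem_graded ha (mem_algebraGrading_homog.1 hb))) hy
  exact h (Grading.mem_span_pureTensors hx)

lemma rightAct_mem_homog (G : Grading k W) {m n : ℕ} {a : A} (ha : a ∈ 𝒜 m) {x : FreeBimod k A W}
    (hx : x ∈ (bimodGrading 𝒜 G).homog n) :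
    rightAct k A W a x ∈ (bimodGrading 𝒜 G).homog (m + n) := by
  have h' : ∀ n, Submodule.span k (pureTensors G.p (algebraGrading 𝒜).p n) ≤
      ((G.tensor (algebraGrading 𝒜)).homog (n + m)).comap
        ((LinearMap.lTensorHom W ∘ₗ (LinearMap.mul k A).flip) a) := by
    intro n
    refine Submodule.span_le.2 ?_
    rintro _ ⟨i, j, rfl, w, hw, b, hb, rfl⟩
    rw [SetLike.mem_coe, Submodule.mem_comap, add_assoc]
    exact tmul_mem_homogeneousPart hw (mem_algebraGrading_homog.2
      (SetLike.mul_mem_graded (mem_algebraGrading_homog.1 hb) ha))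
  have h : Submodule.span k (pureTensors (algebraGrading 𝒜).p (G.tensor (algebraGrading 𝒜)).p n) ≤
      ((bimodGrading 𝒜 G).homog (n + m)).comap (rightAct k A W a) := by
    refine Submodule.span_le.2 ?_
    rintro _ ⟨i, j, rfl, b, hb, y, hy, rfl⟩
    rw [SetLike.mem_coe, Submodule.mem_comap, add_assoc]
    exact tmul_mem_homogeneousPart hb (h' j (Grading.mem_span_pureTensors hy))
  rw [add_comm]
  exact h (Grading.mem_span_pureTensors hx)

lemma isGradedMap_extend {G : Grading k W} {G' : Grading k W'} {f : W →ₗ[k] FreeBimod k A W'}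
    (hf : IsGradedMap G (bimodGrading 𝒜 G') f) :
    IsGradedMap (bimodGrading 𝒜 G) (bimodGrading 𝒜 G') (extend f) := by
  refine isGradedMap_of_tmul fun m n a ha y hy => ?_
  have h : Submodule.span k (pureTensors G.p (algebraGrading 𝒜).p n) ≤
      ((bimodGrading 𝒜 G').homog (m + n)).comap (extend f ∘ₗ TensorProduct.mk k A (W ⊗[k] A) a) := by
    refine Submodule.span_le.2 ?_
    rintro _ ⟨i, j, rfl, w, hw, b, hb, rfl⟩
    rw [SetLike.mem_coe, Submodule.mem_comap, LinearMap.comp_apply, TensorProduct.mk_apply,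
      extend_tmul, add_comm i j]
    exact leftAct_mem_homog G' (mem_algebraGrading_homog.1 ha)
      (rightAct_mem_homog G' (mem_algebraGrading_homog.1 hb) (hf.mem hw))
  exact h (Grading.mem_span_pureTensors hy)

/-- All degrees in `A ⊗ W ⊗ A` are nonnegative, so multiplying by degree at least `n + 1` leaves
nothing in degree `n`. -/
lemma bimodGrading_p_eq_zero {act : A →ₗ[k] Module.End k (FreeBimod k A W)} {G : Grading k W}
    (hact : ∀ {m n : ℕ} {a : A}, a ∈ 𝒜 m → ∀ {x : FreeBimod k A W},
      x ∈ (bimodGrading 𝒜 G).homog n → act a x ∈ (bimodGrading 𝒜 G).homog (m + n)) (n : ℕ)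
    (x : FreeBimod k A W) (hx : x ∈ actGE 𝒜 act (n + 1)) : (bimodGrading 𝒜 G).p n x = 0 := by
  have h1 : ∀ m, n + 1 ≤ m → ∀ a ∈ 𝒜 m, ∀ x, (bimodGrading 𝒜 G).p n (act a x) = 0 := by
    intro m hm a ha x
    have hx : x ∈ ⨆ i, (bimodGrading 𝒜 G).homog i :=
      (bimodGrading 𝒜 G).iSup_homogeneousPart ▸ Submodule.mem_top
    induction hx using Submodule.iSup_induction' with
    | zero => simp
    | add x y _ _ hx hy => rw [map_add, map_add, hx, hy, add_zero]
    | mem i x hx => exact (hact ha hx n).trans (if_neg (by omega))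
  have h : actGE 𝒜 act (n + 1) ≤ LinearMap.ker ((bimodGrading 𝒜 G).p n) := by
    refine Submodule.span_le.2 ?_
    rintro _ ⟨a, ha, x, rfl⟩
    have h2 : degreeGE 𝒜 (n + 1) ≤
        LinearMap.ker ((bimodGrading 𝒜 G).p n ∘ₗ act.flip x) :=
      iSup₂_le fun m hm a ha => h1 m hm a ha x
    exact h2 ha
  exact h hx

end BimoduleGradings

/-! ### Homogeneity of the multi-Koszul differentials -/

namespace MinimalPresentation

variable {A : Type*} [Ring A] [Algebra k A] {𝒜 : ℕ → Submodule k A}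
  {V : Type*} [AddCommGroup V] [Module k V] (P : MinimalPresentation 𝒜 V)

/-- The grading of `T(V)` induced by that of `V`. -/
abbrev tGrading : Grading k (TensorAlgebra k V) := tensorAlgebraGrading P.grading_isInternal

lemma stable_rel : P.tGrading.Stable P.rel := by
  rw [P.rel_graded]
  exact Grading.Stable.iSup fun n => stable_of_le
    (inf_le_right.trans (usualDegree_le_homogeneousPart _ n))

lemma stable_J (i : ℕ) : P.tGrading.Stable (P.J i) := by
  by_cases hi : Even i
  · rw [P.J_even hi]; exact stable_evenJ P.stable_rel _
  · rw [P.J_odd hi]; exact stable_oddJ P.stable_rel _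

variable [GradedAlgebra 𝒜]

lemma isGradedMap_π : IsGradedMap P.tGrading (algebraGrading 𝒜) P.π.toLinearMap := by
  have hι : ∀ n, (P.grading n).map (TensorAlgebra.ι k) ≤ (𝒜 n).comap P.π.toLinearMap := by
    rintro n _ ⟨v, hv, rfl⟩
    rw [Submodule.mem_comap, AlgHom.toLinearMap_apply, P.π_ι]
    exact P.gen_mem n v hv
  -- The homogeneous elements of degree `n` that `π` maps into `𝒜 n` form a multiplicative family
  -- containing the generators, so they span.
  refine isGradedMap_of_iSup (X := fun n => homogeneousPart (tensorAlgebraP P.grading_isInternal) n ⊓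
    (𝒜 n).comap P.π.toLinearMap) (iSup_eq_top_of_mul_le P.grading_isInternal ?_ ?_ ?_)
    (fun n => inf_le_left) fun n x hx => mem_algebraGrading_homog.2 hx.2
  · refine le_inf (one_le_homogeneousPart _) (Submodule.one_le.2 ?_)
    rw [Submodule.mem_comap, AlgHom.toLinearMap_apply, map_one]
    exact SetLike.GradedOne.one_mem
  · exact fun n => le_inf (map_ι_le_homogeneousPart _ n) (hι n)
  · intro a b
    refine le_inf ((mul_le_mul' inf_le_left inf_le_left).trans (homogeneousPart_mul_le _ _ _)) ?_
    refine Submodule.mul_le.2 fun x hx y hy => ?_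
    rw [Submodule.mem_comap, AlgHom.toLinearMap_apply, map_mul]
    exact SetLike.mul_mem_graded hx.2 hy.2

variable {U W : Submodule k (TensorAlgebra k V)}

/-- For a product `x u y` both sides expand over the ways to distribute the degree `n` among the
three factors. Stability keeps every projected factor in its own space, so each term can be cut. -/
lemma cut_p (hU : P.tGrading.Stable U) {l m : ℕ} {z : TensorAlgebra k V}
    (hz : z ∈ gens k V ^ l * U * gens k V ^ m) (n : ℕ) :
    P.cut U l m (P.tGrading.p n z) =
      (bimodGrading 𝒜 (P.tGrading.restrict hU)).p n (P.cut U l m z) := by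
  refine mul_mul_induction hz (fun x hx u hu y hy => ?_) fun z z' hz hz' => ?_
  · have hp : ∀ n x, P.π (tensorAlgebraP P.grading_isInternal n x) =
        (algebraGrading 𝒜).p n (P.π x) := P.isGradedMap_π
    rw [P.cut_mul hx hu hy]
    change _ = tensorP _ (tensorP _ _) n _
    rw [tensorP_tmul, mul_assoc]
    change P.cut U l m (tensorAlgebraP _ n _) = _
    rw [tensorAlgebraP_mul, map_sum]
    refine Finset.sum_congr rfl fun a _ => ?_
    rw [tensorP_tmul, TensorProduct.tmul_sum, tensorAlgebraP_mul, Finset.mul_sum, map_sum]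
    refine Finset.sum_congr rfl fun b _ => ?_
    rw [← mul_assoc, ← hp, ← hp]
    exact P.cut_mul (stable_pow stable_gens l _ x hx) (hU b.1 u hu)
      (stable_pow stable_gens m _ y hy)
  · simp only [map_add, hz, hz']

lemma isGradedMap_oddMap (hU : P.tGrading.Stable U) (hW : P.tGrading.Stable W)
    (hWU : W ≤ gens k V * U ⊓ U * gens k V) :
    IsGradedMap (P.tGrading.restrict hW) (bimodGrading 𝒜 (P.tGrading.restrict hU))
      (P.oddMap U ∘ₗ W.subtype) := by
  rintro n ⟨w, hw⟩
  change P.oddMap U (P.tGrading.p n w) =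
    (bimodGrading 𝒜 (P.tGrading.restrict hU)).p n (P.oddMap U w)
  rw [P.oddMap_eq_cut (hWU hw), P.oddMap_eq_cut (hWU (hW n w hw)), map_sub,
    P.cut_p hU (by simpa using (hWU hw).1), P.cut_p hU (by simpa using (hWU hw).2)]

/-- Special parts are stable under the projections, so projecting a decomposition termwise gives a
decomposition of the projected element, and by independence it computes the differential. -/
lemma isGradedMap_evenMap (hU : P.tGrading.Stable U) (hW : P.tGrading.Stable W)
    (hi : Function.Injective (DirectSum.coeLinearMap (specialPart U)))
    (hWU : ∀ w ∈ W, ∃ f : ℕ →₀ TensorAlgebra k V, (∀ N, f N ∈ specialPart U N) ∧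
      f.sum (fun _ y => y) = w) :
    IsGradedMap (P.tGrading.restrict hW) (bimodGrading 𝒜 (P.tGrading.restrict hU))
      (P.evenMap U ∘ₗ W.subtype) := by
  rintro n ⟨w, hw⟩
  change P.evenMap U (P.tGrading.p n w) =
    (bimodGrading 𝒜 (P.tGrading.restrict hU)).p n (P.evenMap U w)
  obtain ⟨f, hf, rfl⟩ := hWU w hw
  have e : P.tGrading.p n (f.sum fun _ y => y) =
      (f.mapRange (P.tGrading.p n) (map_zero _)).sum fun _ y => y := by
    rw [Finsupp.sum_mapRange_index (fun _ => rfl), Finsupp.sum, map_sum]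
    rfl
  rw [e, P.evenMap_sum hi f hf, P.evenMap_sum hi _ fun N => by
      rw [Finsupp.mapRange_apply]; exact stable_specialPart hU N n _ (hf N),
    Finsupp.sum_mapRange_index (fun _ => by simp), Finsupp.sum, Finsupp.sum, map_sum]
  refine Finset.sum_congr rfl fun N _ => ?_
  rw [map_sum]
  refine Finset.sum_congr rfl fun l hl => P.cut_p hU ?_ n
  exact specialPart_le _ (by have := Finset.mem_range.1 hl; omega) (hf N)

/-- The total grading of `A ⊗ J_i ⊗ A`. -/
def kGrading (i : ℕ) : Grading k (P.K i) := bimodGrading 𝒜 (P.tGrading.restrict (P.stable_J i))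

lemma isGradedMap_d [Nontrivial A] (i : ℕ) :
    IsGradedMap (P.kGrading (i + 1)) (P.kGrading i) (P.d i) := by
  refine isGradedMap_extend ?_
  by_cases hi : Even i
  · rw [P.dJ_even hi]
    refine P.isGradedMap_oddMap (P.stable_J i) (P.stable_J (i + 1)) (le_of_eq ?_)
    rw [P.J_odd (by simpa [Nat.even_add_one] using hi), P.J_even hi]
    have e1 : (i + 1) / 2 = i / 2 := by obtain ⟨m, rfl⟩ := hi; omega
    rw [e1]
    rfl
  · have e1 : (i + 1) / 2 = i / 2 + 1 := by have := Nat.not_even_iff.1 hi; omega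
    rw [P.dJ_odd hi]
    refine P.isGradedMap_evenMap (P.stable_J i) (P.stable_J (i + 1)) ?_ fun w hw => ?_
    · rw [P.J_odd hi]; exact P.specialPart_oddJ_injective _
    · rw [P.J_even (by simpa [Nat.even_add_one] using hi), e1] at hw
      obtain ⟨f, hf, -, hs⟩ := exists_special_decomposition P.rightFree_rel
        (P.rel_le_ker.trans P.ker_le_longWords) hw
      rw [P.J_odd hi]
      exact ⟨f, hf, hs⟩

/-! ### Freeness of the bimodules for either action -/

section Actions

variable (W : Type*) [AddCommGroup W] [Module k W]

/-- A right action is an action of the opposite multiplication. The free generators are `A ⊗ W ⊗ 1`,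
and the comparison map is the associator. -/
lemma isFreeAction_rightAct : IsFreeAction (LinearMap.mul k A).flip (rightAct k A W)
    ((((TensorProduct.mk k W A).flip 1)).lTensor A) where
  bijective := by
    have : actMap (rightAct k A W) (((TensorProduct.mk k W A).flip 1).lTensor A) =
        (TensorProduct.assoc k A W A).toLinearMap := by
      ext a w b
      simp
    rw [this]
    exact (TensorProduct.assoc k A W A).bijective
  act_mul a b x := rightAct_mul b a x
  act_one := rightAct_one

lemma isFreeAction_leftAct : IsFreeAction (LinearMap.mul k A) (leftAct k A W)
    (TensorProduct.mk k A (W ⊗[k] A) 1) where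
  bijective := by
    have : actMap (leftAct k A W) (TensorProduct.mk k A (W ⊗[k] A) 1) =
        (TensorProduct.comm k (W ⊗[k] A) A).toLinearMap := by
      refine TensorProduct.ext' fun y a => ?_
      rw [actMap_tmul, TensorProduct.mk_apply]
      change (a * 1) ⊗ₜ y = a ⊗ₜ y
      rw [mul_one]
    rw [this]
    exact (TensorProduct.comm k (W ⊗[k] A) A).bijective
  act_mul a b x := leftAct_mul a b x
  act_one := leftAct_one

lemma isFreeAction_self {ν : A →ₗ[k] A →ₗ[k] A} (h1 : ∀ a, ν a 1 = a) (h1' : ∀ a, ν 1 a = a)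
    (hm : ∀ a b c, ν (ν a b) c = ν a (ν b c)) :
    IsFreeAction ν ν (Algebra.linearMap k A) where
  bijective := by
    have : actMap ν (Algebra.linearMap k A) = (TensorProduct.lid k A).toLinearMap := by
      refine TensorProduct.ext' fun c a => ?_
      rw [actMap_tmul, Algebra.linearMap_apply, Algebra.algebraMap_eq_smul_one, map_smul, h1]
      simp
    rw [this]
    exact (TensorProduct.lid k A).bijective
  act_mul := hm
  act_one := h1'

lemma isGradedMul_mul : IsGradedMul 𝒜 (LinearMap.mul k A) where
  mul_one := mul_one
  mem ha hb := SetLike.mul_mem_graded ha hb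

lemma isGradedMul_flip : IsGradedMul 𝒜 (LinearMap.mul k A).flip where
  mul_one := one_mul
  mem {m n a b} ha hb := by
    rw [add_comm]
    exact SetLike.mul_mem_graded hb ha

end Actions

end MinimalPresentation

/-! ### Exactness of quotient complexes in terms of representatives -/

section Quotients

variable {M N Q : Type*} [AddCommGroup M] [Module k M] [AddCommGroup N] [Module k N]
  [AddCommGroup Q] [Module k Q] {p : Submodule k M} {q : Submodule k N} {r : Submodule k Q}
  {f : M →ₗ[k] N} {g : N →ₗ[k] Q}

lemma exact_mapQ_liftQ_iff (hf : p ≤ q.comap f) (hg : q ≤ LinearMap.ker g)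
    (hgf : ∀ x, g (f x) = 0) :
    Function.Exact (p.mapQ q f hf) (q.liftQ g hg) ↔ ∀ x, g x = 0 → ∃ y, x - f y ∈ q := by
  constructor
  · intro h x hx
    obtain ⟨y, hy⟩ := (h (q.mkQ x)).1 (by simpa using hx)
    obtain ⟨y, rfl⟩ := p.mkQ_surjective y
    exact ⟨y, (Submodule.Quotient.eq q).1 hy.symm⟩
  · intro h x
    obtain ⟨x, rfl⟩ := q.mkQ_surjective x
    constructor
    · intro hx
      obtain ⟨y, hy⟩ := h x (by simpa using hx)
      exact ⟨p.mkQ y, ((Submodule.Quotient.eq q).2 hy).symm⟩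
    · rintro ⟨y, hy⟩
      obtain ⟨y, rfl⟩ := p.mkQ_surjective y
      rw [← hy]
      simp [hgf]

/-- This is `exact_mapQ_liftQ_iff` for `g` followed by the projection to the quotient by `r`. -/
lemma exact_mapQ_mapQ_iff (hf : p ≤ q.comap f) (hg : q ≤ r.comap g) (hgf : ∀ x, g (f x) = 0) :
    Function.Exact (p.mapQ q f hf) (q.mapQ r g hg) ↔ ∀ x, g x ∈ r → ∃ y, x - f y ∈ q := by
  have h := exact_mapQ_liftQ_iff (g := r.mkQ ∘ₗ g) hf
    (hg.trans_eq (by rw [LinearMap.ker_comp, Submodule.ker_mkQ])) (fun x => by simp [hgf])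
  simp only [LinearMap.comp_apply, Submodule.mkQ_apply, Submodule.Quotient.mk_eq_zero] at h
  exact h

end Quotients

/-! ### The augmentation and the irrelevant ideal -/

section Irrelevant

variable {A : Type*} [Ring A] [Algebra k A] {𝒜 : ℕ → Submodule k A} [GradedAlgebra 𝒜]

lemma augmentation_algebraMap [Nontrivial A] (c : k) :
    augmentation 𝒜 (algebraMap k A c) = c := by
  rw [augmentation, LinearMap.comp_apply, GradedAlgebra.proj_apply,
    DirectSum.decompose_of_mem_same 𝒜 (SetLike.algebraMap_mem_graded 𝒜 c)]
  exact linearInverse_apply (Algebra.linearMap k A) (algebraMap k A).injective c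

lemma augmentation_eq_zero_iff [Nontrivial A] (connected : 𝒜 0 = 1) (a : A) :
    augmentation 𝒜 a = 0 ↔ a ∈ irrelevant 𝒜 := by
  constructor
  · intro h
    obtain ⟨a₀, ha₀, a₁, ha₁, rfl⟩ :=
      Submodule.mem_sup.1 (degreeGE_le_sup 𝒜 0 (mem_degreeGE_zero (𝒜 := 𝒜) a))
    rw [connected] at ha₀
    obtain ⟨c, rfl⟩ := Submodule.mem_one.1 ha₀
    have h1 : augmentation 𝒜 a₁ = 0 := by
      have := augmentation_mul_right 𝒜 1 ha₁
      rwa [one_mul] at this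
    rw [map_add, h1, add_zero, augmentation_algebraMap] at h
    rw [h, map_zero, zero_add]
    exact ha₁
  · intro h
    have := augmentation_mul_right 𝒜 1 h
    rwa [one_mul] at this

lemma actGE_self_one {ν : A →ₗ[k] A →ₗ[k] A} (hν : IsGradedMul 𝒜 ν) :
    actGE 𝒜 (K := A) ν 1 = irrelevant 𝒜 := by
  refine le_antisymm (Submodule.span_le.2 ?_) fun a ha => ?_
  · rintro _ ⟨a, ha, x, rfl⟩
    exact hν.mem_degreeGE (m := 1) (n := 0) ha (mem_degreeGE_zero x)
  · have h := act_mem_actGE (𝒜 := 𝒜) (K := A) (act := ν) (m := 1) ha 1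
    rwa [hν.mul_one] at h

end Irrelevant

/-! ### Comparison of the bimodule complex with its one-sided reductions -/

namespace MinimalPresentation

variable {A : Type*} [Ring A] [Algebra k A] {𝒜 : ℕ → Submodule k A}
  {V : Type*} [AddCommGroup V] [Module k V] (P : MinimalPresentation 𝒜 V)

lemma d₀_surjective : Function.Surjective P.d₀ := by
  intro a
  have h1 : (1 : TensorAlgebra k V) ∈ P.J 0 := by
    rw [P.J_even Even.zero, Nat.zero_div, evenJ_zero]
    exact Submodule.one_le.1 le_rfl
  exact ⟨a ⊗ₜ ((⟨1, h1⟩ : P.J 0) ⊗ₜ 1), by simp [d₀]⟩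

variable [GradedAlgebra 𝒜]

/-- Exactness of the complex obtained from the augmented bimodule complex by dividing out the
action of the irrelevant ideal. -/
def ReducedExact (act : ∀ i, A →ₗ[k] Module.End k (P.K i)) : Prop :=
  (∀ x, P.d₀ x ∈ irrelevant 𝒜 → ∃ y, x - P.d 0 y ∈ actGE 𝒜 (act 0) 1) ∧
    ∀ i x, P.d i x ∈ actGE 𝒜 (act i) 1 → ∃ y, x - P.d (i + 1) y ∈ actGE 𝒜 (act (i + 1)) 1

variable [Nontrivial A]

/-- Surjectivity onto `k` is automatic, and `rightIrr` unfolds to the part of filtration at least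
`1` for the right action. Connectedness identifies the kernel of the augmentation with `A_{>0}`. -/
lemma isLeftMultiKoszul_iff (connected : 𝒜 0 = 1) :
    P.IsLeftMultiKoszul ↔ P.ReducedExact fun i => rightAct k A (P.J i) := by
  have hs : Function.Surjective P.dLeft₀ := by
    intro c
    obtain ⟨x, hx⟩ := P.d₀_surjective (algebraMap k A c)
    refine ⟨(P.rightIrr 0).mkQ x, ?_⟩
    refine (Submodule.liftQ_apply _ _ _).trans ?_
    rw [LinearMap.comp_apply, hx, augmentation_algebraMap]
  have h0 := exact_mapQ_liftQ_iff (P.rightIrr_le 0) P.rightIrr_zero_le fun x => by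
    rw [LinearMap.comp_apply, P.d₀_d, map_zero]
  have h1 := fun i => exact_mapQ_mapQ_iff (P.rightIrr_le (i + 1)) (P.rightIrr_le i) (P.d_d i)
  rw [IsLeftMultiKoszul, ReducedExact]
  refine (and_iff_right hs).trans (and_congr (h0.trans ?_) (forall_congr' h1))
  refine forall_congr' fun x => imp_congr ?_ Iff.rfl
  rw [LinearMap.comp_apply, augmentation_eq_zero_iff connected]

lemma isRightMultiKoszul_iff (connected : 𝒜 0 = 1) :
    P.IsRightMultiKoszul ↔ P.ReducedExact fun i => leftAct k A (P.J i) := by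
  have hs : Function.Surjective P.dRight₀ := by
    intro c
    obtain ⟨x, hx⟩ := P.d₀_surjective (algebraMap k A c)
    refine ⟨(P.leftIrr 0).mkQ x, ?_⟩
    refine (Submodule.liftQ_apply _ _ _).trans ?_
    rw [LinearMap.comp_apply, hx, augmentation_algebraMap]
  have h0 := exact_mapQ_liftQ_iff (P.leftIrr_le 0) P.leftIrr_zero_le fun x => by
    rw [LinearMap.comp_apply, P.d₀_d, map_zero]
  have h1 := fun i => exact_mapQ_mapQ_iff (P.leftIrr_le (i + 1)) (P.leftIrr_le i) (P.d_d i)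
  rw [IsRightMultiKoszul, ReducedExact]
  refine (and_iff_right hs).trans (and_congr (h0.trans ?_) (forall_congr' h1))
  refine forall_congr' fun x => imp_congr ?_ Iff.rfl
  rw [LinearMap.comp_apply, augmentation_eq_zero_iff connected]

/-- The bimodule complex is exact if and only if one of its one-sided reductions is. -/
lemma reducedExact_iff (connected : 𝒜 0 = 1) {ν : A →ₗ[k] A →ₗ[k] A} (hν : IsGradedMul 𝒜 ν)
    (hA : IsFreeAction ν ν (Algebra.linearMap k A))
    {act : ∀ i, A →ₗ[k] Module.End k (P.K i)} {L : ℕ → Type*} [∀ i, AddCommGroup (L i)]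
    [∀ i, Module k (L i)] {j : ∀ i, L i →ₗ[k] P.K i} (hfree : ∀ i, IsFreeAction ν (act i) (j i))
    (hd : ∀ i, Equivariant (act (i + 1)) (act i) (P.d i))
    (hd₀ : Equivariant (act 0) ν P.d₀)
    (hact : ∀ i {m n : ℕ} {a : A}, a ∈ 𝒜 m → ∀ {x : P.K i},
      x ∈ (P.kGrading i).homog n → act i a x ∈ (P.kGrading i).homog (m + n)) :
    P.ReducedExact act ↔ P.BimoduleComplexExact := by
  have hI := actGE_self_one hν
  constructor
  · rintro ⟨h0, h1⟩
    refine ⟨P.d₀_surjective, fun x => ⟨fun hx => ?_, ?_⟩, fun i x => ⟨fun hx => ?_, ?_⟩⟩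
    · exact mem_range_of_eq_zero hν connected (hfree 0) hA (hd 0) hd₀ P.d₀_d
        (fun x hx => h0 x (hI ▸ hx)) (q := (P.kGrading 0).p) (q' := (P.kGrading 1).p)
        (fun n y => (P.isGradedMap_d 0 n y).symm) (bimodGrading_p_eq_zero (hact 0))
        (fun N x => (P.kGrading 0).mem_of_forall N x) x hx
    · rintro ⟨y, rfl⟩
      exact P.d₀_d y
    · exact mem_range_of_eq_zero hν connected (hfree (i + 1)) (hfree i) (hd (i + 1)) (hd i)
        (P.d_d i) (h1 i) (q := (P.kGrading (i + 1)).p) (q' := (P.kGrading (i + 2)).p)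
        (fun n y => (P.isGradedMap_d (i + 1) n y).symm) (bimodGrading_p_eq_zero (hact (i + 1)))
        (fun N x => (P.kGrading (i + 1)).mem_of_forall N x) x hx
    · rintro ⟨y, rfl⟩
      exact P.d_d i y
  · rintro ⟨hs, h0, h1⟩
    have h0' : ∀ x, P.d₀ x = 0 → ∃ y, P.d 0 y = x := fun x hx => (h0 x).1 hx
    have h1' : ∀ i x, P.d i x = 0 → ∃ y, P.d (i + 1) y = x := fun i x hx => (h1 i x).1 hx
    -- The complex is continued by the zero map out of `A`, onto whose kernel the identity retracts.
    -- This starts the induction, surjectivity of `d₀` being exactness at `A`.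
    have hA0 : HasRetraction ν (0 : A →ₗ[k] A) :=
      ⟨LinearMap.id, fun _ _ => rfl, fun _ => rfl, fun _ _ => rfl⟩
    have hr₀ : HasRetraction (act 0) P.d₀ := hA0.succ hA (hfree 0).act_mul hd₀
      (fun _ => rfl) fun x _ => hs x
    have hr : ∀ i, HasRetraction (act (i + 1)) (P.d i) := by
      intro i
      induction i with
      | zero => exact hr₀.succ (hfree 0) (hfree 1).act_mul (hd 0) P.d₀_d h0'
      | succ i ih =>
        exact ih.succ (hfree (i + 1)) (hfree (i + 2)).act_mul (hd (i + 1)) (P.d_d i) (h1' i)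
    refine ⟨fun x hx => ?_, fun i x hx => ?_⟩
    -- At the augmentation the identity serves as the retraction, since the image of `d₀` is all of
    -- `A`.
    · exact exists_sub_mem_of_retraction hd₀ h0' (r := LinearMap.id) (fun _ _ => rfl) hs
        (fun _ => rfl) (hI.symm ▸ hx)
    · cases i with
      | zero =>
        obtain ⟨r, hre, hr0, hr1⟩ := hr₀
        exact exists_sub_mem_of_retraction (hd 0) (h1' 0) hre (fun y => h0' _ (hr0 y))
          (fun x => hr1 _ (P.d₀_d x)) hx
      | succ i =>
        obtain ⟨r, hre, hr0, hr1⟩ := hr i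
        exact exists_sub_mem_of_retraction (hd (i + 1)) (h1' (i + 1)) hre
          (fun y => h1' i _ (hr0 y)) (fun x => hr1 _ (P.d_d i x)) hx

end MinimalPresentation

end

end MultiKoszul

theorem proposition3p7 {k A V : Type*} [Field k] [Ring A] [Nontrivial A] [Algebra k A]
    (𝒜 : ℕ → Submodule k A) [GradedAlgebra 𝒜]
    (connected : 𝒜 0 = 1) (locally_finite : ∀ n, FiniteDimensional k (𝒜 n))
    [AddCommGroup V] [Module k V] (P : MultiKoszul.MinimalPresentation 𝒜 V) :
    List.TFAE [P.IsLeftMultiKoszul, P.BimoduleComplexExact, P.IsRightMultiKoszul] := by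
  open MultiKoszul MultiKoszul.MinimalPresentation in
  -- The left complex is obtained by killing the right action of `A_{>0}`, so the comparison runs
  -- over the opposite multiplication.
  tfae_have 1 ↔ 2 := (P.isLeftMultiKoszul_iff connected).trans <|
    P.reducedExact_iff connected isGradedMul_flip
      (isFreeAction_self one_mul mul_one fun a b c => (mul_assoc c b a).symm)
      (fun i => isFreeAction_rightAct (P.J i)) (fun i a x => P.d_rightAct i a x)
      (fun a x => P.d₀_rightAct a x) fun i _ _ _ ha _ hx => rightAct_mem_homog _ ha hx
  open MultiKoszul MultiKoszul.MinimalPresentation in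
  tfae_have 3 ↔ 2 := (P.isRightMultiKoszul_iff connected).trans <|
    P.reducedExact_iff connected isGradedMul_mul
      (isFreeAction_self mul_one one_mul mul_assoc)
      (fun i => isFreeAction_leftAct (P.J i)) (fun i a x => P.d_leftAct i a x)
      (fun a x => P.d₀_leftAct a x) fun i _ _ _ ha _ hx => leftAct_mem_homog _ ha hx
  tfae_finish
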